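/- **Conventions.** A tree is a finite (possibly empty) connected graph without cycles; a leaf is a vertex of valence at most one (so the vertex of a one-vertex tree is a leaf). For a tree $T$, let $L(T)$ be its set of leaves with the quaternary relation $R(x_1,x_2;y_1,y_2)$: the four leaves are distinct, and the path from $x_1$ to $x_2$ has an edge in common with the path from $y_1$ to $y_2$. Let $\mathfrak{T}$ be the class of structures isomorphic to some $L(T)$. An embedding is an injection that preserves and reflects $R$. An amalgamation of embeddings $X\to Y$, $X\to X'$ is a structure $Z$ in $\mathfrak{T}$ with embeddings $Y\to Z$, $X'\to Z$ that agree on $X$ and are jointly surjective; isomorphisms of amalgamations respect the two embeddings. A measure for $\mathfrak{T}$ with values in a commutative ring $k$ assigns to each embedding $i$ in $\mathfrak{T}$ an element $\mu(i)\in k$ such that (a) $\mu(i)=1$ if $i$ is an isomorphism; (b) $\mu(j\circ i)=\mu(j)\mu(i)$; (c) for embeddings $i\colon X\to Y$ and $X\to X'$, one has $\mu(i)=\sum_\alpha\mu(i'_\alpha)$, where $i'_\alpha\colon X'\to Y'_\alpha$ runs over the amalgamations of $Y$ and $X'$ over $X$ up to isomorphism. The universal measure ring $\Theta(\mathfrak{T})$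 is the commutative ring generated by symbols $[i]$, one for each embedding $i$ in $\mathfrak{T}$, subject to the relations (a)–(c) with $[\cdot]$ in place of $\mu$. A marked tree $(T,a)$ (a tree with a chosen leaf $a$) gives the embedding $L(T)\setminus a\to L(T)$, whose class in $\Theta(\mathfrak{T})$, respectively whose value under a measure $\mu$, is called the class, respectively the $\mu$-value, of $(T,a)$. Let $x_m$ ($m\ge1$), $y$, $z$ be the classes of the marked trees $X_m$, $Y$, $Z$, where: $X_1,X_2$ are the trees with one and two vertices and, for $m\ge3$, $X_m$ is the star with $m$ leaves joined to one node, with one leaf marked; $Y$ has two adjacent nodes with two leaves each, one leaf marked; $Z$ has a node joined to the marked leaf and to two further nodes, each of which carries two leaves. **Theorem.** There is a ring isomorphism $i\colon\Theta(\mathfrak{T})\to\mathbf{Z}[u,v]/(uv)$ satisfying $$i(x_1)=u+v+2,\quad i(x_2)=u+v+1,\quad i(x_3)=u+v,\quad i(x_m)=v+1-(m-2)(u+1)\ (m\ge4),\quad i(y)=u,\quad i(z)=u-v.$$ In particular there are exactly two one-parameter families of measures: for every integral domain $k$ and every $t\in k$ there is a unique $k$-valued measure $\alpha_t$ whose values at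 $Y$ and $Z$ are $t$ and $t$ (the specialization $u=t$, $v=0$), and a unique $k$-valued measure $\beta_t$ whose values at $Y$ and $Z$ are $0$ and $-t$ (the specialization $u=0$, $v=t$); and every $k$-valued measure for $\mathfrak{T}$ takes equal values at $Y$ and $Z$ or the value $0$ at $Y$, so it is one of the $\alpha_t$ or one of the $\beta_t$. -/

import Mathlib

namespace TreeMeasures

open scoped FirstOrder

universe u v w

section General

variable {L : FirstOrder.Language.{u, v}}

/-- The induced structure on a subset of a structure for a relational language. -/
def induced [L.IsRelational] (X : CategoryTheory.Bundled.{w} L.Structure) (s : Set X) :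
    CategoryTheory.Bundled.{w} L.Structure :=
  ⟨s, { funMap := fun f _ => isEmptyElim f
        RelMap := fun r x => FirstOrder.Language.Structure.RelMap (M := X) r fun i => (x i : X) }⟩

/-- The inclusion of an induced structure. -/
def inducedIncl [L.IsRelational] (X : CategoryTheory.Bundled.{w} L.Structure) (s : Set X) :
    induced X s ↪[L] X where
  toFun := fun x => x.1
  inj' := Subtype.val_injective
  map_fun' := fun f _ => isEmptyElim f
  map_rel' := fun _ _ => Iff.rfl

variable (K : Set (CategoryTheory.Bundled.{w} L.Structure))

/-- An embedding between two structures of the class `K`. -/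
structure Emb where
  src : K
  tgt : K
  hom : src.1 ↪[L] tgt.1

variable {K}

/-- An amalgamation, in the class `K`, of `Y₁` and `Y₂` over `X`. -/
structure Amalgam {X Y₁ Y₂ : K} (i₁ : X.1 ↪[L] Y₁.1) (i₂ : X.1 ↪[L] Y₂.1) where
  Z : K
  j₁ : Y₁.1 ↪[L] Z.1
  j₂ : Y₂.1 ↪[L] Z.1
  comm : j₁.comp i₁ = j₂.comp i₂
  cover : Set.range j₁ ∪ Set.range j₂ = Set.univ

/-- Two amalgamations are isomorphic if there is an isomorphism of structures compatible with
the two given embeddings. -/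
def Amalgam.Iso {X Y₁ Y₂ : K} {i₁ : X.1 ↪[L] Y₁.1} {i₂ : X.1 ↪[L] Y₂.1}
    (A B : Amalgam i₁ i₂) : Prop :=
  ∃ e : A.Z.1 ≃[L] B.Z.1, e.toEmbedding.comp A.j₁ = B.j₁ ∧ e.toEmbedding.comp A.j₂ = B.j₂

/-- The finite family `A` lists all amalgamations up to isomorphism, each exactly once. -/
def IsAmalgamList {X Y₁ Y₂ : K} {i₁ : X.1 ↪[L] Y₁.1} {i₂ : X.1 ↪[L] Y₂.1} {n : ℕ}
    (A : Fin n → Amalgam i₁ i₂) : Prop :=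
  ∀ B : Amalgam i₁ i₂, ∃! α : Fin n, B.Iso (A α)

variable (K)

/-- A measure for the class `K` with values in the commutative ring `k`. -/
structure ClassMeasure (k : Type*) [CommRing k] where
  val : Emb K → k
  val_iso : ∀ (X Y : K) (e : X.1 ≃[L] Y.1), val ⟨X, Y, e.toEmbedding⟩ = 1
  val_comp : ∀ (X Y Z : K) (i : X.1 ↪[L] Y.1) (j : Y.1 ↪[L] Z.1),
    val ⟨X, Z, j.comp i⟩ = val ⟨Y, Z, j⟩ * val ⟨X, Y, i⟩
  val_amalgam : ∀ (X Y X' : K) (i : X.1 ↪[L] Y.1) (f : X.1 ↪[L] X'.1) (n : ℕ)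
    (A : Fin n → Amalgam i f), IsAmalgamList A →
    val ⟨X, Y, i⟩ = ∑ α, val ⟨X', (A α).Z, (A α).j₂⟩

/-- The elements of the polynomial ring on the symbols `[i]` that are set to zero in the
universal measure ring. -/
inductive ThetaRel : MvPolynomial (Emb K) ℤ → Prop
  | iso (X Y : K) (e : X.1 ≃[L] Y.1) :
      ThetaRel (MvPolynomial.X ⟨X, Y, e.toEmbedding⟩ - 1)
  | comp (X Y Z : K) (i : X.1 ↪[L] Y.1) (j : Y.1 ↪[L] Z.1) :
      ThetaRel (MvPolynomial.X ⟨X, Z, j.comp i⟩ -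
        MvPolynomial.X ⟨Y, Z, j⟩ * MvPolynomial.X ⟨X, Y, i⟩)
  | amalgam (X Y X' : K) (i : X.1 ↪[L] Y.1) (f : X.1 ↪[L] X'.1) (n : ℕ)
      (A : Fin n → Amalgam i f) (hA : IsAmalgamList A) :
      ThetaRel (MvPolynomial.X ⟨X, Y, i⟩ -
        ∑ α, MvPolynomial.X ⟨X', (A α).Z, (A α).j₂⟩)

/-- The universal measure ring `Θ(K)`. -/
abbrev Theta : Type _ :=
  MvPolynomial (Emb K) ℤ ⧸ Ideal.span {p : MvPolynomial (Emb K) ℤ | ThetaRel K p}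

variable {K}

/-- The class `[i]` of an embedding `i` in the universal measure ring. -/
noncomputable def Theta.cls (i : Emb K) : Theta K :=
  Ideal.Quotient.mk (Ideal.span {p : MvPolynomial (Emb K) ℤ | ThetaRel K p}) (MvPolynomial.X i)

end General

/-- The relation symbols of the language with a single relation, of arity four. -/
inductive QuatRel : ℕ → Type
  | R : QuatRel 4

/-- The language with a single quaternary relation. -/
def quatLang : FirstOrder.Language.{0, 0} := ⟨fun _ => Empty, QuatRel⟩

instance : quatLang.IsRelational := fun _ => inferInstanceAs (IsEmpty Empty)

section Trees

variable {V : Type}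

/-- A (possibly empty) tree: a graph without cycles in which any two vertices are connected.
Finiteness of the vertex set is imposed separately. -/
def IsTreeGraph (G : SimpleGraph V) : Prop := G.Preconnected ∧ G.IsAcyclic

/-- A leaf is a vertex with at most one neighbour: in a tree with at least two vertices this is a
vertex of valence one, and the vertex of the one-vertex tree is a leaf. -/
def IsLeaf (G : SimpleGraph V) (a : V) : Prop := (G.neighborSet a).Subsingleton

/-- `x₁, x₂, y₁, y₂` are distinct and the path from `x₁` to `x₂` has a common edge with the path
from `y₁` to `y₂`. (In a tree there is exactly one path between two vertices.) -/
def PathsCross (G : SimpleGraph V) (x₁ x₂ y₁ y₂ : V) : Prop :=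
  [x₁, x₂, y₁, y₂].Nodup ∧ ∃ (p : G.Walk x₁ x₂) (q : G.Walk y₁ y₂),
    p.IsPath ∧ q.IsPath ∧ ∃ e, e ∈ p.edges ∧ e ∈ q.edges

/-- A set `S` of vertices of `G` with the path-crossing relation. -/
def crossStructure (G : SimpleGraph V) (S : Set V) :
    CategoryTheory.Bundled.{0} quatLang.Structure :=
  ⟨S, { funMap := fun f _ => isEmptyElim f
        RelMap := fun {n} (r : QuatRel n) => match n, r with
          | _, QuatRel.R => fun x => PathsCross G (x 0 : S) (x 1 : S) (x 2 : S) (x 3 : S) }⟩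

/-- The structure `L(G)`: the set of leaves of `G` with the path-crossing relation. -/
def leafStructure (G : SimpleGraph V) : CategoryTheory.Bundled.{0} quatLang.Structure :=
  crossStructure G {a | IsLeaf G a}

end Trees

/-- The class `𝔗` of tree structures: structures isomorphic to the leaf structure of a finite
tree. -/
def treeClass : Set (CategoryTheory.Bundled.{0} quatLang.Structure) :=
  {X | ∃ (V : Type) (_ : Finite V) (G : SimpleGraph V),
    IsTreeGraph G ∧ Nonempty (X ≃[quatLang] leafStructure G)}

section Hereditary

variable {V : Type}

theorem mem_edges_map_induce (G : SimpleGraph V) (s : Set V) {a b : s}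
    (p : (G.induce s).Walk a b) (e : Sym2 V) :
    e ∈ (p.map (SimpleGraph.Embedding.induce s).toHom).edges ↔
      ∃ e' ∈ p.edges, e'.map Subtype.val = e := by
  rw [SimpleGraph.Walk.edges_map, List.mem_map]
  rfl

theorem pathsCross_induce (G : SimpleGraph V) (s : Set V)
    (hs : ∀ v ∉ s, IsLeaf G v) (a b c d : s) :
    PathsCross (G.induce s) a b c d ↔ PathsCross G a b c d := by
  have hN : [a, b, c, d].Nodup ↔ [(a : V), b, c, d].Nodup := by
    simp [Subtype.ext_iff]
  have hpath : ∀ (x y : s) (p : G.Walk x y), p.IsPath → ∀ z ∈ p.support, z ∈ s := by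
    intro x y p hp z hz
    by_contra hzs
    exact hp.not_mem_support_of_subsingleton_neighborSet (by rintro rfl; exact hzs x.2)
      (by rintro rfl; exact hzs y.2) (hs z hzs) hz
  unfold PathsCross
  rw [hN]
  refine and_congr_right fun _ => ⟨?_, ?_⟩
  · rintro ⟨p, q, hp, hq, e, hep, heq⟩
    refine ⟨p.map (SimpleGraph.Embedding.induce s).toHom,
      q.map (SimpleGraph.Embedding.induce s).toHom,
      SimpleGraph.Walk.IsPath.map Subtype.val_injective hp,
      SimpleGraph.Walk.IsPath.map Subtype.val_injective hq,
      e.map Subtype.val, ?_, ?_⟩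
    · exact (mem_edges_map_induce G s p _).2 ⟨e, hep, rfl⟩
    · exact (mem_edges_map_induce G s q _).2 ⟨e, heq, rfl⟩
  · rintro ⟨p, q, hp, hq, e, hep, heq⟩
    have hp' := SimpleGraph.Walk.map_induce p (hpath a b p hp)
    have hq' := SimpleGraph.Walk.map_induce q (hpath c d q hq)
    refine ⟨p.induce s (hpath a b p hp), q.induce s (hpath c d q hq), ?_, ?_, ?_⟩
    · rw [← hp'] at hp
      exact hp.of_map
    · rw [← hq'] at hq
      exact hq.of_map
    · rw [← hp'] at hep
      rw [← hq'] at heq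
      obtain ⟨e₁, h₁, rfl⟩ := (mem_edges_map_induce G s _ _).1 hep
      obtain ⟨e₂, h₂, h⟩ := (mem_edges_map_induce G s _ _).1 heq
      have : e₂ = e₁ := Sym2.map.injective Subtype.val_injective h
      exact ⟨e₁, h₁, this ▸ h₂⟩

theorem crossStructure_mem (n : ℕ) : ∀ (V : Type) [Finite V] (G : SimpleGraph V) (S : Set V),
    Nat.card V = n → IsTreeGraph G → (∀ a ∈ S, IsLeaf G a) →
    crossStructure G S ∈ treeClass := by
  induction n with
  | zero =>
    intro V _ G S hn hG hS
    have : IsEmpty V := (Nat.card_eq_zero.1 hn).resolve_right (by simpa using ‹Finite V›)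
    have hSe : S = {a | IsLeaf G a} := by ext a; exact this.elim a
    subst hSe
    exact ⟨V, ‹_›, G, hG, ⟨FirstOrder.Language.Equiv.refl _ _⟩⟩
  | succ n ih =>
    intro V _ G S hn hG hS
    by_cases h : ∃ a, IsLeaf G a ∧ a ∉ S
    · obtain ⟨a, ha, haS⟩ := h
      have hleaf : ∀ v ∉ ({a}ᶜ : Set V), IsLeaf G v := by
        intro v hv
        simp only [Set.mem_compl_iff, Set.mem_singleton_iff, not_not] at hv
        exact hv ▸ ha
      have hmem := ih ({a}ᶜ : Set V) (G.induce {a}ᶜ) (Subtype.val ⁻¹' S)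
        (by
          have h1 := Set.ncard_add_ncard_compl ({a} : Set V)
          rw [Set.ncard_singleton, hn] at h1
          have h2 : Nat.card ({a}ᶜ : Set V) = ({a}ᶜ : Set V).ncard := rfl
          omega)
        ⟨hG.1.induce_of_degree_eq_one hleaf, hG.2.induce _⟩
        (by
          intro b hb c hc d hd
          exact Subtype.ext (hS _ hb hc hd))
      obtain ⟨W, hW, H, hH, ⟨e⟩⟩ := hmem
      have key : crossStructure G S ≃[quatLang]
          crossStructure (G.induce ({a}ᶜ : Set V)) (Subtype.val ⁻¹' S) :=
        { toFun := fun x => ⟨⟨x.1, fun hx => haS (by rw [← Set.mem_singleton_iff.1 hx]; exact x.2)⟩,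
            x.2⟩
          invFun := fun x => ⟨x.1.1, x.2⟩
          left_inv := fun _ => rfl
          right_inv := fun _ => rfl
          map_fun' := fun f _ => isEmptyElim f
          map_rel' := by
            intro m r x
            cases r
            exact pathsCross_induce G {a}ᶜ hleaf _ _ _ _ }
      exact ⟨W, hW, H, hH, ⟨e.comp key⟩⟩
    · push Not at h
      have hSe : S = {a | IsLeaf G a} := Set.Subset.antisymm hS h
      subst hSe
      exact ⟨V, ‹_›, G, hG, ⟨FirstOrder.Language.Equiv.refl _ _⟩⟩

/-- A structure induced from a tree structure is a tree structure. -/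
theorem induced_mem_treeClass {X : CategoryTheory.Bundled.{0} quatLang.Structure}
    (hX : X ∈ treeClass) (s : Set X) : induced X s ∈ treeClass := by
  obtain ⟨V, _, G, hG, ⟨e⟩⟩ := hX
  let S : Set V := {a | ∃ x ∈ s, (e x).1 = a}
  have hmem := crossStructure_mem _ V G S rfl hG (by rintro a ⟨x, -, rfl⟩; exact (e x).2)
  obtain ⟨W, hW, H, hH, ⟨f⟩⟩ := hmem
  have hinj : Function.Injective fun x : X => (e x).1 :=
    Subtype.val_injective.comp e.injective
  let E : s ≃ S := Equiv.ofBijective (fun x => ⟨(e x.1).1, x.1, x.2, rfl⟩)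
    ⟨fun x y h => Subtype.ext (hinj (congrArg (fun z : S => z.1) h)), by
      rintro ⟨a, x, hx, rfl⟩; exact ⟨⟨x, hx⟩, rfl⟩⟩
  have key : induced X s ≃[quatLang] crossStructure G S :=
    { E with
      map_fun' := fun f _ => isEmptyElim f
      map_rel' := by
        intro m r x
        have := e.map_rel r (fun i => (x i).1)
        cases r
        exact this }
  exact ⟨W, hW, H, hH, ⟨f.comp key⟩⟩

end Hereditary

/-- The tree structure `L(G)` of a finite tree `G`, as a member of `𝔗`. -/
def treeObj {V : Type} [Finite V] (G : SimpleGraph V) (hG : IsTreeGraph G) : treeClass :=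
  ⟨leafStructure G, V, ‹_›, G, hG, ⟨FirstOrder.Language.Equiv.refl _ _⟩⟩

/-- The one-point extension `X \ a → X` attached to a marked structure `(X, a)` of `𝔗`. -/
def markedEmb (X : treeClass) (a : X.1) : Emb treeClass where
  src := ⟨induced X.1 {x | x ≠ a}, induced_mem_treeClass X.2 _⟩
  tgt := X
  hom := inducedIncl X.1 {x | x ≠ a}

/-- The one-point extension attached to a finite tree `G` with marked leaf `a`. -/
def markedTree {V : Type} [Finite V] (G : SimpleGraph V) (hG : IsTreeGraph G) (a : V)
    (ha : IsLeaf G a) : Emb treeClass :=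
  markedEmb (treeObj G hG) ⟨a, ha⟩

/-- The tree with node set and leaf set together `{0, …, n}`, in which each `i ≠ 0` is joined to
`p i`. -/
def parentGraph {n : ℕ} (p : Fin (n + 1) → Fin (n + 1)) : SimpleGraph (Fin (n + 1)) :=
  SimpleGraph.fromRel fun i j => p i = j

instance {n : ℕ} (p : Fin (n + 1) → Fin (n + 1)) : DecidableRel (parentGraph p).Adj :=
  fun a b => inferInstanceAs (Decidable (a ≠ b ∧ (p a = b ∨ p b = a)))

theorem parentGraph_isTree {n : ℕ} (p : Fin (n + 1) → Fin (n + 1))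
    (hp : ∀ i, i ≠ 0 → p i < i) (h0 : p 0 = 0) : IsTreeGraph (parentGraph p) := by
  have hreach : ∀ i, (parentGraph p).Reachable i 0 := by
    intro i
    induction i using WellFoundedLT.induction with
    | ind i ih =>
      by_cases hi : i = 0
      · subst hi; exact SimpleGraph.Reachable.refl _
      · have hadj : (parentGraph p).Adj i (p i) := ⟨(hp i hi).ne', Or.inl rfl⟩
        exact hadj.reachable.trans (ih _ (hp i hi))
  have hpre : (parentGraph p).Preconnected := fun i j => (hreach i).trans (hreach j).symm
  have hconn : (parentGraph p).Connected := ⟨hpre⟩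
  refine ⟨hpre, (SimpleGraph.isTree_iff_connected_and_card.2 ⟨hconn, ?_⟩).isAcyclic⟩
  refine le_antisymm ?_ hconn.card_vert_le_card_edgeSet_add_one
  have hsub : (parentGraph p).edgeSet ⊆ (fun i => s(i, p i)) '' {i | i ≠ 0} := by
    intro e
    induction e using Sym2.ind with
    | _ a b =>
      rintro ⟨hne, h | h⟩
      · exact ⟨a, by rintro rfl; exact hne (h0.symm.trans h), by simp [h]⟩
      · exact ⟨b, by rintro rfl; exact hne (h.symm.trans h0), by simp [h, Sym2.eq_swap]⟩
  have h1 : (parentGraph p).edgeSet.ncard ≤ ({i | i ≠ 0} : Set (Fin (n + 1))).ncard :=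
    (Set.ncard_le_ncard hsub (Set.toFinite _)).trans (Set.ncard_image_le (Set.toFinite _))
  have h2 := Set.ncard_add_ncard_compl ({0} : Set (Fin (n + 1)))
  rw [Set.ncard_singleton] at h2
  have h3 : (({0} : Set (Fin (n + 1)))ᶜ) = {i | i ≠ 0} := by ext; simp
  rw [h3] at h2
  have h4 : Nat.card (parentGraph p).edgeSet = (parentGraph p).edgeSet.ncard := rfl
  omega

theorem starGraph_isLeaf_last (n : ℕ) :
    IsLeaf (SimpleGraph.starGraph (0 : Fin (n + 1))) (Fin.last n) := by
  intro a ha b hb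
  simp only [SimpleGraph.mem_neighborSet, SimpleGraph.starGraph_adj] at ha hb
  grind

/-- The star with centre `0` and remaining vertices `1, …, n`, the last vertex being marked.
For `n = 0, 1` this is the one-vertex tree and the two-vertex tree. -/
def markedStar (n : ℕ) : Emb treeClass :=
  markedTree (SimpleGraph.starGraph (0 : Fin (n + 1)))
    ⟨(SimpleGraph.connected_starGraph _).preconnected, SimpleGraph.isAcyclic_starGraph _⟩
    (Fin.last n) (starGraph_isLeaf_last n)

/-- The marked tree `X_m`, for `m ≥ 1`: the tree with `m` vertices if `m ≤ 2`, and the star with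
`m` leaves joined to a common node if `m ≥ 3`; one leaf is marked. -/
def treeX (m : ℕ) : Emb treeClass :=
  markedStar (if m ≤ 2 then m - 1 else m)

/-- The marked tree `Y`: adjacent nodes `0` and `1`, leaves `2, 3` at `0` and `4, 5` at `1`, with
the leaf `5` marked. -/
def treeY : Emb treeClass :=
  markedTree (parentGraph (n := 5) ![0, 0, 0, 0, 1, 1])
    (parentGraph_isTree _ (by decide) rfl) 5
    (by intro a ha b hb; revert a b; simp only [SimpleGraph.mem_neighborSet]; decide)

/-- The marked tree `Z`: a node `0` joined to the marked leaf `3` and to two further nodes `1` and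
`2`, with leaves `4, 5` at `1` and `6, 7` at `2`. -/
def treeZ : Emb treeClass :=
  markedTree (parentGraph (n := 7) ![0, 0, 0, 0, 1, 1, 2, 2])
    (parentGraph_isTree _ (by decide) rfl) 3
    (by intro a ha b hb; revert a b; simp only [SimpleGraph.mem_neighborSet]; decide)

/-- The ring `ℤ[u, v] / (u v)`. -/
abbrev TwoLines : Type :=
  MvPolynomial (Fin 2) ℤ ⧸
    Ideal.span {(MvPolynomial.X 0 * MvPolynomial.X 1 : MvPolynomial (Fin 2) ℤ)}

/-- The class of `u` in `ℤ[u, v] / (u v)`. -/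
noncomputable def TwoLines.u : TwoLines := Ideal.Quotient.mk _ (MvPolynomial.X 0)

/-- The class of `v` in `ℤ[u, v] / (u v)`. -/
noncomputable def TwoLines.v : TwoLines := Ideal.Quotient.mk _ (MvPolynomial.X 1)

end TreeMeasures

open TreeMeasures

/-!
The relation on the leaves of a tree is recorded by its quartets: `D a b c d` says that some edge
separates `a, b` from `c, d`. The relations `D` that come from finite trees are those that satisfy the
axioms of `QuartetSystem`, which involve at most five leaves (`QuartetSystem.isRealized`). So one may
work with quartets, and every embedding is a composite of extensions by one leaf.

A one-leaf extension is determined by the place at which the new leaf is attached, a node or an edge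
of the old tree, and a place is recorded by the partition of the old leaves into branches
(`Branch`, `IsLocation`, `exists_equiv_of_loc`). Given two one-leaf extensions of `X`, by `a` and
by `b`, the amalgamations are the places of `a` in the tree with `b` that restrict to the given place
in `X`, and in addition the identification of `a` with `b` if the two places in `X` are equal
(`amalgamSum_iff`). If the places in `X` differ there is exactly one amalgamation
(`exists_places_eq_singleton`). If they are equal, `a` is attached to the leg of `b`, or to the node
at `b`, or, when the place is an edge, to one of its two halves (`places_of_subsingleton`,
`places_of_three`, `places_of_pair`). Condition (c) for all embeddings follows from these cases
(`amalgamSum_of_missesLeOne`).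

Existence. For `u * v = 0`, give a place the weight `u + v + 2` in the empty tree, `u + v + 1` in the
one-vertex tree, `u + (e - 1) v` at an edge of which `e` ends are leaves, and `v + 1 - (n - 1)(u + 1)`
at a node with `n` branches (`locWeight`). The product of the weights along a chain of one-leaf
extensions does not depend on the order of the leaves (`locWeight_comm`); this is where `u * v = 0`
is used. So the weights define a multiplicative function on embeddings (`embWeight`), and
condition (c) is an identity between the weights in the cases above (`sum_locWeight`). The values at
`Y` and `Z` are `u` and `u - v`.

Uniqueness. By condition (c) for two different places, a leaf `b` can be removed without changing the
value of a measure at a place, unless that place and `b` restrict to the same place of the rest of the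
tree. If no leaf can be removed, the place is a node or an edge all of whose branches are single
leaves, or it is that of `Y` or `Z` (`exists_removable_or`). Condition (c) for attaching two leaves at
one place then gives the stars from the values at `Y` and `Z` (`exists_star_agree`,
`leafVal_eq_of_agree`, `IsMeasure.ext`).

The relation. Removing the marked leaf of `Z` and then a leaf next to it, or the same two leaves in the
opposite order, gives `z * y = y * y` (`IsMeasure.mul_eq_mul`). Applied to the universal measure, this
says that `u ↦ y` and `v ↦ y - z` define a homomorphism `ℤ[u, v] / (u v) → Θ`; it is inverse to the
homomorphism given by the measure with parameters `u` and `v`, because a measure is determined by its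
values at `Y` and `Z` (`thetaEquiv`). Over a domain `u * v = 0` means `u = 0` or `v = 0`, whence the
two families.
-/

namespace TreeMeasures

open scoped FirstOrder Classical
open FirstOrder.Language (Structure)

/-! ### Quartet systems and branches -/

/-- The axioms, on at most five points, of the quaternary relation `D a b c d` on the leaves of a
tree saying that some edge separates the distinct leaves `a, b` from `c, d`. -/
structure QuartetSystem {α : Type*} (D : α → α → α → α → Prop) : Prop where
  ne₁₂ : ∀ {a b c d}, D a b c d → a ≠ b
  ne₁₃ : ∀ {a b c d}, D a b c d → a ≠ c
  swap : ∀ {a b c d}, D a b c d → D b a c d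
  symm : ∀ {a b c d}, D a b c d → D c d a b
  excl : ∀ {a b c d}, D a b c d → ¬ D a c b d
  five : ∀ {a b c d v}, D a b c d → v ≠ b → v ≠ c → D v b c d ∨ D a b c v

/-- For a set `S` of leaves and a leaf `a` outside `S`, the relation on `S` of lying in the same
branch at the node at which `a` is attached to the tree spanned by `S`. -/
def Branch {α : Type*} (D : α → α → α → α → Prop) (S : Finset α) (a x y : α) : Prop :=
  x = y ∨ ∃ d ∈ S, D a d x y

/-- The relations on `S` that occur as `Branch D S a` for some way of attaching a new leaf `a`:
the classes of `F` are the branches at a node, or the two sides of an edge. If `S` has at most one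
element, the only location is the one with all of `S` in a single class. -/
structure IsLocation {α : Type*} (D : α → α → α → α → Prop) (S : Finset α) (F : α → α → Prop) :
    Prop where
  refl : ∀ x ∈ S, F x x
  symm : ∀ x ∈ S, ∀ y ∈ S, F x y → F y x
  trans : ∀ x ∈ S, ∀ y ∈ S, ∀ z ∈ S, F x y → F y z → F x z
  split : ∀ x ∈ S, ∀ y ∈ S, ∀ d ∈ S, ∀ e ∈ S, x ≠ y → d ≠ e → F x y → ¬ F x d → ¬ F x e →
    D x y d e
  node : ∀ x ∈ S, ∀ y ∈ S, ∀ z ∈ S, ∀ w ∈ S, ¬ F x y → ¬ F x z → ¬ F x w → ¬ F y z → ¬ F y w →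
    ¬ F z w → ¬ D x y z w
  proper : ∀ x ∈ S, ∀ y ∈ S, x ≠ y → ∃ z ∈ S, ¬ F x z

namespace QuartetSystem

variable {α : Type*} {D : α → α → α → α → Prop} (hD : QuartetSystem D) {S : Finset α} {a b : α}
include hD

theorem swap' {a b c d : α} (h : D a b c d) : D a b d c := hD.symm (hD.swap (hD.symm h))

theorem branch_symm {x y : α} (h : Branch D S a x y) : Branch D S a y x := by
  rcases h with rfl | ⟨d, hd, h⟩
  · exact Or.inl rfl
  · exact Or.inr ⟨d, hd, hD.swap' h⟩

theorem branch_trans {x y z : α} (h : Branch D S a x y) (h' : Branch D S a y z) :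
    Branch D S a x z := by
  rcases h with rfl | ⟨d, hd, h⟩
  · exact h'
  rcases h' with rfl | ⟨e, he, h'⟩
  · exact Or.inr ⟨d, hd, h⟩
  by_cases hxz : x = z
  · exact Or.inl hxz
  have := @hD.swap
  have := @hD.symm
  have := @hD.ne₁₂
  have := @hD.ne₁₃
  have := @hD.excl
  have h1 : D a d x z ∨ D a z x y := by
    have := @hD.five y x a d z (hD.swap (hD.symm h))
    grind
  have h2 : D a e x z ∨ D a x y z := by
    have := @hD.five y z a e x ((hD.symm h'))
    grind
  unfold Branch
  grind

theorem branch_apart (ha : a ∉ S) {x y d : α} (hd : d ∈ S) (hxy : x ≠ y) (h : Branch D S a x y)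
    (hxd : ¬ Branch D S a x d) : D a d x y := by
  rcases h with rfl | ⟨e, he, h⟩
  · exact absurd rfl hxy
  have := @hD.swap
  have := @hD.symm
  have := @hD.ne₁₂
  have := @hD.ne₁₃
  have h1 := @hD.five e a x y d (hD.swap h)
  unfold Branch at hxd
  grind

/-- A branch at the place of `a` is separated from any two leaves outside it. -/
theorem branch_split (ha : a ∉ S) {x y d e : α} (hd : d ∈ S) (hxy : x ≠ y) (hde : d ≠ e)
    (h : Branch D S a x y) (hxd : ¬ Branch D S a x d) (hxe : ¬ Branch D S a x e) : D x y d e := by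
  have h1 := hD.branch_apart ha hd hxy h hxd
  have h2 := @hD.five a d x y e h1 hde.symm
  have := @hD.swap
  have := @hD.symm
  unfold Branch at hxd hxe
  grind

/-- Leaves in four different branches at a node are not separated by an edge. -/
theorem branch_node (ha : a ∉ S) {x y z w : α} (hy : y ∈ S) (hz : z ∈ S)
    (hxy : ¬ Branch D S a x y) (hzw : ¬ Branch D S a z w) : ¬ D x y z w := by
  intro h
  have h2 := @hD.five x y z w a h (by grind) (by grind)
  have := @hD.swap
  have := @hD.symm
  unfold Branch at hxy hzw
  grind

theorem branch_proper {x y : α} (hy : y ∈ S) (hxy : x ≠ y) :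
    ∃ z ∈ S, ¬ Branch D S a x z := by
  -- Among the leaves `d ≠ x`, one for which the cluster of `t` with `D a d x t` is largest lies in
  -- another branch than `x`: otherwise `D a e x d` for some `e`, and the cluster of `e` is larger.
  obtain ⟨d, hd, hmax⟩ := (S.filter (· ≠ x)).exists_max_image
    (fun d => (S.filter fun t => D a d x t).card) ⟨y, by grind⟩
  rw [Finset.mem_filter] at hd
  refine ⟨d, hd.1, ?_⟩
  rintro (rfl | ⟨e, he, h⟩)
  · exact hd.2 rfl
  have := @hD.swap
  have := @hD.symm
  have := @hD.ne₁₂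
  have := @hD.ne₁₃
  have := hmax e (by grind)
  refine absurd this (not_le.2 (Finset.card_lt_card (Finset.ssubset_iff.2 ⟨d, by grind, ?_⟩)))
  intro t ht
  rcases Finset.mem_insert.1 ht with rfl | ht
  · grind
  · rw [Finset.mem_filter] at ht ⊢
    refine ⟨ht.1, ?_⟩
    have h1 := @hD.five d x a e t (hD.swap (hD.symm h))
    have := @hD.excl
    grind

theorem isLocation_branch (ha : a ∉ S) : IsLocation D S (Branch D S a) where
  refl _ _ := Or.inl rfl
  symm _ _ _ _ h := hD.branch_symm h
  trans _ _ _ _ _ _ h h' := hD.branch_trans h h'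
  split _ _ _ _ _ hd _ _ hxy hde h h' h'' := hD.branch_split ha hd hxy hde h h' h''
  node _ _ _ hy _ hz _ _ h _ _ _ _ h' := hD.branch_node ha hy hz h h'
  proper _ _ _ hy h := hD.branch_proper hy h

/-- The position of the new leaf determines all quartets that contain it. -/
theorem quartet_iff_branch (ha : a ∉ S) {x y z : α} (hx : x ∈ S) (hy : y ∈ S) :
    D a x y z ↔ y ≠ z ∧ Branch D S a y z ∧
      (¬ Branch D S a x y ∨ ∃ e ∈ S, ¬ Branch D S a x e ∧ D e x y z) := by
  have s1 := @hD.swap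
  have s2 := @hD.symm
  have n1 := @hD.ne₁₂
  have n2 := @hD.ne₁₃
  constructor
  · intro h
    have hyz : Branch D S a y z := Or.inr ⟨x, hx, h⟩
    refine ⟨by grind, hyz, ?_⟩
    by_cases hxy : Branch D S a x y
    · right
      obtain ⟨e, he, hxe⟩ := hD.branch_proper (a := a) (x := x) hy (by grind)
      refine ⟨e, he, hxe, ?_⟩
      have h1 := hD.branch_apart ha he (n2 (s1 h)) hxy hxe
      have h2 := @hD.five a x y z e h (by unfold Branch at hxe; grind)
        (by rintro rfl; exact hxe hxy)
      have h3 := hD.excl h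
      have h4 := @hD.excl
      grind
    · exact Or.inl hxy
  · rintro ⟨hyz, h, hxy | ⟨e, he, hxe, h'⟩⟩
    · exact hD.branch_apart ha hx hyz h (fun h' => hxy (hD.branch_symm h'))
    · by_cases hxy : Branch D S a x y
      · have h1 := hD.branch_apart ha he (n2 (s1 h')) hxy hxe
        have h2 := @hD.five e x y z a h' (by grind) (by grind)
        have h4 := @hD.excl
        grind
      · exact hD.branch_apart ha hx hyz h (fun h' => hxy (hD.branch_symm h'))

end QuartetSystem

/-! ### Extending a quartet system by one leaf -/

/-- The quartets of `none` with three old leaves, when the new leaf `none` is attached at `F`: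
`y, z` lie in one branch, and either `x` lies in another, or `x` is in the same branch and `y, z` are
still separated from `x` and a leaf `e` of another branch. -/
def NewQuartet {α : Type*} (D : α → α → α → α → Prop) (F : α → α → Prop) (x y z : α) : Prop :=
  y ≠ z ∧ F y z ∧ (¬ F x y ∨ ∃ e, ¬ F x e ∧ D e x y z)

/-- The quartet relation on `Option α` obtained by attaching a new leaf `none` at `F`. -/
def extQuartet {α : Type*} (D : α → α → α → α → Prop) (F : α → α → Prop) :
    Option α → Option α → Option α → Option α → Prop
  | some a, some b, some c, some d => D a b c d
  | none, some x, some y, some z => NewQuartet D F x y z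
  | some x, none, some y, some z => NewQuartet D F x y z
  | some y, some z, none, some x => NewQuartet D F x y z
  | some y, some z, some x, none => NewQuartet D F x y z
  | _, _, _, _ => False

namespace IsLocation

universe u

/-- A location is the kernel of a map. -/
theorem exists_class {α : Type u} {D : α → α → α → α → Prop} {S : Finset α} {F : α → α → Prop}
    (hF : IsLocation D S F) : ∃ (β : Type u) (π : α → β), ∀ x ∈ S, ∀ y ∈ S, (F x y ↔ π x = π y) := by
  refine ⟨Set α, fun x => {y | y ∈ S ∧ F x y}, fun x hx y hy => ⟨fun h => ?_, fun h => ?_⟩⟩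
  · ext z
    exact ⟨fun hz => ⟨hz.1, hF.trans y hy x hx z hz.1 (hF.symm x hx y hy h) hz.2⟩,
      fun hz => ⟨hz.1, hF.trans x hx y hy z hz.1 h hz.2⟩⟩
  · exact ((Set.ext_iff.1 h y).2 ⟨hy, hF.refl y hy⟩).2

variable {α : Type*} [Fintype α] {D : α → α → α → α → Prop} (hD : QuartetSystem D)
  {F : α → α → Prop} (hF : IsLocation D Finset.univ F)
include hD hF

theorem newQuartet_swap {x y z : α} (h : NewQuartet D F x y z) : NewQuartet D F x z y := by
  obtain ⟨h1, h2, h3⟩ := h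
  have := hF.symm y (by simp) z (by simp) h2
  have := hF.trans x (by simp) z (by simp) y (by simp)
  have := @hD.swap'
  unfold NewQuartet
  grind

theorem newQuartet_ne {x y z : α} (h : NewQuartet D F x y z) : x ≠ y := by
  obtain ⟨h1, h2, h3⟩ := h
  have := hF.refl x (by simp)
  have := @hD.ne₁₂
  have := @hD.symm
  have := @hD.swap
  have := @hD.ne₁₃
  grind

theorem newQuartet_excl {x y z : α} (h : NewQuartet D F x y z) : ¬ NewQuartet D F y x z := by
  intro h'
  obtain ⟨h1, h2, h3⟩ := h
  obtain ⟨h1', h2', h3'⟩ := h'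
  have t := fun x y z => hF.trans x (by simp) y (by simp) z (by simp)
  have s := fun x y => hF.symm x (by simp) y (by simp)
  have h4 : F x y := t _ _ _ h2' (s _ _ h2)
  obtain ⟨e, he, h5⟩ := h3.resolve_left (by simpa using h4)
  obtain ⟨e', he', h6⟩ := h3'.resolve_left (by simpa using s _ _ h4)
  have hx := hF.split x (by simp) z (by simp) e (by simp) e' (by simp)
  have hy := hF.split x (by simp) y (by simp) e (by simp) e' (by simp)
  have := @hD.swap
  have := @hD.symm
  have := @hD.ne₁₂
  have := @hD.ne₁₃
  have := @hD.excl
  have := @hD.five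
  by_cases hee : e = e'
  · grind
  · have := @hD.five e x y z e' h5
    grind

theorem newQuartet_of_quartet {p q r s : α} (h : D p q r s) :
    NewQuartet D F q r s ∨ NewQuartet D F r p q := by
  have t := fun x y z => hF.trans x (by simp) y (by simp) z (by simp)
  have sy := fun x y => hF.symm x (by simp) y (by simp)
  have s1 := @hD.swap
  have s2 := @hD.symm
  have n1 := @hD.ne₁₂ _ _ _ _ h
  have n2 := @hD.ne₁₂ _ _ _ _ (hD.symm h)
  have x1 := @hD.excl
  by_cases hpq : F p q
  · by_cases hqr : F q r
    · by_cases hrs : F r s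
      · -- all four leaves lie in one branch
        obtain ⟨e, -, he⟩ := hF.proper p (by simp) q (by simp) n1
        have hqe : ¬ F q e := fun h' => he (t _ _ _ hpq h')
        have hre : ¬ F r e := fun h' => hqe (t _ _ _ hqr h')
        have hrp : F r p := sy _ _ (t _ _ _ hpq hqr)
        rcases @hD.five p q r s e h (by rintro rfl; exact he hpq)
          (by rintro rfl; exact hqe hqr) with h1 | h1
        · exact Or.inl ⟨n2, hrs, Or.inr ⟨e, hqe, h1⟩⟩
        · exact Or.inr ⟨n1, hpq, Or.inr ⟨e, hre, hD.swap (hD.symm h1)⟩⟩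
      · unfold NewQuartet
        have := hF.refl s (by simp)
        grind
    · unfold NewQuartet
      grind
  · by_cases hrs : F r s
    · by_cases hqr : F q r
      · unfold NewQuartet
        grind
      · unfold NewQuartet
        grind
    · exfalso
      have hnode := hF.node p (by simp) q (by simp) r (by simp) s (by simp)
      have s3 := hF.split q (by simp) r (by simp) p (by simp) s (by simp)
      have s4 := hF.split q (by simp) s (by simp) p (by simp) r (by simp)
      have s5 := hF.split p (by simp) r (by simp) q (by simp) s (by simp)
      have s6 := hF.split p (by simp) s (by simp) q (by simp) r (by simp)
      have e1 := hD.excl h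
      have e2 := hD.excl (hD.swap h)
      have e3 := hD.excl (hD.swap' h)
      have e4 := hD.excl (hD.swap (hD.swap' h))
      have m1 := hD.ne₁₃ h
      have m2 := hD.ne₁₃ (hD.swap h)
      have m3 := hD.ne₁₃ (hD.swap' h)
      have m4 := hD.ne₁₃ (hD.swap (hD.swap' h))
      obtain ⟨β, π, hπ⟩ := hF.exists_class
      simp only [Finset.mem_univ, forall_const] at hπ
      simp only [hπ] at hpq hrs hnode s3 s4 s5 s6
      clear s1 s2 x1 t sy
      by_cases π p = π r <;> by_cases π p = π s <;> by_cases π q = π r <;> by_cases π q = π s <;>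
        grind

theorem newQuartet_five_left {q r s v : α} (h : NewQuartet D F q r s) (h1 : v ≠ q) (h2 : v ≠ r) :
    D v q r s ∨ NewQuartet D F q r v := by
  obtain ⟨h3, h4, h5⟩ := h
  have t := fun x y z => hF.trans x (by simp) y (by simp) z (by simp)
  have sy := fun x y => hF.symm x (by simp) y (by simp)
  by_cases hqr : F q r
  · obtain ⟨e, he, h6⟩ := h5.resolve_left (by simpa using hqr)
    have := @hD.five e q r s v h6 h1 h2
    by_cases hrv : F r v
    · rcases this with h7 | h7
      · exact Or.inl h7
      · exact Or.inr ⟨h2.symm, hrv, Or.inr ⟨e, he, h7⟩⟩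
    · by_cases hev : e = v
      · exact Or.inl (hev ▸ h6)
      rcases this with h7 | h7
      · exact Or.inl h7
      · have s4 := hF.split q (by simp) r (by simp) e (by simp) v (by simp) (hD.ne₁₃ (hD.swap h6))
          hev hqr he (fun h' => hrv (t _ _ _ (sy _ _ hqr) h'))
        exact absurd (hD.swap h7) (hD.excl s4)
  · by_cases hrv : F r v
    · unfold NewQuartet
      grind
    · have s3 := hF.split r (by simp) s (by simp) v (by simp) q (by simp)
      have s2 := @hD.symm
      grind

theorem newQuartet_five_right {p r s v : α} (h : NewQuartet D F p r s) (h2 : v ≠ r) :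
    NewQuartet D F v r s ∨ NewQuartet D F p r v := by
  obtain ⟨h3, h4, h5⟩ := h
  have t := fun x y z => hF.trans x (by simp) y (by simp) z (by simp)
  have sy := fun x y => hF.symm x (by simp) y (by simp)
  have s1 := @hD.swap
  have s2 := @hD.symm
  by_cases hrv : F r v
  · by_cases hpr : F p r
    · obtain ⟨e, he, h6⟩ := h5.resolve_left (by simpa using hpr)
      have := @hD.five p e r s v (hD.swap h6)
      unfold NewQuartet
      grind
    · unfold NewQuartet
      grind
  · unfold NewQuartet
    grind

/-- Attaching a leaf at a location gives a quartet system. -/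
theorem quartetSystem_ext : QuartetSystem (extQuartet D F) where
  ne₁₂ {a b c d} h := by
    have := @hD.ne₁₂
    rcases a with _ | a <;> rcases b with _ | b <;> rcases c with _ | c <;> rcases d with _ | d <;>
      simp only [extQuartet] at h <;> grind [NewQuartet]
  ne₁₃ {a b c d} h := by
    have := @hD.ne₁₃
    have n1 := fun x y z h => @newQuartet_ne _ _ _ hD _ hF x y z h
    have n2 := fun x y z h => @newQuartet_swap _ _ _ hD _ hF x y z h
    rcases a with _ | a <;> rcases b with _ | b <;> rcases c with _ | c <;> rcases d with _ | d <;>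
      simp only [extQuartet] at h <;> grind
  swap {a b c d} h := by
    have := @hD.swap
    have n2 := fun x y z h => @newQuartet_swap _ _ _ hD _ hF x y z h
    rcases a with _ | a <;> rcases b with _ | b <;> rcases c with _ | c <;> rcases d with _ | d <;>
      simp only [extQuartet] at h ⊢ <;> grind
  symm {a b c d} h := by
    have := @hD.symm
    rcases a with _ | a <;> rcases b with _ | b <;> rcases c with _ | c <;> rcases d with _ | d <;>
      simp only [extQuartet] at h ⊢ <;> grind
  excl {a b c d} h := by
    have := @hD.excl
    have n2 := fun x y z h => @newQuartet_swap _ _ _ hD _ hF x y z h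
    have n3 := fun x y z h => @newQuartet_excl _ _ _ hD _ hF x y z h
    rcases a with _ | a <;> rcases b with _ | b <;> rcases c with _ | c <;> rcases d with _ | d <;>
      simp only [extQuartet] at h ⊢ <;> grind
  five {a b c d v} h h1 h2 := by
    have n2 := fun x y z h => @newQuartet_swap _ _ _ hD _ hF x y z h
    have n3 := fun p q r s h => @newQuartet_of_quartet _ _ _ hD _ hF p q r s h
    have n4 := fun q r s v h => @newQuartet_five_left _ _ _ hD _ hF q r s v h
    have n5 := fun p r s v h => @newQuartet_five_right _ _ _ hD _ hF p r s v h
    have n6 := @hD.swap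
    have n7 := @hD.symm
    have n8 := @hD.five
    rcases a with _ | a <;> rcases b with _ | b <;> rcases c with _ | c <;> rcases d with _ | d <;>
      simp only [extQuartet] at h <;> rcases v with _ | v <;>
      simp only [extQuartet, ne_eq, Option.some.injEq] at h1 h2 ⊢ <;> grind

omit hD in
/-- The location of the new leaf is the one at which it was attached. -/
theorem branch_ext (x y : α) :
    Branch (extQuartet D F) (Finset.univ.map Function.Embedding.some) none (some x) (some y) ↔
      F x y := by
  have : Branch (extQuartet D F) (Finset.univ.map Function.Embedding.some) none (some x) (some y) ↔
      x = y ∨ ∃ d, NewQuartet D F d x y := by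
    simp [Branch, extQuartet]
  rw [this]
  constructor
  · rintro (rfl | ⟨d, h⟩)
    · exact hF.refl _ (by simp)
    · exact h.2.1
  · intro h
    by_cases hxy : x = y
    · exact Or.inl hxy
    · obtain ⟨z, -, hz⟩ := hF.proper x (by simp) y (by simp) hxy
      exact Or.inr ⟨z, hxy, h, Or.inl fun h' => hz (hF.symm _ (by simp) _ (by simp) h')⟩

end IsLocation

/-! ### Relative position of two new leaves -/

section Position

variable {α : Type*}

/-- The new leaf is attached to the leg of the leaf `b`. -/
def cherryLoc (b x y : α) : Prop := x = b ↔ y = b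

/-- The new leaf is attached at the same node as `b`, the other branches being the classes
of `E`. -/
def newLoc (b : α) (E : α → α → Prop) (x y : α) : Prop :=
  (x = b ∧ y = b) ∨ (x ≠ b ∧ y ≠ b ∧ E x y)

/-- The leaf `b` is added to the class of `c` under `E`. -/
def joinLoc (b c : α) (E : α → α → Prop) (x y : α) : Prop :=
  E (if x = b then c else x) (if y = b then c else y)

/-- All of `S` outside the branch of `c` under `E` lies in one branch under `E'`. -/
def CoBranch (S : Finset α) (E E' : α → α → Prop) (c : α) : Prop :=
  ∀ d ∈ S, ∀ e ∈ S, ¬ E c d → ¬ E c e → E' d e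

variable {D : α → α → α → α → Prop} {S : Finset α} {a b c : α} {E E' : α → α → Prop}

theorem isLocation_cherry (hb : b ∉ S) : IsLocation D (insert b S) (cherryLoc b) where
  refl := by simp [cherryLoc]
  symm := by grind [cherryLoc]
  trans := by grind [cherryLoc]
  split := by grind [cherryLoc]
  node := by grind [cherryLoc]
  proper := by
    intro x hx y hy hxy
    by_cases hxb : x = b
    · exact ⟨y, hy, by grind [cherryLoc]⟩
    · exact ⟨b, by simp, by grind [cherryLoc]⟩

theorem isLocation_new (hD : QuartetSystem D) (hb : b ∉ S)
    (hE : ∀ x ∈ S, ∀ y ∈ S, (E x y ↔ Branch D S b x y)) :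
    IsLocation D (insert b S) (newLoc b E) where
  refl := by
    have := fun x hx => (hE x hx x hx).2 (Or.inl rfl)
    grind [newLoc]
  symm := by
    have := fun x y h => hD.branch_symm (S := S) (a := b) (x := x) (y := y) h
    grind [newLoc]
  trans := by
    have := fun x y z h => hD.branch_trans (S := S) (a := b) (x := x) (y := y) (z := z) h
    grind [newLoc]
  split := by
    intro x hx y hy d hd e he hxy hde h h1 h2
    have hxb : x ≠ b ∧ y ≠ b ∧ E x y := by grind [newLoc]
    have hB := (hE x (by grind) y (by grind)).1 hxb.2.2
    have s1 := @hD.symm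
    have s2 := @hD.swap
    by_cases hdb : d = b
    · subst hdb
      have heS : e ∈ S := by grind
      exact hD.symm (hD.branch_apart hb heS hxy hB
        (by rw [← hE x (by grind) e heS]; grind [newLoc]))
    by_cases heb : e = b
    · subst heb
      have hdS : d ∈ S := by grind
      exact hD.swap' (hD.symm (hD.branch_apart hb hdS hxy hB
        (by rw [← hE x (by grind) d hdS]; grind [newLoc])))
    have hdS : d ∈ S := by grind
    have heS : e ∈ S := by grind
    exact hD.branch_split hb hdS hxy hde hB
        (by rw [← hE x (by grind) d hdS]; grind [newLoc])
        (by rw [← hE x (by grind) e heS]; grind [newLoc])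
  node := by
    intro x hx y hy z hz w hw h1 h2 h3 h4 h5 h6 h
    have key : ∀ x ∈ S, ∀ y ∈ S, ∀ z ∈ S, ¬ newLoc b E y z → ¬ D b x y z := by
      intro x hx y hy z hz h h'
      have : Branch D S b y z := Or.inr ⟨x, hx, h'⟩
      rw [← hE y hy z hz] at this
      exact h (Or.inr ⟨fun h => hb (h ▸ hy), fun h => hb (h ▸ hz), this⟩)
    have s1 := hD.symm h
    have s2 := hD.swap h
    have s3 := hD.swap s1
    have hbr := hD.branch_node (x := x) hb (S := S) (y := y) (z := z) (w := w)
    have e1 := hE x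
    have e2 := hE z
    by_cases hxb : x = b
    · grind [newLoc]
    by_cases hyb : y = b
    · grind [newLoc]
    by_cases hzb : z = b
    · grind [newLoc]
    by_cases hwb : w = b
    · grind [newLoc]
    exact hbr (by grind) (by grind) (by grind [newLoc]) (by grind [newLoc]) h
  proper := by
    intro x hx y hy hxy
    by_cases hxb : x = b
    · exact ⟨y, hy, by grind [newLoc]⟩
    · exact ⟨b, by simp, by grind [newLoc]⟩

theorem isLocation_join (hD : QuartetSystem D) (hb : b ∉ S) (hE : IsLocation D S E) (hc : c ∈ S)
    (hcd : ∃ d ∈ S, ¬ E c d) (hco : CoBranch S E (Branch D S b) c) :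
    IsLocation D (insert b S) (joinLoc b c E) := by
  have t := hE.trans
  have sy := hE.symm
  have pr : ∀ x ∈ S, ¬ E c x → ∃ t ∈ S, ¬ Branch D S b x t ∧ E c t := by
    intro x hx hcx
    obtain ⟨z, hz, hxz⟩ := hD.branch_proper (S := S) (a := b) (x := x) hc
      (by rintro rfl; exact hcx (hE.refl _ hc))
    exact ⟨z, hz, hxz, by_contra fun h => hxz (hco x hx z hz hcx h)⟩
  -- Quartets containing `b` and two old leaves outside the branch of `c`.
  have key : ∀ p ∈ S, ∀ x ∈ S, ∀ y ∈ S, x ≠ y → ¬ E c x → ¬ E c y → (E c p ∨ (E x y ∧ ¬ E p x)) →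
      D b p x y := by
    intro p hp x hx y hy hxy hcx hcy h
    obtain ⟨z, hz, hxz, hcz⟩ := pr x hx hcx
    refine (hD.quartet_iff_branch hb hp hx).2 ⟨hxy, hco x hx y hy hcx hcy, ?_⟩
    by_cases hpx : Branch D S b p x
    · refine Or.inr ⟨z, hz, fun hpz => hxz (hD.branch_trans (hD.branch_symm hpx) hpz), ?_⟩
      have hzp : z ≠ p := by
        rintro rfl
        exact hxz (hD.branch_symm hpx)
      rcases h with h | ⟨h, h'⟩
      · exact hE.split z hz p hp x hx y hy hzp hxy (t _ hz _ hc _ hp (sy _ hc _ hz hcz) h)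
          (fun h' => hcx (t _ hc _ hz _ hx hcz h')) (fun h' => hcy (t _ hc _ hz _ hy hcz h'))
      · exact hD.symm (hE.split x hx y hy z hz p hp hxy hzp h
          (fun h' => hcx (t _ hc _ hz _ hx hcz (sy _ hx _ hz h'))) (fun h'' => h' (sy _ hx _ hp h'')))
    · exact Or.inl hpx
  have node : ∀ p ∈ S, ∀ x ∈ S, ∀ y ∈ S, ¬ E c p → ¬ E c x → ¬ E c y → ¬ E p x → ¬ E p y →
      ¬ E x y → ¬ D b p x y := by
    intro p hp x hx y hy hcp hcx hcy hpx hpy hxy h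
    obtain ⟨-, -, h | ⟨z, hz, hpz, h⟩⟩ := (hD.quartet_iff_branch hb hp hx).1 h
    · exact h (hco p hp x hx hcp hcx)
    · have hcz : E c z := by_contra fun h => hpz (hco p hp z hz hcp h)
      exact hE.node z hz p hp x hx y hy (fun h => hcp (t _ hc _ hz _ hp hcz h))
        (fun h => hcx (t _ hc _ hz _ hx hcz h)) (fun h => hcy (t _ hc _ hz _ hy hcz h)) hpx hpy hxy h
  have s1 := @hD.symm
  have s2 := @hD.swap
  refine ⟨?_, ?_, ?_, ?_, ?_, ?_⟩
  · have := hE.refl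
    grind [joinLoc]
  · grind [joinLoc]
  · have hmem : ∀ x ∈ insert b S, (if x = b then c else x) ∈ S := by grind
    exact fun x hx y hy z hz h h' => t _ (hmem x hx) _ (hmem y hy) _ (hmem z hz) h h'
  · intro x hx y hy d hd e he hxy hde h h1 h2
    have hsp := hE.split x
    simp only [joinLoc] at h h1 h2
    by_cases hxb : x = b
    · have := key y (by grind) d (by grind) e (by grind) hde
      grind
    by_cases hyb : y = b
    · have := key x (by grind) d (by grind) e (by grind) hde
      grind
    by_cases hdb : d = b
    · have := key e (by grind) x (by grind) y (by grind) hxy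
      grind
    by_cases heb : e = b
    · have := key d (by grind) x (by grind) y (by grind) hxy
      grind
    grind
  · have hmem : ∀ x ∈ insert b S, (if x = b then c else x) ∈ S := by grind
    have js : ∀ x ∈ insert b S, ∀ y ∈ insert b S, ¬ joinLoc b c E x y → ¬ joinLoc b c E y x :=
      fun x hx y hy h h' => h (sy _ (hmem y hy) _ (hmem x hx) h')
    have nodeJ : ∀ p ∈ insert b S, ∀ x ∈ insert b S, ∀ y ∈ insert b S, p ≠ b → x ≠ b → y ≠ b →
        ¬ joinLoc b c E b p → ¬ joinLoc b c E b x → ¬ joinLoc b c E b y → ¬ joinLoc b c E p x →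
        ¬ joinLoc b c E p y → ¬ joinLoc b c E x y → ¬ D b p x y := by
      intro p hp x hx y hy hpb hxb hyb
      simpa [joinLoc, hpb, hxb, hyb] using node p (by grind) x (by grind) y (by grind)
    clear key pr hcd node
    intro x hx y hy z hz w hw h1 h2 h3 h4 h5 h6 h
    have hr : ∀ x ∈ insert b S, joinLoc b c E x x := fun x hx => hE.refl _ (hmem x hx)
    have n1 : x ≠ y := fun h => h1 (h ▸ hr x hx)
    have n2 : x ≠ z := fun h => h2 (h ▸ hr x hx)
    have n3 : x ≠ w := fun h => h3 (h ▸ hr x hx)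
    have n4 : y ≠ z := fun h => h4 (h ▸ hr y hy)
    have n5 : y ≠ w := fun h => h5 (h ▸ hr y hy)
    have n6 : z ≠ w := fun h => h6 (h ▸ hr z hz)
    by_cases hxb : x = b
    · subst hxb
      exact nodeJ y hy z hz w hw n1.symm n2.symm n3.symm h1 h2 h3 h4 h5 h6 h
    by_cases hyb : y = b
    · subst hyb
      exact nodeJ x hx z hz w hw n1 n4.symm n5.symm (js _ hx _ hy h1) h4 h5 h2 h3 h6 (hD.swap h)
    by_cases hzb : z = b
    · subst hzb
      exact nodeJ w hw x hx y hy n6.symm n2 n4 h6 (js _ hx _ hz h2) (js _ hy _ hz h4)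
        (js _ hx _ hw h3) (js _ hy _ hw h5) h1 (hD.symm h)
    by_cases hwb : w = b
    · subst hwb
      exact nodeJ z hz x hx y hy n6 n3 n5 (js _ hz _ hw h6) (js _ hx _ hw h3) (js _ hy _ hw h5)
        (js _ hx _ hz h2) (js _ hy _ hz h4) h1 (hD.swap (hD.symm h))
    simp only [joinLoc, hxb, hyb, hzb, hwb, if_false] at h1 h2 h3 h4 h5 h6
    exact hE.node x (by grind) y (by grind) z (by grind) w (by grind) h1 h2 h3 h4 h5 h6 h
  · intro x hx y hy hxy
    clear key pr node hco
    obtain ⟨d, hd, hcd⟩ := hcd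
    by_cases hcx : E c (if x = b then c else x)
    · exact ⟨d, by simp [hd], by grind [joinLoc]⟩
    · exact ⟨c, by simp [hc], by grind [joinLoc]⟩

end Position

namespace QuartetSystem

variable {α : Type*} {D : α → α → α → α → Prop} (hD : QuartetSystem D) {S : Finset α} {a b : α}
include hD

omit hD in
theorem branch_insert_of_branch {x y : α} (h : Branch D S a x y) : Branch D (insert b S) a x y := by
  rcases h with h | ⟨d, hd, h⟩
  · exact Or.inl h
  · exact Or.inr ⟨d, by simp [hd], h⟩

/-- If two branches of `a` merge when `b` is added, then `a` and `b` form a cherry. -/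
theorem cherry_of_branch_insert (ha : a ∉ S) {x y : α}
    (h : Branch D (insert b S) a x y) (hxy : ¬ Branch D S a x y) :
    (∀ z ∈ S, Branch D (insert b S) a x z) ∧ (∀ z ∈ S, ¬ Branch D (insert b S) a b z) ∧
      ∀ z ∈ S, ∀ w ∈ S, (Branch D S a z w ↔ Branch D S b z w) := by
  have hab : D a b x y := by grind [Branch]
  have s1 := @hD.symm
  have s2 := @hD.swap
  have key : ∀ z ∈ S, x ≠ z → D a b x z := by
    intro z hz hxz
    have h1 := @hD.five y x a b z (hD.swap (hD.symm hab))
    have h2 := @hD.five b a x y z (hD.swap hab)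
    have h3 : ¬ D a z x y := fun h => hxy (Or.inr ⟨z, hz, h⟩)
    have n1 := @hD.ne₁₂
    have n2 := @hD.ne₁₃
    grind
  have key2 : ∀ z ∈ S, ∀ w ∈ S, z ≠ w → D a b z w := by
    intro z hz w hw hzw
    by_cases hxz : x = z
    · exact hxz ▸ key w hw (hxz ▸ hzw)
    by_cases hxw : x = w
    · exact hD.swap' (hxw ▸ key z hz hxz)
    have h1 := key z hz hxz
    have h2 := key w hw hxw
    have h3 := @hD.five x z a b w (hD.symm h1)
    have h4 := @hD.five x w a b z (hD.symm h2)
    have n2 := @hD.ne₁₃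
    have x1 := @hD.excl
    grind
  refine ⟨fun z hz => ?_, fun z hz h => ?_, fun z hz w hw => ?_⟩
  · by_cases hxz : x = z
    · exact Or.inl hxz
    · exact Or.inr ⟨b, by simp, key z hz hxz⟩
  · have n1 := @hD.ne₁₂
    have n2 := @hD.ne₁₃
    have x1 := @hD.excl
    rcases h with rfl | ⟨d, hd, h⟩
    · grind
    · have h1 := key2 d (by grind) z hz
      grind
  · have : ∀ d ∈ S, D a d z w ↔ D b d z w := by
      intro d hd
      have h1 := key2 z hz w hw
      have h2 := key2 d hd z hz
      have h3 := key2 d hd w hw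
      have n1 := @hD.ne₁₂
      have n2 := @hD.ne₁₃
      have x1 := @hD.excl
      have f1 := @hD.five a d z w b
      have f2 := @hD.five b d z w a
      grind
    simp only [Branch]
    grind

/-- The possible positions of `a` relative to `S ∪ {b}`, given those of `a` and `b` relative
to `S`. -/
theorem branch_insert_cases (ha : a ∉ S) (hb : b ∉ S) (hab : a ≠ b) :
    ((∀ x ∈ insert b S, ∀ y ∈ insert b S, (Branch D (insert b S) a x y ↔ cherryLoc b x y)) ∧
      ∀ x ∈ S, ∀ y ∈ S, (Branch D S a x y ↔ Branch D S b x y)) ∨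
    ((∀ x ∈ insert b S, ∀ y ∈ insert b S,
        (Branch D (insert b S) a x y ↔ newLoc b (Branch D S a) x y)) ∧
      ∀ x ∈ S, ∀ y ∈ S, (Branch D S a x y ↔ Branch D S b x y)) ∨
    ∃ c ∈ S, (∃ d ∈ S, ¬ Branch D S a c d) ∧ CoBranch S (Branch D S a) (Branch D S b) c ∧
      ∀ x ∈ insert b S, ∀ y ∈ insert b S,
        (Branch D (insert b S) a x y ↔ joinLoc b c (Branch D S a) x y) := by
  have ha' : a ∉ insert b S := by grind
  by_cases h : ∃ x ∈ S, ∃ y ∈ S, Branch D (insert b S) a x y ∧ ¬ Branch D S a x y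
  · left
    obtain ⟨x, hx, y, hy, h, hxy⟩ := h
    obtain ⟨h1, h2, h3⟩ := hD.cherry_of_branch_insert ha h hxy
    refine ⟨fun z hz w hw => ?_, h3⟩
    have t := fun x y z h h' =>
      hD.branch_trans (S := insert b S) (a := a) (x := x) (y := y) (z := z) h h'
    have sy := fun x y h => hD.branch_symm (S := insert b S) (a := a) (x := x) (y := y) h
    have r : Branch D (insert b S) a b b := Or.inl rfl
    grind [cherryLoc]
  · push Not at h
    have hiff : ∀ x ∈ S, ∀ y ∈ S, (Branch D (insert b S) a x y ↔ Branch D S a x y) :=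
      fun x hx y hy => ⟨h x hx y hy, branch_insert_of_branch⟩
    have t := fun x y z h h' =>
      hD.branch_trans (S := insert b S) (a := a) (x := x) (y := y) (z := z) h h'
    have sy := fun x y h => hD.branch_symm (S := insert b S) (a := a) (x := x) (y := y) h
    have r : Branch D (insert b S) a b b := Or.inl rfl
    right
    by_cases hc : ∃ c ∈ S, Branch D (insert b S) a b c
    · right
      obtain ⟨c, hc, hbc⟩ := hc
      have hcb := sy _ _ hbc
      refine ⟨c, hc, ?_, ?_, ?_⟩
      · obtain ⟨d, hd, hcd⟩ := hD.branch_proper (a := a) (S := insert b S) (x := c) (y := b)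
          (by simp) (by grind)
        exact ⟨d, by grind, by grind⟩
      · intro d hd e he hcd hce
        by_cases hde : d = e
        · exact Or.inl hde
        · exact Or.inr ⟨c, hc, hD.swap (hD.branch_split ha' (by simp [hd]) (by grind) hde hcb
            (by grind) (by grind))⟩
      · intro x hx y hy
        grind [joinLoc]
    · left
      push Not at hc
      refine ⟨fun x hx y hy => ?_, fun x hx y hy => ⟨?_, ?_⟩⟩
      · grind [newLoc]
      · intro hxy
        by_cases hne : x = y
        · exact Or.inl hne
        · rcases hxy with h1 | ⟨d, hd, h1⟩
          · exact Or.inl h1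
          have hax : D a b x y := hD.branch_apart ha' (by simp) hne
            ((hiff x hx y hy).2 (Or.inr ⟨d, hd, h1⟩)) (fun h' => hc x hx (sy _ _ h'))
          by_cases hbd : Branch D (insert b S) a x d
          · have h2 := @hD.five a d x y b h1 (by grind) (by grind)
            have s1 := @hD.symm
            have s2 := @hD.swap
            have h3 : ¬ D a d x b := fun h' => hc x hx (sy _ _ (Or.inr ⟨d, by simp [hd], h'⟩))
            exact Or.inr ⟨d, hd, by grind⟩
          · exact Or.inr ⟨d, hd, hD.swap (hD.symm (hD.branch_split ha' (by simp [hd])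
              hne (by grind) (hiff x hx y hy |>.2 (Or.inr ⟨d, hd, h1⟩)) hbd
              (fun h' => hc x hx (sy _ _ h'))))⟩
      · rintro (h1 | ⟨d, hd, h1⟩)
        · exact Or.inl h1
        · have h3 : ¬ D a x b d := fun h' => hc d hd (Or.inr ⟨x, by simp [hx], h'⟩)
          refine Or.inr ⟨d, hd, ?_⟩
          rcases @hD.five b d x y a h1 (by grind) (by grind) with h2 | h2
          · exact h2
          · exact absurd (hD.swap (hD.symm h2)) h3

end QuartetSystem

/-! ### Comparing two locations of the same set -/

section CoBranch

variable {α : Type*} {D : α → α → α → α → Prop} {S : Finset α} {E E' : α → α → Prop}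

/-- If `x, y` lie in one branch of `E` but not of `E'`, then the place `E'` lies inside the branch of
`x` under `E`. -/
theorem coBranch_of_ne (hD : QuartetSystem D) (hE : IsLocation D S E) (hE' : IsLocation D S E')
    {x y : α} (hx : x ∈ S) (hy : y ∈ S) (h : E x y) (h' : ¬ E' x y) : CoBranch S E E' x := by
  intro d hd e he hxd hxe
  by_contra hde
  have sy := hE'.symm
  have t := hE'.trans
  have r := hE'.refl
  have hxy : x ≠ y := fun h0 => h' (h0 ▸ r x hx)
  have hne : d ≠ e := fun h0 => hde (h0 ▸ r d hd)
  have q := hE.split x hx y hy d hd e he hxy hne h hxd hxe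
  have e1 := hD.excl q
  have e2 := hD.excl (hD.swap q)
  have e3 := hD.excl (hD.swap' q)
  have e4 := hD.excl (hD.swap (hD.swap' q))
  by_cases h1 : E' x d
  · exact e1 (hE'.split x hx d hd y hy e he (hD.ne₁₃ q) (hD.ne₁₃ (hD.swap (hD.swap' q))) h1 h'
      (fun h2 => hde (t _ hd _ hx _ he (sy _ hx _ hd h1) h2)))
  by_cases h2 : E' x e
  · exact e3 (hE'.split x hx e he y hy d hd (hD.ne₁₃ (hD.swap' q)) (hD.ne₁₃ (hD.swap q)) h2 h' h1)
  by_cases h3 : E' y d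
  · exact e2 (hE'.split y hy d hd x hx e he (hD.ne₁₃ (hD.swap q)) (hD.ne₁₃ (hD.swap' q)) h3
      (fun h4 => h' (sy _ hy _ hx h4))
      (fun h4 => hde (t _ hd _ hy _ he (sy _ hy _ hd h3) h4)))
  by_cases h4 : E' y e
  · exact e4 (hE'.split y hy e he x hx d hd (hD.ne₁₃ (hD.swap (hD.swap' q))) (hD.ne₁₃ q) h4
      (fun h4 => h' (sy _ hy _ hx h4)) h3)
  exact hE'.node x hx y hy d hd e he h' h1 h2 h3 h4 hde q

/-- Two leaves attached at different places see each other in one branch: the remaining branches of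
either lie in a single branch of the other. -/
theorem exists_coBranch (hD : QuartetSystem D) (hE : IsLocation D S E) (hE' : IsLocation D S E')
    (h : ¬ ∀ x ∈ S, ∀ y ∈ S, (E x y ↔ E' x y)) :
    ∃ c ∈ S, (∃ d ∈ S, ¬ E c d) ∧ CoBranch S E E' c := by
  by_cases h1 : ∃ x ∈ S, ∃ y ∈ S, E x y ∧ ¬ E' x y
  · obtain ⟨x, hx, y, hy, hxy, hxy'⟩ := h1
    exact ⟨x, hx, hE.proper x hx y hy (fun h0 => hxy' (h0 ▸ hE'.refl x hx)),
      coBranch_of_ne hD hE hE' hx hy hxy hxy'⟩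
  · push Not at h h1
    obtain ⟨x, hx, y, hy, h2⟩ := h
    have hxy : E' x y ∧ ¬ E x y := by
      rcases h2 with h2 | h2
      · exact absurd (h1 x hx y hy h2.1) h2.2
      · exact h2.symm
    have hne : x ≠ y := fun h0 => hxy.2 (h0 ▸ hE.refl x hx)
    have hco := coBranch_of_ne hD hE' hE hx hy hxy.1 hxy.2
    obtain ⟨c, hc, hxc⟩ := hE'.proper x hx y hy hne
    have key : ∀ d ∈ S, ¬ E c d → E' x d := fun d hd hcd =>
      by_contra fun h3 => hcd (hco c hc d hd hxc h3)
    refine ⟨c, hc, ?_, fun d hd e he hcd hce => ?_⟩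
    · by_contra! hall
      exact hxy.2 (hE.trans x hx c hc y hy (hE.symm c hc x hx (hall x hx)) (hall y hy))
    · exact hE'.trans d hd x hx e he (hE'.symm x hx d hd (key d hd hcd)) (key e he hce)

/-- If `E'` lies inside two different branches of `E`, in the sense of `CoBranch`, then the two
locations are equal. -/
theorem coBranch_unique (hE : IsLocation D S E) (hE' : IsLocation D S E')
    {c c' : α} (hc : c ∈ S) (hc' : c' ∈ S) (h : CoBranch S E E' c) (h' : CoBranch S E E' c')
    (hcc : ¬ E c c') : ∀ x ∈ S, ∀ y ∈ S, (E x y ↔ E' x y) := by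
  have hcc' : ¬ E c' c := fun h0 => hcc (hE.symm _ hc' _ hc h0)
  have hne : c ≠ c' := fun h0 => hcc (h0 ▸ hE.refl c hc)
  have t := hE.trans
  have sy := hE.symm
  have t' := hE'.trans
  have sy' := hE'.symm
  have hcover : ∀ x ∈ S, E c x ∨ E c' x := by
    intro x hx
    by_contra! h0
    -- otherwise all of `S` is a single class of `E'`
    obtain ⟨z, hz, hxz⟩ := hE'.proper x hx c hc (fun h1 => h0.1 (h1 ▸ hE.refl c hc))
    by_cases hcz : E c z
    · refine hxz (h' x hx z hz h0.2 (fun h1 => hcc (t _ hc _ hz _ hc' hcz (sy _ hc' _ hz h1))))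
    · exact hxz (h x hx z hz h0.1 hcz)
  have hnot : ¬ E' c c' := by
    intro h0
    obtain ⟨z, hz, hxz⟩ := hE'.proper c hc c' hc' hne
    by_cases hcz : E c z
    · exact hxz (h' c hc z hz hcc' (fun h1 => hcc (t _ hc _ hz _ hc' hcz (sy _ hc' _ hz h1))))
    · exact hxz (t' _ hc _ hc' _ hz h0 (h c' hc' z hz hcc hcz))
  have key : ∀ x ∈ S, (E c x ↔ E' c x) := by
    intro x hx
    constructor
    · intro hcx
      exact h' c hc x hx hcc' (fun h1 => hcc (t _ hc _ hx _ hc' hcx (sy _ hc' _ hx h1)))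
    · intro hcx
      by_contra h1
      exact hnot (t' _ hc _ hx _ hc' hcx (sy' _ hc' _ hx (h c' hc' x hx hcc h1)))
  intro x hx y hy
  have h1 := key x hx
  have h2 := key y hy
  constructor
  · intro hxy
    by_cases hcx : E c x
    · exact t' _ hx _ hc _ hy (sy' _ hc _ hx (h1.1 hcx)) (h2.1 (t _ hc _ hx _ hy hcx hxy))
    · exact h x hx y hy hcx (fun h3 => hcx (t _ hc _ hy _ hx h3 (sy _ hx _ hy hxy)))
  · intro hxy
    by_cases hcx : E c x
    · exact t _ hx _ hc _ hy (sy _ hc _ hx hcx) (h2.2 (t' _ hc _ hx _ hy (h1.1 hcx) hxy))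
    · have hcy : ¬ E c y := fun h3 =>
        hcx (h1.2 (t' _ hc _ hy _ hx (h2.1 h3) (sy' _ hx _ hy hxy)))
      exact t _ hx _ hc' _ hy (sy _ hc' _ hx ((hcover x hx).resolve_left hcx))
        ((hcover y hy).resolve_left hcy)

variable {a b c : α}

/-- A leaf `a` in cherry position with `b` sits over `S` where `b` does. -/
theorem branch_of_branch_insert_cherry (hD : QuartetSystem D) (ha : a ∉ S)
    (hb : b ∉ S)
    (hF : ∀ x ∈ insert b S, ∀ y ∈ insert b S, (Branch D (insert b S) a x y ↔ cherryLoc b x y)) :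
    ∀ x ∈ S, ∀ y ∈ S, (Branch D S a x y ↔ Branch D S b x y) := by
  by_cases h : ∃ x ∈ S, ∃ y ∈ S, ¬ Branch D S a x y
  · obtain ⟨x, hx, y, hy, h⟩ := h
    exact (hD.cherry_of_branch_insert ha ((hF x (by simp [hx]) y (by simp [hy])).2
      (by grind [cherryLoc])) h).2.2
  · push Not at h
    intro x hx y hy
    by_cases hxy : x = y
    · subst hxy
      exact ⟨fun _ => Or.inl rfl, fun _ => Or.inl rfl⟩
    · obtain ⟨z, hz, h1⟩ := hD.branch_proper (a := a) (x := x) hy hxy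
      exact absurd (h x hx z hz) h1

/-- If the branches of `a` over `S ∪ {b}` restrict to a location `E` of `S`, then `a` sits over `S`
at `E`. -/
theorem branch_of_branch_insert (hD : QuartetSystem D) (ha : a ∉ S) (hE : IsLocation D S E)
    (hF : ∀ x ∈ S, ∀ y ∈ S, (Branch D (insert b S) a x y ↔ E x y)) :
    ∀ x ∈ S, ∀ y ∈ S, (Branch D S a x y ↔ E x y) := by
  intro x hx y hy
  rw [← hF x hx y hy]
  refine ⟨QuartetSystem.branch_insert_of_branch, fun h => by_contra fun h1 => ?_⟩
  obtain ⟨z, hz, h2⟩ := hE.proper x hx y hy (fun h0 => h1 (Or.inl h0))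
  exact h2 ((hF x hx z hz).1 ((hD.cherry_of_branch_insert ha h h1).1 z hz))

end CoBranch

/-! ### The weight of a location -/

section Weight

variable {α : Type*} {k : Type*} [CommRing k] (u v : k)

/-- The set of classes of `F` on `S`. -/
noncomputable def parts (S : Finset α) (F : α → α → Prop) : Finset (Finset α) :=
  S.image fun x => S.filter (F x)

/-- The value, under the measure with parameters `u` and `v`, of attaching a leaf at a place with
the given set of branches: the empty tree, the one-vertex tree, an edge (two branches, each of which
ends in a leaf or in a node according as it has one or more leaves), or a node. -/
noncomputable def partsWeight (P : Finset (Finset α)) : k :=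
  match P.card with
  | 0 => u + v + 2
  | 1 => u + v + 1
  | 2 => u + (((P.filter fun B => B.card = 1).card : k) - 1) * v
  | n + 3 => v + 1 - ((n : k) + 2) * (u + 1)

/-- The weight of the location `F` of `S`. -/
noncomputable def locWeight (S : Finset α) (F : α → α → Prop) : k := partsWeight u v (parts S F)

/-- Contribution `1` of a branch consisting of a single leaf. -/
noncomputable def single (B : Finset α) : k := if B.card = 1 then 1 else 0

theorem partsWeight_pair {B C : Finset α} (h : B ≠ C) :
    partsWeight u v {B, C} = u + (single B + single C - 1) * v := by
  have : ({B, C} : Finset (Finset α)).card = 2 := Finset.card_pair h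
  rw [partsWeight, this]
  simp only [single, Finset.filter_insert, Finset.filter_singleton]
  split_ifs <;> simp [Finset.card_pair h]
  ring

theorem partsWeight_of_three_le {P : Finset (Finset α)} (h : 3 ≤ P.card) :
    partsWeight u v P = v + 1 - ((P.card : k) - 1) * (u + 1) := by
  obtain ⟨n, hn⟩ := Nat.exists_eq_add_of_le h
  rw [partsWeight, hn, Nat.add_comm 3 n]
  push_cast
  ring

theorem partsWeight_congr {β : Type*} {P : Finset (Finset α)} {Q : Finset (Finset β)}
    (h1 : P.card = Q.card) (h2 : P.card = 2 →
      (P.filter fun B => B.card = 1).card = (Q.filter fun B => B.card = 1).card) :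
    partsWeight u v P = partsWeight u v Q := by
  unfold partsWeight
  rw [← h1]
  by_cases h : P.card = 2
  · rw [h2 h]
  · split
    · rfl
    · rfl
    · contradiction
    · rfl

theorem parts_congr {S : Finset α} {F G : α → α → Prop} (h : ∀ x ∈ S, ∀ y ∈ S, (F x y ↔ G x y)) :
    parts S F = parts S G :=
  Finset.image_congr fun x hx => Finset.filter_congr fun y hy => h x hx y hy

theorem locWeight_congr {S : Finset α} {F G : α → α → Prop}
    (h : ∀ x ∈ S, ∀ y ∈ S, (F x y ↔ G x y)) : locWeight u v S F = locWeight u v S G := by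
  rw [locWeight, parts_congr h, locWeight]

theorem locWeight_map {β : Type*} (g : α ↪ β) {S : Finset α} {F : α → α → Prop}
    {G : β → β → Prop} (h : ∀ x ∈ S, ∀ y ∈ S, (F x y ↔ G (g x) (g y))) :
    locWeight u v (S.map g) G = locWeight u v S F := by
  have hp : parts (S.map g) G = (parts S F).map (Finset.mapEmbedding g).toEmbedding := by
    ext B
    simp only [parts, Finset.mem_image, Finset.mem_map, exists_exists_and_eq_and,
      RelEmbedding.coe_toEmbedding, Finset.mapEmbedding_apply]
    refine exists_congr fun x => and_congr_right fun hx => ?_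
    have : S.filter (G (g x) ∘ g) = S.filter (F x) :=
      Finset.filter_congr fun y hy => (h x hx y hy).symm
    rw [Finset.filter_map, this]
  rw [locWeight, locWeight, hp]
  refine partsWeight_congr u v (by simp) fun _ => ?_
  rw [Finset.filter_map]
  simp

variable {S : Finset α} {b c : α} {E E' : α → α → Prop} {D : α → α → α → α → Prop}

theorem parts_new (hb : b ∉ S) : parts (insert b S) (newLoc b E) = insert {b} (parts S E) := by
  rw [parts, Finset.image_insert]
  congr 1
  · ext y
    simp only [Finset.mem_filter, Finset.mem_insert, Finset.mem_singleton]
    grind [newLoc]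
  · refine Finset.image_congr fun x hx => ?_
    ext y
    simp only [Finset.mem_filter, Finset.mem_insert]
    have : x ∈ S := hx
    grind [newLoc]

theorem parts_cherry (hb : b ∉ S) (hc : c ∈ S) :
    parts (insert b S) (cherryLoc b) = {{b}, S} := by
  rw [parts, Finset.image_insert]
  congr 1
  · ext y
    simp only [Finset.mem_filter, Finset.mem_insert, Finset.mem_singleton]
    grind [cherryLoc]
  · have : ∀ x ∈ S, (insert b S).filter (cherryLoc b x) = S := by
      intro x hx
      ext y
      simp only [Finset.mem_filter, Finset.mem_insert]
      grind [cherryLoc]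
    rw [Finset.image_congr (g := fun _ => S) (fun x hx => this x hx)]
    exact Finset.image_const ⟨c, hc⟩ S

theorem parts_join (hb : b ∉ S) (hc : c ∈ S) :
    parts (insert b S) (joinLoc b c E) =
      (parts S E).image fun B => if c ∈ B then insert b B else B := by
  have hfil : ∀ x ∈ S, (insert b S).filter (joinLoc b c E x) =
      if c ∈ S.filter (E x) then insert b (S.filter (E x)) else S.filter (E x) := by
    intro x hx
    have hxb : x ≠ b := fun h => hb (h ▸ hx)
    ext y
    by_cases hyb : y = b
    · subst hyb
      split_ifs with h <;> simp [joinLoc, hxb, hb] <;> simpa [hc] using h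
    · split_ifs with h <;> simp [joinLoc, hxb, hyb]
  rw [parts, Finset.image_insert, Finset.insert_eq_of_mem, parts, Finset.image_image]
  · exact Finset.image_congr fun x hx => hfil x hx
  · refine Finset.mem_image.2 ⟨c, hc, ?_⟩
    have : c ≠ b := fun h => hb (h ▸ hc)
    exact Finset.filter_congr fun y _ => by simp [joinLoc, this]

theorem not_mem_parts (hb : b ∉ S) {B : Finset α} (hB : B ∈ parts S E) : b ∉ B := by
  obtain ⟨x, -, rfl⟩ := Finset.mem_image.1 hB
  exact fun h => hb (Finset.mem_filter.1 h).1

theorem card_parts_join (hb : b ∉ S) (hc : c ∈ S) :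
    (parts (insert b S) (joinLoc b c E)).card = (parts S E).card := by
  rw [parts_join hb hc]
  refine Finset.card_image_of_injOn fun B hB C hC h => ?_
  have h1 := not_mem_parts hb hB
  have h2 := not_mem_parts hb hC
  split_ifs at h
  · rw [← Finset.erase_insert h1, h, Finset.erase_insert h2]
  · exact absurd (h ▸ Finset.mem_insert_self b B) h2
  · exact absurd (h ▸ Finset.mem_insert_self b C) h1
  · exact h

/-- If every leaf of `S` is equivalent to `c` or to `d`, there are no further classes. -/
theorem parts_eq_pair (hE : IsLocation D S E) {d : α} (hc : c ∈ S) (hd : d ∈ S)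
    (hcover : ∀ x ∈ S, E c x ∨ E d x) : parts S E = {S.filter (E c), S.filter (E d)} := by
  ext B
  simp only [parts, Finset.mem_image, Finset.mem_insert, Finset.mem_singleton]
  constructor
  · rintro ⟨x, hx, rfl⟩
    have key : ∀ c ∈ S, E c x → S.filter (E x) = S.filter (E c) := fun c hc h =>
      Finset.filter_congr fun y hy => ⟨fun h' => hE.trans c hc x hx y hy h h',
        fun h' => hE.trans x hx c hc y hy (hE.symm c hc x hx h) h'⟩
    rcases hcover x hx with h | h
    · exact Or.inl (key c hc h)
    · exact Or.inr (key d hd h)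
  · rintro (rfl | rfl)
    · exact ⟨c, hc, rfl⟩
    · exact ⟨d, hd, rfl⟩

theorem filter_ne (hE : IsLocation D S E) {d : α} (hd : d ∈ S) (hcd : ¬ E c d) :
    S.filter (E c) ≠ S.filter (E d) := by
  intro h
  have : d ∈ S.filter (E c) := h ▸ Finset.mem_filter.2 ⟨hd, hE.refl d hd⟩
  exact hcd (Finset.mem_filter.1 this).2

theorem three_le_card_parts (hE : IsLocation D S E) {d e : α} (hc : c ∈ S) (hd : d ∈ S)
    (he : e ∈ S) (hcd : ¬ E c d) (hce : ¬ E c e) (hde : ¬ E d e) : 3 ≤ (parts S E).card := by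
  have h : ({S.filter (E c), S.filter (E d), S.filter (E e)} : Finset (Finset α)) ⊆ parts S E := by
    intro B hB
    simp only [Finset.mem_insert, Finset.mem_singleton] at hB
    rcases hB with rfl | rfl | rfl
    exacts [Finset.mem_image_of_mem _ hc, Finset.mem_image_of_mem _ hd,
      Finset.mem_image_of_mem _ he]
  refine le_trans (le_of_eq ?_) (Finset.card_le_card h)
  rw [Finset.card_eq_three.2 ⟨_, _, _, filter_ne hE hd hcd, filter_ne hE he hce,
    filter_ne hE he hde, rfl⟩]

theorem locWeight_cherry (hb : b ∉ S) {d : α} (hc : c ∈ S) (hd : d ∈ S) (hcd : c ≠ d) :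
    locWeight u v (insert b S) (cherryLoc b) = u := by
  have hne : ({b} : Finset α) ≠ S := fun h => hb (h ▸ Finset.mem_singleton_self b)
  have hcard : S.card ≠ 1 := fun h => by
    obtain ⟨x, rfl⟩ := Finset.card_eq_one.1 h
    simp only [Finset.mem_singleton] at hc hd
    exact hcd (hc.trans hd.symm)
  rw [locWeight, parts_cherry hb hc, partsWeight_pair u v hne]
  simp [single, hcard]

theorem locWeight_new (hb : b ∉ S) (h : 2 ≤ (parts S E).card) :
    locWeight u v (insert b S) (newLoc b E) = v + 1 - ((parts S E).card : k) * (u + 1) := by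
  have hcard : (parts (insert b S) (newLoc b E)).card = (parts S E).card + 1 := by
    rw [parts_new hb, Finset.card_insert_of_notMem]
    exact fun h => not_mem_parts hb h (Finset.mem_singleton_self b)
  rw [locWeight, partsWeight_of_three_le u v (by omega), hcard]
  push_cast
  ring

theorem locWeight_pair (hE : IsLocation D S E) {d : α} (hc : c ∈ S) (hd : d ∈ S)
    (hcd : ¬ E c d) (hcover : ∀ x ∈ S, E c x ∨ E d x) :
    locWeight u v S E = u + (single (S.filter (E c)) + single (S.filter (E d)) - 1) * v := by
  rw [locWeight, parts_eq_pair hE hc hd hcover, partsWeight_pair u v (filter_ne hE hd hcd)]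

theorem locWeight_join_pair (hb : b ∉ S) (hE : IsLocation D S E) {d : α} (hc : c ∈ S) (hd : d ∈ S)
    (hcd : ¬ E c d) (hcover : ∀ x ∈ S, E c x ∨ E d x) :
    locWeight u v (insert b S) (joinLoc b c E) = u + (single (S.filter (E d)) - 1) * v := by
  have h1 : c ∈ S.filter (E c) := Finset.mem_filter.2 ⟨hc, hE.refl c hc⟩
  have h2 : c ∉ S.filter (E d) := fun h =>
    hcd (hE.symm d hd c hc (Finset.mem_filter.1 h).2)
  have h3 : b ∉ S.filter (E d) := fun h => hb (Finset.mem_filter.1 h).1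
  have h4 : b ∉ S.filter (E c) := fun h => hb (Finset.mem_filter.1 h).1
  have h5 : single (k := k) (insert b (S.filter (E c))) = 0 := by
    have : 0 < (S.filter (E c)).card := Finset.card_pos.2 ⟨c, h1⟩
    rw [single, Finset.card_insert_of_notMem h4, if_neg (by omega)]
  have hne : insert b (S.filter (E c)) ≠ S.filter (E d) := fun h =>
    h3 (h ▸ Finset.mem_insert_self _ _)
  rw [locWeight, parts_join hb hc, parts_eq_pair hE hc hd hcover, Finset.image_insert,
    Finset.image_singleton, if_pos h1, if_neg h2, partsWeight_pair u v hne, h5, zero_add]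

/-- Adding a leaf `b` in one of the branches of `a`, at another place than `a`, does not change the
weight of `a`. -/
theorem locWeight_join (hb : b ∉ S) (hE : IsLocation D S E) (hE' : IsLocation D S E') (hc : c ∈ S)
    (hcd : ∃ d ∈ S, ¬ E c d) (hco : CoBranch S E E' c)
    (hne : ¬ ∀ x ∈ S, ∀ y ∈ S, (E x y ↔ E' x y)) :
    locWeight u v (insert b S) (joinLoc b c E) = locWeight u v S E := by
  obtain ⟨d, hd, hcd⟩ := hcd
  by_cases hcover : ∀ x ∈ S, E c x ∨ E d x
  · -- An edge: the branch of `c` is not a single leaf, as `E'` would be the same edge.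
    have hs : single (k := k) (S.filter (E c)) = 0 := by
      rw [single, if_neg]
      intro h1
      obtain ⟨x, hx⟩ := Finset.card_eq_one.1 h1
      have hcx : c ∈ S.filter (E c) := Finset.mem_filter.2 ⟨hc, hE.refl c hc⟩
      rw [hx, Finset.mem_singleton] at hcx
      have honly : ∀ y ∈ S, E c y → y = c := fun y hy hcy => by
        have : y ∈ S.filter (E c) := Finset.mem_filter.2 ⟨hy, hcy⟩
        rw [hx, Finset.mem_singleton] at this
        rw [this, hcx]
      have hout : ∀ y ∈ S, y ≠ c → ¬ E' c y := by
        intro y hy hyc h2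
        obtain ⟨z, hz, h3⟩ := hE'.proper c hc d hd (fun h => hcd (h ▸ hE.refl c hc))
        refine h3 (hE'.trans c hc y hy z hz h2 (hco y hy z hz (fun h => hyc (honly y hy h)) ?_))
        intro h
        rw [honly z hz h] at h3
        exact h3 (hE'.refl c hc)
      refine hne fun y hy z hz => ?_
      by_cases hyc : y = c
      · subst hyc
        by_cases hzc : z = y
        · subst hzc
          exact ⟨fun _ => hE'.refl z hz, fun _ => hE.refl z hz⟩
        · exact ⟨fun h => absurd (honly z hz h) hzc, fun h => absurd h (hout z hz hzc)⟩
      · by_cases hzc : z = c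
        · subst hzc
          exact ⟨fun h => absurd (honly y hy (hE.symm y hy z hz h)) hyc,
            fun h => absurd (hE'.symm y hy z hz h) (hout y hy hyc)⟩
        · have h4 : ∀ y ∈ S, y ≠ c → E d y := fun y hy hyc =>
            (hcover y hy).resolve_left fun h => hyc (honly y hy h)
          exact ⟨fun _ => hco y hy z hz (fun h => hyc (honly y hy h)) fun h => hzc (honly z hz h),
            fun _ => hE.trans y hy d hd z hz (hE.symm d hd y hy (h4 y hy hyc)) (h4 z hz hzc)⟩
    rw [locWeight_join_pair u v hb hE hc hd hcd hcover, locWeight_pair u v hE hc hd hcd hcover,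
      hs, zero_add]
  · push Not at hcover
    obtain ⟨e, he, hce, hde⟩ := hcover
    have h3 := three_le_card_parts hE hc hd he hcd hce hde
    rw [locWeight, locWeight, partsWeight_of_three_le u v h3,
      partsWeight_of_three_le u v (by rwa [card_parts_join hb hc]), card_parts_join hb hc]

end Weight

/-! ### The weight of a chain of one-leaf extensions -/

section Chain

variable {α : Type*} {D : α → α → α → α → Prop} (hD : QuartetSystem D) {S : Finset α} {a b : α}
  {k : Type*} [CommRing k] {u v : k} (huv : u * v = 0)

/-- A leaf attached at another place does not change the weight. -/
theorem locWeight_insert_of_ne (hD : QuartetSystem D) (u v : k) (ha : a ∉ S) (hb : b ∉ S)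
    (hab : a ≠ b) (hne : ¬ ∀ x ∈ S, ∀ y ∈ S, (Branch D S a x y ↔ Branch D S b x y)) :
    locWeight u v (insert b S) (Branch D (insert b S) a) = locWeight u v S (Branch D S a) := by
  rcases hD.branch_insert_cases ha hb hab with ⟨-, h⟩ | ⟨-, h⟩ | ⟨c, hc, hcd, hco, h⟩
  · exact absurd h hne
  · exact absurd h hne
  · rw [locWeight_congr u v h, locWeight_join u v hb (hD.isLocation_branch ha)
      (hD.isLocation_branch hb) hc hcd hco hne]

/-- The contribution of a branch is idempotent, being `0` or `1`. -/
theorem single_mul_self (B : Finset α) : (single B : k) * single B = single B := by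
  unfold single
  split_ifs <;> simp

theorem locWeight_empty (F : α → α → Prop) : locWeight u v ∅ F = u + v + 2 := by
  simp [locWeight, parts, partsWeight]

theorem locWeight_singleton (F : α → α → Prop) (x : α) : locWeight u v {x} F = u + v + 1 := by
  simp [locWeight, parts, partsWeight]

include hD huv

/-- The product of the weights of `a` and then `b` does not depend on their order. If the places of the
two leaves differ, neither affects the weight of the other. If both are attached at the same edge, in
different points, the two products differ by a multiple of `u * v`. -/
theorem locWeight_comm (ha : a ∉ S) (hb : b ∉ S) (hab : a ≠ b) :
    locWeight u v (insert a S) (Branch D (insert a S) b) * locWeight u v S (Branch D S a) =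
      locWeight u v (insert b S) (Branch D (insert b S) a) * locWeight u v S (Branch D S b) := by
  by_cases hne : ∀ x ∈ S, ∀ y ∈ S, (Branch D S a x y ↔ Branch D S b x y)
  swap
  · rw [locWeight_insert_of_ne hD u v ha hb hab hne,
      locWeight_insert_of_ne hD u v hb ha hab.symm fun h => hne fun x hx y hy => (h x hx y hy).symm,
      mul_comm]
  rw [locWeight_congr u v hne]
  have hEa := hD.isLocation_branch ha
  have hEb := hD.isLocation_branch hb
  have hEab : IsLocation D S (Branch D S a) := hEa
  have s1 := @hD.symm
  have s2 := @hD.swap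
  by_cases hS : ∃ c ∈ S, ∃ d ∈ S, ¬ Branch D S a c d
  swap
  · push Not at hS
    have hsub : S.card ≤ 1 := Finset.card_le_one.2 fun x hx y hy => by
      by_contra hxy
      obtain ⟨z, hz, h⟩ := hEa.proper x hx y hy hxy
      exact h (hS x hx z hz)
    congr 1
    rcases Nat.le_one_iff_eq_zero_or_eq_one.1 hsub with h | h
    · rw [Finset.card_eq_zero] at h
      subst h
      simp only [insert_empty_eq, locWeight_singleton]
    · obtain ⟨c, rfl⟩ := Finset.card_eq_one.1 h
      -- both new leaves form an edge with `c`
      have key : ∀ a b : α, a ∉ ({c} : Finset α) → b ∉ ({c} : Finset α) → a ≠ b →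
          locWeight u v (insert b {c}) (Branch D (insert b {c}) a) = u + v := by
        intro a b ha hb hab
        have ha' : a ∉ insert b ({c} : Finset α) := by grind
        have hbc : b ≠ c := by grind
        have hE := hD.isLocation_branch ha'
        have hc : ¬ Branch D (insert b {c}) a b c := by
          intro h
          obtain ⟨z, hz, h'⟩ := hE.proper b (by simp) c (by simp) hbc
          rw [Finset.mem_insert, Finset.mem_singleton] at hz
          rcases hz with rfl | rfl
          · exact h' (hE.refl z (by simp))
          · exact h' h
        have hc' : ¬ Branch D (insert b {c}) a c b := fun h => hc (hD.branch_symm h)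
        rw [locWeight_pair u v hE (c := b) (d := c) (by simp) (by simp) hc
          (by intro x hx; rw [Finset.mem_insert, Finset.mem_singleton] at hx
              rcases hx with rfl | rfl
              exacts [Or.inl (Or.inl rfl), Or.inr (Or.inl rfl)])]
        have hb1 : Branch D (insert b {c}) a b b := Or.inl rfl
        have hc1 : Branch D (insert b {c}) a c c := Or.inl rfl
        simp [Finset.filter_insert, Finset.filter_singleton, hb1, hc1, hc, hc', single]
      rw [key a b ha hb hab, key b a hb ha hab.symm]
  obtain ⟨c, hc, d, hd, hcd⟩ := hS
  have hcne : c ≠ d := fun h => hcd (Or.inl h)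
  have hcd' : ¬ Branch D S b c d := fun h => hcd ((hne c hc d hd).2 h)
  -- adding `b` merges the branches of `c` and `d` at `a` only if `D a b c d`, a condition symmetric
  -- in `a` and `b`
  have hmerge : Branch D (insert b S) a c d ↔ Branch D (insert a S) b c d := by
    simp only [Branch] at hcd hcd' ⊢
    grind
  have hm1 : cherryLoc b c d := by
    have : c ≠ b := fun h => hb (h ▸ hc)
    have : d ≠ b := fun h => hb (h ▸ hd)
    simp [cherryLoc, *]
  have hm2 : cherryLoc a c d := by
    have : c ≠ a := fun h => ha (h ▸ hc)
    have : d ≠ a := fun h => ha (h ▸ hd)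
    simp [cherryLoc, *]
  have hn1 : ∀ E, newLoc b E c d → E c d := fun E h => by
    have : c ≠ b := fun h => hb (h ▸ hc)
    have : d ≠ b := fun h => hb (h ▸ hd)
    simpa [newLoc, *] using h
  have hn2 : ∀ E, newLoc a E c d → E c d := fun E h => by
    have : c ≠ a := fun h => ha (h ▸ hc)
    have : d ≠ a := fun h => ha (h ▸ hd)
    simpa [newLoc, *] using h
  have hj1 : ∀ E e, joinLoc b e E c d → E c d := fun E e h => by
    have : c ≠ b := fun h => hb (h ▸ hc)
    have : d ≠ b := fun h => hb (h ▸ hd)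
    simpa [joinLoc, *] using h
  have hj2 : ∀ E e, joinLoc a e E c d → E c d := fun E e h => by
    have : c ≠ a := fun h => ha (h ▸ hc)
    have : d ≠ a := fun h => ha (h ▸ hd)
    simpa [joinLoc, *] using h
  have cb : c ∈ insert b S := by simp [hc]
  have db : d ∈ insert b S := by simp [hd]
  have ca : c ∈ insert a S := by simp [hc]
  have da : d ∈ insert a S := by simp [hd]
  -- if `a` joins the branch of `f`, then `b` joins the other branch
  have hjoin : ∀ a b : α, a ∉ S → b ∉ S → a ≠ b → ∀ f ∈ S, (∃ d ∈ S, ¬ Branch D S b f d) →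
      (∀ x ∈ insert a S, ∀ y ∈ insert a S,
        (Branch D (insert a S) b x y ↔ joinLoc a f (Branch D S b) x y)) →
      ∃ d ∈ S, ¬ Branch D S b f d ∧ Branch D (insert b S) a b d := by
    intro a b ha hb hab f hf ⟨d, hd, hfd⟩ h
    have hfa : f ≠ a := fun h => ha (h ▸ hf)
    have hda : d ≠ a := fun h => ha (h ▸ hd)
    refine ⟨d, hd, hfd, Or.inr ⟨f, by simp [hf], ?_⟩⟩
    have h1 : Branch D (insert a S) b a f := by
      rw [h a (by simp) f (by simp [hf])]
      simp only [joinLoc, if_true, if_neg hfa]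
      exact Or.inl rfl
    have h2 : ¬ Branch D (insert a S) b a d := by
      rw [h a (by simp) d (by simp [hd])]
      simpa only [joinLoc, if_true, if_neg hda]
    exact hD.symm (hD.branch_apart (by grind) (by simp [hd]) hfa.symm h1 h2)
  rcases hD.branch_insert_cases ha hb hab with ⟨h1, -⟩ | ⟨h1, -⟩ | ⟨e, he, hed, hco, h1⟩ <;>
    rcases hD.branch_insert_cases hb ha hab.symm with ⟨h2, -⟩ | ⟨h2, -⟩ | ⟨f, hf, hfd, hcf, h2⟩
  · rw [locWeight_congr u v h1, locWeight_congr u v h2, locWeight_cherry u v hb hc hd hcne,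
      locWeight_cherry u v ha hc hd hcne]
  · exact absurd (hn2 _ ((h2 c ca d da).1 (hmerge.1 ((h1 c cb d db).2 hm1)))) hcd'
  · exact absurd (hj2 _ _ ((h2 c ca d da).1 (hmerge.1 ((h1 c cb d db).2 hm1)))) hcd'
  · exact absurd (hn1 _ ((h1 c cb d db).1 (hmerge.2 ((h2 c ca d da).2 hm2)))) hcd
  · have h3 : 2 ≤ (parts S (Branch D S a)).card := by
      refine Finset.one_lt_card.2 ⟨_, Finset.mem_image_of_mem _ hc, _, Finset.mem_image_of_mem _ hd,
        filter_ne hEa hd hcd⟩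
    rw [locWeight_congr u v h1, locWeight_congr u v h2, locWeight_new u v hb h3,
      locWeight_new u v ha (by rwa [← parts_congr hne]), parts_congr hne]
  · obtain ⟨g, hg, -, h⟩ := hjoin a b ha hb hab f hf hfd h2
    rw [h1 b (by simp) g (by simp [hg])] at h
    have : g ≠ b := fun h => hb (h ▸ hg)
    simp [newLoc, this] at h
  · exact absurd (hj1 _ _ ((h1 c cb d db).1 (hmerge.2 ((h2 c ca d da).2 hm2)))) hcd
  · obtain ⟨g, hg, -, h⟩ := hjoin b a hb ha hab.symm e he hed h1
    rw [h2 a (by simp) g (by simp [hg])] at h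
    have : g ≠ a := fun h => ha (h ▸ hg)
    simp [newLoc, this] at h
  · obtain ⟨g, hg, hfg, h⟩ := hjoin a b ha hb hab f hf hfd h2
    have hgb : g ≠ b := fun h => hb (h ▸ hg)
    rw [h1 b (by simp) g (by simp [hg])] at h
    simp only [joinLoc, if_true, if_neg hgb] at h
    have heg : Branch D S b e g := (hne e he g hg).1 h
    have hfe' : ¬ Branch D S b f e := fun h => hfg (hEb.trans f hf e he g hg h heg)
    have hef' : ¬ Branch D S b e f := fun h => hfe' (hEb.symm e he f hf h)
    have hcov : ∀ x ∈ S, Branch D S b f x ∨ Branch D S b e x := fun x hx => by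
      by_cases hfx : Branch D S b f x
      · exact Or.inl hfx
      · exact Or.inr ((hne e he x hx).1 (hcf e he x hx hfe' hfx))
    have hcongr : ∀ x ∈ insert b S, ∀ y ∈ insert b S,
        (Branch D (insert b S) a x y ↔ joinLoc b e (Branch D S b) x y) := fun x hx y hy => by
      rw [h1 x hx y hy]
      exact hne _ (by grind) _ (by grind)
    rw [locWeight_congr u v hcongr, locWeight_congr u v h2,
      locWeight_join_pair u v hb hEb he hf hef' (fun x hx => (hcov x hx).symm),
      locWeight_join_pair u v ha hEb hf he hfe' hcov, locWeight_pair u v hEb hf he hfe' hcov]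
    have e1 := single_mul_self (k := k) (S.filter (Branch D S b e))
    have e2 := single_mul_self (k := k) (S.filter (Branch D S b f))
    linear_combination (single (S.filter (Branch D S b e)) - single (S.filter (Branch D S b f))) *
      huv + v ^ 2 * (e1 - e2)

omit hD huv in
/-- The product of the weights of the leaves of `l`, attached one after the other to `S`. -/
noncomputable def chainWeight (D : α → α → α → α → Prop) (u v : k) : Finset α → List α → k
  | _, [] => 1
  | S, a :: l => locWeight u v S (Branch D S a) * chainWeight D u v (insert a S) l

theorem chainWeight_perm {l l' : List α} (h : l.Perm l') :
    ∀ S : Finset α, l.Nodup → (∀ x ∈ l, x ∉ S) →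
      chainWeight D u v S l = chainWeight D u v S l' := by
  induction h with
  | nil => simp
  | cons a h ih =>
    intro S hl hS
    rw [chainWeight, chainWeight, ih _ (List.nodup_cons.1 hl).2]
    intro x hx
    have : x ≠ a := fun h0 => (List.nodup_cons.1 hl).1 (h0 ▸ hx)
    simp [this, hS x (by simp [hx])]
  | swap a b l =>
    intro S hl hS
    have hab : a ≠ b := by grind
    simp only [chainWeight]
    rw [Finset.insert_comm, ← mul_assoc, ← mul_assoc, mul_comm (locWeight u v S _),
      mul_comm (locWeight u v S _),
      locWeight_comm hD huv (hS b (by simp)) (hS a (by simp)) hab.symm]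
  | trans h1 _ ih1 ih2 =>
    intro S hl hS
    rw [ih1 S hl hS, ih2 S (h1.nodup_iff.1 hl) fun x hx => hS x (h1.mem_iff.2 hx)]

omit hD huv in
theorem chainWeight_append (l l' : List α) : ∀ S : Finset α,
    chainWeight D u v S (l ++ l') =
      chainWeight D u v S l * chainWeight D u v (S ∪ l.toFinset) l' := by
  induction l with
  | nil => simp [chainWeight]
  | cons a l ih =>
    intro S
    have : insert a S ∪ l.toFinset = S ∪ (a :: l).toFinset := by
      ext x
      simp
    rw [List.cons_append, chainWeight, chainWeight, ih, this, mul_assoc]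

omit hD huv in
theorem branch_map {β : Type*} {D' : β → β → β → β → Prop} (g : α ↪ β)
    (hg : ∀ a b c d, D' (g a) (g b) (g c) (g d) ↔ D a b c d) (S : Finset α) (a x y : α) :
    Branch D' (S.map g) (g a) (g x) (g y) ↔ Branch D S a x y := by
  simp [Branch, hg]

omit hD huv in
theorem chainWeight_map {β : Type*} {D' : β → β → β → β → Prop} (g : α ↪ β)
    (hg : ∀ a b c d, D' (g a) (g b) (g c) (g d) ↔ D a b c d) (l : List α) :
    ∀ S : Finset α, chainWeight D' u v (S.map g) (l.map g) = chainWeight D u v S l := by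
  induction l with
  | nil => simp [chainWeight]
  | cons a l ih =>
    intro S
    rw [List.map_cons, chainWeight, chainWeight, ← Finset.map_insert, ih,
      locWeight_map u v g fun x _ y _ => (branch_map g hg S a x y).symm]

/-- The weight of the extension from `S` to `T`: the product of the weights of the leaves of
`T \ S`, attached in any order. -/
noncomputable def extWeight (D : α → α → α → α → Prop) (u v : k) (S T : Finset α) : k :=
  chainWeight D u v S (T \ S).toList

omit hD huv in
theorem extWeight_self (S : Finset α) : extWeight D u v S S = 1 := by
  simp [extWeight, chainWeight]

omit hD huv in
theorem extWeight_insert (ha : a ∉ S) :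
    extWeight D u v S (insert a S) = locWeight u v S (Branch D S a) := by
  have : insert a S \ S = {a} := by
    ext x
    simp only [Finset.mem_sdiff, Finset.mem_insert, Finset.mem_singleton]
    grind
  simp [extWeight, this, chainWeight]

theorem extWeight_mul {S T U : Finset α} (h : S ⊆ T) (h' : T ⊆ U) :
    extWeight D u v S U = extWeight D u v T U * extWeight D u v S T := by
  have hp : (U \ S).toList.Perm ((T \ S).toList ++ (U \ T).toList) := by
    refine (List.perm_ext_iff_of_nodup (Finset.nodup_toList _) ?_).2 fun x => ?_
    · refine List.Nodup.append (Finset.nodup_toList _) (Finset.nodup_toList _) fun x hx hx' => ?_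
      simp only [Finset.mem_toList, Finset.mem_sdiff] at hx hx'
      exact hx'.2 hx.1
    · simp only [List.mem_append, Finset.mem_toList, Finset.mem_sdiff]
      have := @h x
      have := @h' x
      tauto
  have hT : S ∪ (T \ S) = T := Finset.union_sdiff_of_subset h
  rw [extWeight, chainWeight_perm hD huv hp S (Finset.nodup_toList _) (by simp),
    chainWeight_append, Finset.toList_toFinset, hT, mul_comm]
  rfl

omit hD in
theorem extWeight_map {β : Type*} {D' : β → β → β → β → Prop} (hD' : QuartetSystem D') (g : α ↪ β)
    (hg : ∀ a b c d, D' (g a) (g b) (g c) (g d) ↔ D a b c d) (S T : Finset α) :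
    extWeight D' u v (S.map g) (T.map g) = extWeight D u v S T := by
  rw [extWeight, extWeight, ← chainWeight_map g hg]
  refine chainWeight_perm hD' huv ?_ _ (Finset.nodup_toList _) (by simp)
  refine (List.perm_ext_iff_of_nodup (Finset.nodup_toList _)
    ((List.nodup_map_iff g.injective).2 (Finset.nodup_toList _))).2 fun x => ?_
  simp only [Finset.mem_toList, Finset.mem_sdiff, Finset.mem_map, List.mem_map]
  constructor
  · rintro ⟨⟨y, hy, rfl⟩, h⟩
    exact ⟨y, ⟨hy, fun h' => h ⟨y, h', rfl⟩⟩, rfl⟩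
  · rintro ⟨y, ⟨hy, h⟩, rfl⟩
    refine ⟨⟨y, hy, rfl⟩, ?_⟩
    rintro ⟨z, hz, h'⟩
    exact h (g.injective h' ▸ hz)

end Chain

/-! ### Trees and quartet systems -/

section Graph

variable {V W : Type}

/-- The vertices `x` and `y` are on the same side of the edge `e` of `G`. -/
def SameSide (G : SimpleGraph V) (e : Sym2 V) (x y : V) : Prop :=
  (G.deleteEdges {e}).Reachable x y

/-- The four distinct vertices are split by an edge of `G` into the pairs `a, b` and `c, d`. -/
def EdgeSplit (G : SimpleGraph V) (a b c d : V) : Prop :=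
  [a, b, c, d].Nodup ∧ ∃ e, SameSide G e a b ∧ SameSide G e c d ∧ ¬ SameSide G e a c

variable {G : SimpleGraph V} {H : SimpleGraph W}

theorem sameSide_of_adj {e : Sym2 V} {x y : V} (h : G.Adj x y) (he : s(x, y) ≠ e) :
    SameSide G e x y :=
  (SimpleGraph.deleteEdges_adj.2 ⟨h, he⟩).reachable

theorem sameSide_or (hG : G.Preconnected) (p q x : V) :
    SameSide G s(p, q) x p ∨ SameSide G s(p, q) x q := by
  obtain ⟨w⟩ := hG x p
  induction w with
  | nil => exact Or.inl (SimpleGraph.Reachable.refl _)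
  | @cons x y p h w ih =>
    by_cases he : s(x, y) = s(p, q)
    · rcases Sym2.eq_iff.1 he with ⟨rfl, -⟩ | ⟨rfl, -⟩
      · exact Or.inl (SimpleGraph.Reachable.refl _)
      · exact Or.inr (SimpleGraph.Reachable.refl _)
    · have hadj : (G.deleteEdges {s(p, q)}).Adj x y :=
        SimpleGraph.deleteEdges_adj.2 ⟨h, he⟩
      exact ih.imp hadj.reachable.trans hadj.reachable.trans

theorem sameSide_of_not (hG : G.Preconnected) {e : Sym2 V} {x y z : V} (h : ¬ SameSide G e x y) :
    SameSide G e z x ∨ SameSide G e z y := by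
  induction e using Sym2.ind with
  | _ p q =>
    have t : ∀ {x y z}, SameSide G s(p, q) x y → SameSide G s(p, q) y z → SameSide G s(p, q) x z :=
      fun h h' => SimpleGraph.Reachable.trans h h'
    have sy : ∀ {x y}, SameSide G s(p, q) x y → SameSide G s(p, q) y x :=
      fun h => SimpleGraph.Reachable.symm h
    rcases sameSide_or hG p q x with hx | hx <;> rcases sameSide_or hG p q y with hy | hy <;>
      rcases sameSide_or hG p q z with hz | hz
    · exact Or.inl (t hz (sy hx))
    · exact absurd (t hx (sy hy)) h
    · exact Or.inl (t hz (sy hx))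
    · exact Or.inr (t hz (sy hy))
    · exact Or.inr (t hz (sy hy))
    · exact Or.inl (t hz (sy hx))
    · exact absurd (t hx (sy hy)) h
    · exact Or.inl (t hz (sy hx))

/-- In a tree, the path from `x` to `y` contains the edges having `x` and `y` on different sides. -/
theorem exists_path_mem_edges_iff (hG : IsTreeGraph G) (e : Sym2 V) (x y : V) :
    (∃ p : G.Walk x y, p.IsPath ∧ e ∈ p.edges) ↔ ¬ SameSide G e x y := by
  constructor
  · rintro ⟨p, hp, he⟩ h
    obtain ⟨q, hq⟩ := h.exists_isPath
    have h1 := (hG.2.subsingleton_path x y).elim ⟨p, hp⟩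
      ⟨q.mapLe (G.deleteEdges_le _), hq.mapLe _⟩
    have h2 : p = q.mapLe (G.deleteEdges_le _) := congrArg Subtype.val h1
    rw [h2, SimpleGraph.Walk.edges_mapLe_eq_edges] at he
    have := q.edges_subset_edgeSet he
    rw [SimpleGraph.edgeSet_deleteEdges] at this
    exact this.2 rfl
  · intro h
    obtain ⟨p, hp⟩ := (hG.1 x y).exists_isPath
    refine ⟨p, hp, by_contra fun he => h ?_⟩
    exact ⟨p.toDeleteEdges {e} (by
      rintro f hf rfl
      exact he hf)⟩

/-- The sides of two edges are nested: four vertices are not split in two ways. -/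
theorem sameSide_noncross {e f : Sym2 V} {x₁ x₂ x₃ x₄ : V}
    (h₁₂ : SameSide G e x₁ x₂) (h₃₄ : SameSide G e x₃ x₄) (h : ¬ SameSide G e x₁ x₃)
    (h₁₃ : SameSide G f x₁ x₃) (h₂₄ : SameSide G f x₂ x₄) : SameSide G f x₁ x₂ := by
  -- a side of `e` that does not contain the edge `f` lies on one side of `f`
  have key : ∀ (r s x y : V), f = s(r, s) → SameSide G e x y → ¬ SameSide G e x r →
      SameSide G f x y := by
    rintro r s x y rfl ⟨w⟩ hr
    induction w with
    | nil => exact SimpleGraph.Reachable.refl _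
    | @cons x y z hxy w ih =>
      have hyr : ¬ SameSide G e y r := fun h => hr (hxy.reachable.trans h)
      refine SimpleGraph.Reachable.trans (SimpleGraph.Adj.reachable ?_) (ih hyr)
      refine SimpleGraph.deleteEdges_adj.2 ⟨(SimpleGraph.deleteEdges_adj.1 hxy).1, fun he => ?_⟩
      rcases Sym2.eq_iff.1 he with ⟨rfl, -⟩ | ⟨-, rfl⟩
      · exact hr (SimpleGraph.Reachable.refl _)
      · exact hyr (SimpleGraph.Reachable.refl _)
  obtain ⟨r, s, hf⟩ : ∃ r s, f = s(r, s) := by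
    induction f using Sym2.ind with
    | _ r s => exact ⟨r, s, rfl⟩
  by_cases h1 : SameSide G e x₁ r
  · have h3 : ¬ SameSide G e x₃ r := fun h3 => h (h1.trans h3.symm)
    exact (h₁₃.trans (key r s x₃ x₄ hf h₃₄ h3)).trans h₂₄.symm
  · exact key r s x₁ x₂ hf h₁₂ h1

theorem quartetSystem_edgeSplit (hG : IsTreeGraph G) : QuartetSystem (EdgeSplit G) where
  ne₁₂ h := by have := h.1; grind
  ne₁₃ h := by have := h.1; grind
  swap := by
    rintro a b c d ⟨h, e, h1, h2, h3⟩
    exact ⟨by grind, e, h1.symm, h2, fun h4 => h3 (h1.trans h4)⟩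
  symm := by
    rintro a b c d ⟨h, e, h1, h2, h3⟩
    exact ⟨by grind, e, h2, h1, fun h4 => h3 h4.symm⟩
  excl := by
    rintro a b c d ⟨h, e, h1, h2, h3⟩ ⟨h', f, h1', h2', h3'⟩
    exact h3' (sameSide_noncross h1 h2 h3 h1' h2')
  five := by
    rintro a b c d v ⟨h, e, h1, h2, h3⟩ hb hc
    rcases sameSide_of_not hG.1 (z := v) h3 with h4 | h4
    · have hvd : v ≠ d := by
        rintro rfl
        exact h3 (h4.symm.trans h2.symm)
      exact Or.inl ⟨by grind, e, h4.trans h1, h2, fun h5 => h3 (h4.symm.trans h5)⟩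
    · have hva : v ≠ a := by
        rintro rfl
        exact h3 h4
      exact Or.inr ⟨by grind, e, h1, h4.symm, h3⟩

theorem pathsCross_iff (hG : IsTreeGraph G) (a b c d : V) :
    PathsCross G a b c d ↔ EdgeSplit G a c b d ∨ EdgeSplit G a d b c := by
  have h0 : PathsCross G a b c d ↔ [a, b, c, d].Nodup ∧
      ∃ e, ¬ SameSide G e a b ∧ ¬ SameSide G e c d := by
    simp only [← exists_path_mem_edges_iff hG]
    unfold PathsCross
    refine and_congr_right fun _ => ⟨?_, ?_⟩
    · rintro ⟨p, q, hp, hq, e, h1, h2⟩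
      exact ⟨e, ⟨p, hp, h1⟩, ⟨q, hq, h2⟩⟩
    · rintro ⟨e, ⟨p, hp, h1⟩, ⟨q, hq, h2⟩⟩
      exact ⟨p, q, hp, hq, e, h1, h2⟩
  rw [h0]
  constructor
  · rintro ⟨h, e, h1, h2⟩
    rcases sameSide_of_not hG.1 (z := c) h1 with h3 | h3
    · rcases sameSide_of_not hG.1 (z := d) h1 with h4 | h4
      · exact absurd (h3.trans h4.symm) h2
      · exact Or.inl ⟨by grind, e, h3.symm, h4.symm, h1⟩
    · rcases sameSide_of_not hG.1 (z := d) h1 with h4 | h4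
      · exact Or.inr ⟨by grind, e, h4.symm, h3.symm, h1⟩
      · exact absurd (h3.trans h4.symm) h2
  · rintro (⟨h, e, h1, h2, h3⟩ | ⟨h, e, h1, h2, h3⟩)
    · exact ⟨by grind, e, h3, fun h4 => h3 (h1.trans (h4.trans h2.symm))⟩
    · exact ⟨by grind, e, h3, fun h4 => h3 (h1.trans (h4.symm.trans h2.symm))⟩

theorem reachable_map_of_adj (f : V → W) (h : ∀ x y, G.Adj x y → H.Reachable (f x) (f y)) {x y : V}
    (hr : G.Reachable x y) : H.Reachable (f x) (f y) := by
  obtain ⟨w⟩ := hr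
  induction w with
  | nil => exact SimpleGraph.Reachable.refl _
  | cons hxy _ ih => exact (h _ _ hxy).trans ih

/-- The disjoint union of `G` and `H` with an edge added between `r` and `s`. -/
def joinGraph (G : SimpleGraph V) (H : SimpleGraph W) (r : V) (s : W) : SimpleGraph (V ⊕ W) where
  Adj
    | Sum.inl x, Sum.inl y => G.Adj x y
    | Sum.inr x, Sum.inr y => H.Adj x y
    | Sum.inl x, Sum.inr y => x = r ∧ y = s
    | Sum.inr y, Sum.inl x => x = r ∧ y = s
  symm := ⟨by
    rintro (x | x) (y | y) h
    exacts [h.symm, h, h, h.symm]⟩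
  loopless := ⟨by
    rintro (x | x) h
    exacts [h.ne rfl, h.ne rfl]⟩

variable {r : V} {s : W}

theorem sameSide_join_inl (hH : H.Preconnected) (e : Sym2 V) (x y : V ⊕ W) :
    SameSide (joinGraph G H r s) (e.map Sum.inl) x y ↔
      SameSide G e (Sum.elim id (fun _ => r) x) (Sum.elim id (fun _ => r) y) := by
  constructor
  · refine reachable_map_of_adj _ ?_
    rintro (x | x) (y | y) h <;> obtain ⟨h1, h2⟩ := SimpleGraph.deleteEdges_adj.1 h
    · refine sameSide_of_adj (G := G) h1 fun h3 => h2 ?_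
      rw [Set.mem_singleton_iff, ← h3]
      rfl
    · rw [show x = r from h1.1]
      exact SimpleGraph.Reachable.refl _
    · rw [show y = r from h1.1]
      exact SimpleGraph.Reachable.refl _
    · exact SimpleGraph.Reachable.refl _
  · intro h
    have hinr : ∀ w : W, (s(Sum.inl r, Sum.inr w) : Sym2 (V ⊕ W)) ≠ e.map Sum.inl := by
      intro w
      induction e using Sym2.ind with
      | _ p q => simp
    have hinr' : ∀ w w' : W, (s(Sum.inr w, Sum.inr w') : Sym2 (V ⊕ W)) ≠ e.map Sum.inl := by
      intro w w'
      induction e using Sym2.ind with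
      | _ p q => simp
    have key : ∀ z : V ⊕ W, SameSide (joinGraph G H r s) (e.map Sum.inl) z
        (Sum.inl (Sum.elim id (fun _ => r) z)) := by
      rintro (z | z)
      · exact SimpleGraph.Reachable.refl _
      · have h1 : SameSide (joinGraph G H r s) (e.map Sum.inl) (Sum.inr z) (Sum.inr s) := by
          refine reachable_map_of_adj (G := H) _ (fun x y h => ?_) (hH z s)
          exact sameSide_of_adj (G := joinGraph G H r s) h (hinr' _ _)
        have h2 : (joinGraph G H r s).Adj (Sum.inl r) (Sum.inr s) := ⟨rfl, rfl⟩
        exact h1.trans (sameSide_of_adj h2 (hinr _)).symm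
    refine (key x).trans (SimpleGraph.Reachable.trans ?_ (key y).symm)
    refine reachable_map_of_adj Sum.inl (fun x y h => ?_) h
    obtain ⟨h1, h2⟩ := SimpleGraph.deleteEdges_adj.1 h
    refine sameSide_of_adj (G := joinGraph G H r s) h1 fun h3 => h2 ?_
    exact Sym2.map.injective Sum.inl_injective h3

theorem sameSide_join_inr (hG : G.Preconnected) (e : Sym2 W) (x y : V ⊕ W) :
    SameSide (joinGraph G H r s) (e.map Sum.inr) x y ↔
      SameSide H e (Sum.elim (fun _ => s) id x) (Sum.elim (fun _ => s) id y) := by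
  have hswap : ∀ (V W : Type) (G : SimpleGraph V) (H : SimpleGraph W) (r : V) (s : W)
      (e : Sym2 (V ⊕ W)) (x y : V ⊕ W), SameSide (joinGraph G H r s) e x y →
      SameSide (joinGraph H G s r) (e.map Sum.swap) x.swap y.swap := by
    intro V W G H r s e x y
    refine reachable_map_of_adj _ (fun x y h => (SimpleGraph.Adj.reachable ?_))
    obtain ⟨h1, h2⟩ := SimpleGraph.deleteEdges_adj.1 h
    refine SimpleGraph.deleteEdges_adj.2 ⟨?_, fun h3 => h2 ?_⟩
    · rcases x with x | x <;> rcases y with y | y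
      exacts [h1, ⟨h1.2, h1.1⟩, ⟨h1.2, h1.1⟩, h1]
    · exact Sym2.map.injective (Equiv.sumComm V W).injective h3
  have he : (e.map Sum.inr : Sym2 (V ⊕ W)).map Sum.swap = e.map Sum.inl := by
    rw [Sym2.map_map]
    rfl
  have he' : (e.map Sum.inl : Sym2 (W ⊕ V)).map Sum.swap = e.map Sum.inr := by
    rw [Sym2.map_map]
    rfl
  have h1 := sameSide_join_inl (G := H) (r := s) (s := r) hG e x.swap y.swap
  have h2 : ∀ z : V ⊕ W, Sum.elim id (fun _ => s) z.swap = Sum.elim (fun _ => s) id z := by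
    rintro (z | z) <;> rfl
  rw [h2, h2] at h1
  rw [← h1]
  constructor
  · intro h
    exact he ▸ hswap _ _ _ _ _ _ _ _ _ h
  · intro h
    have := hswap _ _ _ _ _ _ _ _ _ h
    rwa [he', Sum.swap_swap, Sum.swap_swap] at this

theorem sameSide_join_bridge (hG : G.Preconnected) (hH : H.Preconnected) (x y : V ⊕ W) :
    SameSide (joinGraph G H r s) s(Sum.inl r, Sum.inr s) x y ↔ x.isLeft = y.isLeft := by
  constructor
  · intro h
    have := reachable_map_of_adj (H := (⊥ : SimpleGraph Bool)) Sum.isLeft ?_ h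
    · exact SimpleGraph.reachable_bot.1 this
    · rintro (x | x) (y | y) h <;> obtain ⟨h1, h2⟩ := SimpleGraph.deleteEdges_adj.1 h
      · exact SimpleGraph.Reachable.refl _
      · exact absurd (by rw [show x = r from h1.1, show y = s from h1.2]; rfl) h2
      · exact absurd (by rw [show y = r from h1.1, show x = s from h1.2]; exact Sym2.eq_swap) h2
      · exact SimpleGraph.Reachable.refl _
  · intro h
    rcases x with x | x <;> rcases y with y | y
    · refine reachable_map_of_adj (G := G) Sum.inl (fun x y h => ?_) (hG x y)
      exact sameSide_of_adj (G := joinGraph G H r s) h (by simp)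
    · simp at h
    · simp at h
    · refine reachable_map_of_adj (G := H) Sum.inr (fun x y h => ?_) (hH x y)
      exact sameSide_of_adj (G := joinGraph G H r s) h (by simp)

theorem isTreeGraph_join (hG : IsTreeGraph G) (hH : IsTreeGraph H) :
    IsTreeGraph (joinGraph G H r s) := by
  have key : ∀ {V : Type} {G : SimpleGraph V}, G.IsAcyclic ↔
      ∀ ⦃v w : V⦄, G.Adj v w → ¬ SameSide G s(v, w) v w := by
    intro V G
    rw [SimpleGraph.isAcyclic_iff_forall_adj_isBridge]
    refine forall_congr' fun v => forall_congr' fun w => forall_congr' fun h => ?_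
    rw [SimpleGraph.isBridge_iff]
    simp [SameSide]
  refine ⟨?_, key.2 ?_⟩
  · have h1 : ∀ z : V ⊕ W, (joinGraph G H r s).Reachable z (Sum.inl r) := by
      rintro (z | z)
      · exact reachable_map_of_adj (G := G) Sum.inl
          (fun x y h => SimpleGraph.Adj.reachable (G := joinGraph G H r s) h) (hG.1 z r)
      · have h2 := reachable_map_of_adj (G := H) Sum.inr
          (fun x y h => SimpleGraph.Adj.reachable (G := joinGraph G H r s) h) (hH.1 z s)
        have h3 : (joinGraph G H r s).Adj (Sum.inr s) (Sum.inl r) := ⟨rfl, rfl⟩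
        exact h2.trans h3.reachable
    exact fun x y => (h1 x).trans (h1 y).symm
  · rintro (x | x) (y | y) h
    · have := sameSide_join_inl (G := G) (r := r) (s := s) hH.1 s(x, y) (Sum.inl x) (Sum.inl y)
      rw [Sym2.map_mk] at this
      rw [this]
      exact key.1 hG.2 h
    · obtain ⟨rfl, rfl⟩ := h
      rw [sameSide_join_bridge hG.1 hH.1]
      simp
    · obtain ⟨rfl, rfl⟩ := h
      rw [Sym2.eq_swap, sameSide_join_bridge hG.1 hH.1]
      simp
    · have := sameSide_join_inr (H := H) (r := r) (s := s) hG.1 s(x, y) (Sum.inr x) (Sum.inr y)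
      rw [Sym2.map_mk] at this
      rw [this]
      exact key.1 hH.2 h

/-- An edge of the join splits the vertices as an edge of `G` does after contracting `H`, as an edge
of `H` does after contracting `G`, or into the vertices of `G` and those of `H`. -/
theorem exists_split_join_iff (hG : G.Preconnected) (hH : H.Preconnected) (a b c d : V ⊕ W) :
    (∃ e, SameSide (joinGraph G H r s) e a b ∧ SameSide (joinGraph G H r s) e c d ∧
      ¬ SameSide (joinGraph G H r s) e a c) ↔
    (∃ e, SameSide G e (Sum.elim id (fun _ => r) a) (Sum.elim id (fun _ => r) b) ∧
      SameSide G e (Sum.elim id (fun _ => r) c) (Sum.elim id (fun _ => r) d) ∧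
      ¬ SameSide G e (Sum.elim id (fun _ => r) a) (Sum.elim id (fun _ => r) c)) ∨
    (∃ e, SameSide H e (Sum.elim (fun _ => s) id a) (Sum.elim (fun _ => s) id b) ∧
      SameSide H e (Sum.elim (fun _ => s) id c) (Sum.elim (fun _ => s) id d) ∧
      ¬ SameSide H e (Sum.elim (fun _ => s) id a) (Sum.elim (fun _ => s) id c)) ∨
    (a.isLeft = b.isLeft ∧ c.isLeft = d.isLeft ∧ a.isLeft ≠ c.isLeft) := by
  constructor
  · rintro ⟨e, h1, h2, h3⟩
    have hbr : e = s(Sum.inl r, Sum.inr s) → a.isLeft = b.isLeft ∧ c.isLeft = d.isLeft ∧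
        a.isLeft ≠ c.isLeft := by
      rintro rfl
      rw [sameSide_join_bridge hG hH] at h1 h2 h3
      exact ⟨h1, h2, h3⟩
    have hno : ∀ (p : V) (q : W), e = s(Sum.inl p, Sum.inr q) → e = s(Sum.inl r, Sum.inr s) := by
      rintro p q rfl
      by_contra hne
      refine h3 ?_
      have key : ∀ x y, (joinGraph G H r s).Adj x y →
          SameSide (joinGraph G H r s) s(Sum.inl p, Sum.inr q) x y := by
        intro x y h
        refine (SimpleGraph.deleteEdges_adj.2 ⟨h, fun h' => hne ?_⟩).reachable
        rw [Set.mem_singleton_iff] at h'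
        rw [← h']
        rcases x with x | x <;> rcases y with y | y
        · simp at h'
        · rw [show x = r from h.1, show y = s from h.2]
        · rw [show y = r from h.1, show x = s from h.2, Sym2.eq_swap]
        · simp at h'
      have hr : ∀ z, SameSide (joinGraph G H r s) s(Sum.inl p, Sum.inr q) z (Sum.inl r) := by
        rintro (z | z)
        · exact reachable_map_of_adj (G := G) Sum.inl (fun x y h => key _ _ h) (hG z r)
        · exact (reachable_map_of_adj (G := H) Sum.inr (fun x y h => key _ _ h) (hH z s)).trans
            (key (Sum.inr s) (Sum.inl r) ⟨rfl, rfl⟩)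
      exact (hr a).trans (hr c).symm
    induction e using Sym2.ind with
    | _ p q =>
      rcases p with p | p <;> rcases q with q | q
      · left
        have h := sameSide_join_inl (G := G) (r := r) (s := s) hH s(p, q)
        rw [Sym2.map_mk] at h
        exact ⟨s(p, q), (h a b).1 h1, (h c d).1 h2, fun h' => h3 ((h a c).2 h')⟩
      · exact Or.inr (Or.inr (hbr (hno p q rfl)))
      · exact Or.inr (Or.inr (hbr (hno q p Sym2.eq_swap)))
      · right; left
        have h := sameSide_join_inr (H := H) (r := r) (s := s) hG s(p, q)
        rw [Sym2.map_mk] at h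
        exact ⟨s(p, q), (h a b).1 h1, (h c d).1 h2, fun h' => h3 ((h a c).2 h')⟩
  · rintro (⟨e, h⟩ | ⟨e, h⟩ | h)
    · refine ⟨e.map Sum.inl, ?_⟩
      rwa [sameSide_join_inl hH, sameSide_join_inl hH, sameSide_join_inl hH]
    · refine ⟨e.map Sum.inr, ?_⟩
      rwa [sameSide_join_inr hG, sameSide_join_inr hG, sameSide_join_inr hG]
    · refine ⟨s(Sum.inl r, Sum.inr s), ?_⟩
      rwa [sameSide_join_bridge hG hH, sameSide_join_bridge hG hH, sameSide_join_bridge hG hH]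

theorem not_edgeSplit_star (r a b c d : V) : ¬ EdgeSplit (SimpleGraph.starGraph r) a b c d := by
  rintro ⟨hn, e, h1, h2, h3⟩
  have key : ∀ x, e ≠ s(r, x) → SameSide (SimpleGraph.starGraph r) e x r := fun x hx => by
    by_cases hxr : x = r
    · exact hxr ▸ SimpleGraph.Reachable.refl _
    refine SimpleGraph.Reachable.symm (SimpleGraph.Adj.reachable ?_)
    refine SimpleGraph.deleteEdges_adj.2 ⟨?_, fun h => hx h.symm⟩
    simp [SimpleGraph.starGraph_adj, Ne.symm hxr]
  have hne : ∀ x y, x ≠ y → e = s(r, x) → e ≠ s(r, y) := by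
    rintro x y hxy rfl h
    rw [Sym2.congr_right] at h
    exact hxy h
  by_cases ha : e = s(r, a)
  · have hb := key b (hne a b (by grind) ha)
    have hc := key c (hne a c (by grind) ha)
    exact h3 (h1.trans (hb.trans hc.symm))
  · by_cases hc : e = s(r, c)
    · have hd := key d (hne c d (by grind) hc)
      exact h3 ((key a ha).trans (hd.symm.trans h2.symm))
    · exact h3 ((key a ha).trans (key c hc).symm)

end Graph

/-! ### Every finite quartet system comes from a tree -/

section Realize

/-- A realization of a quartet relation by leaves of a finite tree. -/
def IsRealized {X : Type} (D : X → X → X → X → Prop) : Prop :=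
  ∃ (V : Type) (_ : Finite V) (G : SimpleGraph V) (φ : X → V), IsTreeGraph G ∧
    Function.Injective φ ∧ (∀ x, IsLeaf G (φ x)) ∧
    ∀ a b c d, EdgeSplit G (φ a) (φ b) (φ c) (φ d) ↔ D a b c d

variable {X : Type} {D : X → X → X → X → Prop}

theorem QuartetSystem.comap {X Y : Type*} {D : X → X → X → X → Prop} (hD : QuartetSystem D)
    (f : Y → X) (hf : Function.Injective f) :
    QuartetSystem fun a b c d => D (f a) (f b) (f c) (f d) where
  ne₁₂ h h' := hD.ne₁₂ h (congrArg f h')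
  ne₁₃ h h' := hD.ne₁₃ h (congrArg f h')
  swap h := hD.swap h
  symm h := hD.symm h
  excl h := hD.excl h
  five h h1 h2 := hD.five h (fun h' => h1 (hf h')) (fun h' => h2 (hf h'))

theorem QuartetSystem.nodup {X : Type*} {D : X → X → X → X → Prop} (hD : QuartetSystem D)
    {a b c d : X} (h : D a b c d) : [a, b, c, d].Nodup := by
  have h1 := hD.ne₁₂ h
  have h2 := hD.ne₁₂ (hD.symm h)
  have h3 := hD.ne₁₃ h
  have h4 := hD.ne₁₃ (hD.swap h)
  have h5 := hD.ne₁₃ (hD.swap' h)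
  have h6 := hD.ne₁₃ (hD.swap (hD.swap' h))
  simp [h1, h2, h3, h4, h5, h6]

theorem isRealized_of_forall_not (X : Type) [Finite X] {D : X → X → X → X → Prop}
    (h : ∀ a b c d, ¬ D a b c d) : IsRealized D := by
  refine ⟨Option X, inferInstance, SimpleGraph.starGraph none, some,
    ⟨(SimpleGraph.connected_starGraph _).preconnected, SimpleGraph.isAcyclic_starGraph _⟩,
    Option.some_injective X, fun x a ha b hb => ?_, fun a b c d =>
    iff_of_false (not_edgeSplit_star _ _ _ _ _) (h a b c d)⟩
  simp only [SimpleGraph.mem_neighborSet, SimpleGraph.starGraph_adj] at ha hb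
  grind

/-- A quartet `D x y z w` gives a subset `B` containing `x, y` but not `z, w` that is one side of
an edge. -/
theorem exists_split (hD : QuartetSystem D) {x y z w : X} (h : D x y z w) :
    ∃ B : Set X, x ∈ B ∧ y ∈ B ∧ z ∉ B ∧ w ∉ B ∧
      ∀ p ∈ B, ∀ q ∈ B, ∀ d ∉ B, ∀ e ∉ B, p ≠ q → d ≠ e → D p q d e := by
  have s1 := @hD.swap
  have s2 := @hD.symm
  have n1 := @hD.ne₁₂
  have n2 := @hD.ne₁₃
  have key : ∀ t, D x t z w → ∀ d, d ≠ x → ¬ D x d z w → ∀ e, e ≠ x → ¬ D x e z w → d ≠ e →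
      D x t d e := by
    intro t ht d hd hxd e he hxe hde
    have a1 : ∀ d, d ≠ x → ¬ D x d z w → d = z ∨ D x t z d := fun d hd hxd => by
      have := @hD.five t x z w d (hD.swap ht) hd
      grind
    have a2 : ∀ d, d ≠ x → ¬ D x d z w → d = w ∨ D x t w d := fun d hd hxd => by
      have := @hD.five t x w z d (hD.swap (hD.swap' ht)) hd
      grind
    by_cases hdz : d = z
    · grind
    by_cases hdw : d = w
    · grind
    by_cases hez : e = z
    · grind
    have h1 := (a1 d hd hxd).resolve_left hdz
    have h2 := (a1 e he hxe).resolve_left hez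
    rcases @hD.five t x d z e (hD.swap (hD.swap' h1)) he hde.symm with h3 | h3
    · rcases @hD.five t x e z d (hD.swap (hD.swap' h2)) hd hde with h4 | h4
      · exact absurd (hD.swap h4) (hD.excl (hD.swap h3))
      · exact hD.swap (hD.swap' h4)
    · exact hD.swap h3
  have key2 : ∀ t t' d e, D x t d e → D x t' d e → t ≠ t' → D t t' d e := by
    intro t t' d e h1 h2 hne
    have n3 : t' ≠ d := by
      rintro rfl
      exact hD.ne₁₃ (hD.swap h2) rfl
    have n4 : t ≠ d := by
      rintro rfl
      exact hD.ne₁₃ (hD.swap h1) rfl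
    rcases @hD.five x t d e t' h1 hne.symm n3 with h3 | h3
    · exact hD.swap h3
    · rcases @hD.five x t' d e t h2 hne n4 with h4 | h4
      · exact h4
      · exact absurd (hD.swap' h4) (hD.excl (hD.swap' h3))
  refine ⟨{t | t = x ∨ D x t z w}, Or.inl rfl, Or.inr h, ?_, ?_, ?_⟩
  · simp only [Set.mem_ofPred_eq]
    grind
  · simp only [Set.mem_ofPred_eq]
    grind
  · intro p hp q hq d hd e he hpq hde
    simp only [Set.mem_ofPred_eq, not_or] at hp hq hd he
    rcases hp with rfl | hp
    · rcases hq with rfl | hq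
      · exact absurd rfl hpq
      · exact key q hq d hd.1 hd.2 e he.1 he.2 hde
    · rcases hq with rfl | hq
      · exact hD.swap (key p hp d hd.1 hd.2 e he.1 he.2 hde)
      · exact key2 p q d e (key p hp d hd.1 hd.2 e he.1 he.2 hde)
          (key q hq d hd.1 hd.2 e he.1 he.2 hde) hpq

/-- In a quartet with three leaves on one side of a split, the fourth can be replaced by any other
leaf of the other side. -/
theorem quartet_iff_of_split (hD : QuartetSystem D) {B : Set X}
    (hB : ∀ p ∈ B, ∀ q ∈ B, ∀ d ∉ B, ∀ e ∉ B, p ≠ q → d ≠ e → D p q d e) {p q t d e : X}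
    (hq : q ∈ B) (ht : t ∈ B) (hd : d ∉ B) (he : e ∉ B) :
    D p q t d ↔ D p q t e := by
  have key : ∀ d ∉ B, ∀ e ∉ B, D p q t d → D p q t e := by
    intro d hd e he h
    by_cases hde : d = e
    · exact hde ▸ h
    have h1 := hB q hq t ht d hd e he (hD.ne₁₃ (hD.swap h)) hde
    have := @hD.five d t q p e (hD.swap (hD.swap' (hD.symm h))) (by grind) (by grind)
    rcases this with h2 | h2
    · exact hD.symm (hD.swap (hD.swap' h2))
    · exact absurd (hD.swap h1) (hD.excl (hD.swap h2))
  exact ⟨key d hd e he, key e he d hd⟩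

/-- The quartets of a tree obtained by contracting the complement of one side `B` of a split to
the leaf `z`. -/
theorem exists_sameSide_contract (hD : QuartetSystem D) {B : Set X}
    (hB : ∀ p ∈ B, ∀ q ∈ B, ∀ d ∉ B, ∀ e ∉ B, p ≠ q → d ≠ e → D p q d e) {z : X} (hz : z ∉ B)
    {V : Type} {G : SimpleGraph V} {φ : {t // t ∈ B ∨ t = z} → V} (hφ : Function.Injective φ)
    (hGD : ∀ a b c d, EdgeSplit G (φ a) (φ b) (φ c) (φ d) ↔ D a.1 b.1 c.1 d.1) {ψ : X → V}
    (hψ : ∀ t (ht : t ∈ B), ψ t = φ ⟨t, Or.inl ht⟩) (hψ' : ∀ t ∉ B, ψ t = φ ⟨z, Or.inr rfl⟩)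
    {a b c d : X} (hn : [a, b, c, d].Nodup) :
    ((a ∈ B ∨ b ∈ B) → (a ∈ B ∨ c ∈ B) → (a ∈ B ∨ d ∈ B) → (b ∈ B ∨ c ∈ B) → (b ∈ B ∨ d ∈ B) →
      (c ∈ B ∨ d ∈ B) → ((∃ e, SameSide G e (ψ a) (ψ b) ∧ SameSide G e (ψ c) (ψ d) ∧
        ¬ SameSide G e (ψ a) (ψ c)) ↔ D a b c d)) ∧
    ((a ∉ B ∧ c ∉ B) ∨ (a ∉ B ∧ d ∉ B) ∨ (b ∉ B ∧ c ∉ B) ∨ (b ∉ B ∧ d ∉ B) →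
      ¬ ∃ e, SameSide G e (ψ a) (ψ b) ∧ SameSide G e (ψ c) (ψ d) ∧
        ¬ SameSide G e (ψ a) (ψ c)) := by
  let P : X → {t // t ∈ B ∨ t = z} := fun t =>
    if ht : t ∈ B then ⟨t, Or.inl ht⟩ else ⟨z, Or.inr rfl⟩
  have hP : ∀ t, ψ t = φ (P t) := fun t => by
    by_cases ht : t ∈ B
    · simp only [P, dif_pos ht, hψ t ht]
    · simp only [P, dif_neg ht, hψ' t ht]
  have hP1 : ∀ t ∈ B, (P t).1 = t := fun t ht => by simp only [P, dif_pos ht]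
  have hP2 : ∀ t ∉ B, (P t).1 = z := fun t ht => by simp only [P, dif_neg ht]
  have hPz : ∀ t t', t ≠ t' → (t ∈ B ∨ t' ∈ B) → (P t).1 ≠ (P t').1 := by
    intro t t' hne h
    by_cases ht : t ∈ B <;> by_cases ht' : t' ∈ B
    · rwa [hP1 t ht, hP1 t' ht']
    · rw [hP1 t ht, hP2 t' ht']
      exact fun h0 => hz (h0 ▸ ht)
    · rw [hP2 t ht, hP1 t' ht']
      exact fun h0 => hz (h0 ▸ ht')
    · exact absurd h (not_or.2 ⟨ht, ht'⟩)
  constructor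
  · intro h1 h2 h3 h4 h5 h6
    simp only [List.nodup_cons, List.mem_cons, List.not_mem_nil, or_false, not_or, not_false_eq_true,
      List.nodup_nil, and_true] at hn
    obtain ⟨⟨n1, n2, n3⟩, ⟨n4, n5⟩, n6⟩ := hn
    have hn' : [ψ a, ψ b, ψ c, ψ d].Nodup := by
      have key : ∀ t t', t ≠ t' → (t ∈ B ∨ t' ∈ B) → ψ t ≠ ψ t' := fun t t' h h' h0 => by
        rw [hP, hP] at h0
        exact hPz t t' h h' (congrArg Subtype.val (hφ h0))
      simp [key a b n1 h1, key a c n2 h2, key a d n3 h3, key b c n4 h4, key b d n5 h5,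
        key c d n6 h6]
    have hsplit := hGD (P a) (P b) (P c) (P d)
    rw [← hP, ← hP, ← hP, ← hP, EdgeSplit, and_iff_right hn'] at hsplit
    rw [hsplit]
    have T := fun {p q t d e : X} => quartet_iff_of_split hD hB (p := p) (q := q) (t := t)
      (d := d) (e := e)
    have sw : ∀ {a b c d}, D a b c d ↔ D b a c d := ⟨hD.swap, hD.swap⟩
    have sm : ∀ {a b c d}, D a b c d ↔ D c d a b := ⟨hD.symm, hD.symm⟩
    have sw' : ∀ {a b c d}, D a b c d ↔ D a b d c := ⟨hD.swap', hD.swap'⟩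
    by_cases ha : a ∈ B
    · by_cases hb : b ∈ B
      · by_cases hc : c ∈ B
        · by_cases hd : d ∈ B
          · rw [hP1 a ha, hP1 b hb, hP1 c hc, hP1 d hd]
          · rw [hP1 a ha, hP1 b hb, hP1 c hc, hP2 d hd]
            exact T hb hc hz hd
        · have hd : d ∈ B := h6.resolve_left hc
          rw [hP1 a ha, hP1 b hb, hP2 c hc, hP1 d hd, sw', T hb hd hz hc, sw']
      · have hc : c ∈ B := h4.resolve_left hb
        have hd : d ∈ B := h5.resolve_left hb
        rw [hP1 a ha, hP2 b hb, hP1 c hc, hP1 d hd, sm, T hd ha hz hb, sm]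
    · have hb : b ∈ B := h1.resolve_left ha
      have hc : c ∈ B := h2.resolve_left ha
      have hd : d ∈ B := h3.resolve_left ha
      rw [hP2 a ha, hP1 b hb, hP1 c hc, hP1 d hd, sm, sw', T hd hb hz ha, sw', sm]
  · have hψz : ∀ t t', t ∉ B → t' ∉ B → ∀ e, SameSide G e (ψ t) (ψ t') := fun t t' h h' e => by
      rw [hψ' t h, hψ' t' h']
      exact SimpleGraph.Reachable.refl _
    rintro h ⟨e, h1, h2, h3⟩
    rcases h with ⟨h, h'⟩ | ⟨h, h'⟩ | ⟨h, h'⟩ | ⟨h, h'⟩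
    · exact h3 (hψz _ _ h h' e)
    · exact h3 ((hψz _ _ h h' e).trans h2.symm)
    · exact h3 (h1.trans (hψz _ _ h h' e))
    · exact h3 ((h1.trans (hψz _ _ h h' e)).trans h2.symm)

/-- Every finite quartet system comes from a tree: a tree without quartets is a star, and otherwise
the trees for the two sides of a split are joined by an edge. -/
theorem QuartetSystem.isRealized (n : ℕ) : ∀ (X : Type) [Finite X] {D : X → X → X → X → Prop},
    Nat.card X = n → QuartetSystem D → IsRealized D := by
  induction n using Nat.strong_induction_on with
  | _ n ih =>
    intro X _ D hn hD
    by_cases h : ∀ a b c d, ¬ D a b c d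
    · exact isRealized_of_forall_not X h
    push Not at h
    obtain ⟨x, y, z, w, h⟩ := h
    obtain ⟨B, hx, hy, hz, hw, hB⟩ := exists_split hD h
    have hxy := hD.ne₁₂ h
    have hzw := hD.ne₁₂ (hD.symm h)
    have hlt : ∀ (P : X → Prop) (a : X), ¬ P a → Nat.card {t // P t} < n := fun P a ha => by
      rw [← hn]
      exact Finite.card_subtype_lt ha
    -- `z` stands for the complement of `B` in the first tree, and `x` for `B` in the second
    obtain ⟨V, _, G, φ, hG, hφ, hφl, hGD⟩ := ih _ (hlt (fun t => t ∈ B ∨ t = z) w (by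
      rintro (h | h)
      exacts [hw h, hzw h.symm])) {t // t ∈ B ∨ t = z} rfl (hD.comap Subtype.val Subtype.val_injective)
    obtain ⟨W, _, H, ψ, hH, hψ, hψl, hHD⟩ := ih _ (hlt (fun t => t ∉ B ∨ t = x) y (by
      rintro (h | h)
      exacts [h hy, hxy h.symm])) {t // t ∉ B ∨ t = x} rfl (hD.comap Subtype.val Subtype.val_injective)
    set r := φ ⟨z, Or.inr rfl⟩ with hr
    set s := ψ ⟨x, Or.inr rfl⟩ with hs
    let χ : X → V ⊕ W := fun t =>
      if ht : t ∈ B then Sum.inl (φ ⟨t, Or.inl ht⟩) else Sum.inr (ψ ⟨t, Or.inl ht⟩)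
    have hχ1 : ∀ t (ht : t ∈ B), χ t = Sum.inl (φ ⟨t, Or.inl ht⟩) := fun t ht => dif_pos ht
    have hχ2 : ∀ t (ht : t ∉ B), χ t = Sum.inr (ψ ⟨t, Or.inl ht⟩) := fun t ht => dif_neg ht
    have hχ : Function.Injective χ := by
      intro t t' htt
      by_cases ht : t ∈ B <;> by_cases ht' : t' ∈ B
      · rw [hχ1 t ht, hχ1 t' ht'] at htt
        exact congrArg Subtype.val (hφ (Sum.inl_injective htt))
      · rw [hχ1 t ht, hχ2 t' ht'] at htt
        simp at htt
      · rw [hχ2 t ht, hχ1 t' ht'] at htt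
        simp at htt
      · rw [hχ2 t ht, hχ2 t' ht'] at htt
        exact congrArg Subtype.val (hψ (Sum.inr_injective htt))
    refine ⟨V ⊕ W, inferInstance, joinGraph G H r s, χ, isTreeGraph_join hG hH, hχ, ?_, ?_⟩
    · intro t
      by_cases ht : t ∈ B
      · rw [hχ1 t ht]
        have hne : φ ⟨t, Or.inl ht⟩ ≠ r := fun h' =>
          hz (congrArg Subtype.val (hφ h') ▸ ht : (⟨z, Or.inr rfl⟩ : {t // t ∈ B ∨ t = z}).1 ∈ B)
        rintro (a | a) ha (b | b) hb
        · exact congrArg Sum.inl (hφl _ ha hb)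
        · exact absurd hb.1 hne
        · exact absurd ha.1 hne
        · exact absurd ha.1 hne
      · rw [hχ2 t ht]
        have hne : ψ ⟨t, Or.inl ht⟩ ≠ s := fun h' => by
          have := congrArg Subtype.val (hψ h')
          simp only at this
          exact ht (this ▸ hx)
        rintro (a | a) ha (b | b) hb
        · exact absurd ha.2 hne
        · exact absurd ha.2 hne
        · exact absurd hb.2 hne
        · exact congrArg Sum.inr (hψl _ ha hb)
    · intro a b c d
      have hnodup : [χ a, χ b, χ c, χ d].Nodup ↔ [a, b, c, d].Nodup := by
        rw [show [χ a, χ b, χ c, χ d] = [a, b, c, d].map χ from rfl, List.nodup_map_iff hχ]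
      rw [EdgeSplit, exists_split_join_iff hG.1 hH.1, hnodup]
      by_cases hn : [a, b, c, d].Nodup
      swap
      · exact iff_of_false (fun h' => hn h'.1) fun h' => hn (hD.nodup h')
      rw [and_iff_right hn]
      have hB' : ∀ p ∈ Bᶜ, ∀ q ∈ Bᶜ, ∀ d ∉ Bᶜ, ∀ e ∉ Bᶜ, p ≠ q → d ≠ e → D p q d e := by
        intro p hp q hq d hd e he hpq hde
        exact hD.symm (hB d (not_not.1 hd) e (not_not.1 he) p hp q hq hde hpq)
      obtain ⟨g1, g2⟩ := exists_sameSide_contract hD hB hz hφ hGD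
        (ψ := fun t => Sum.elim id (fun _ => r) (χ t)) (fun t ht => by simp only [hχ1 t ht]; rfl)
        (fun t ht => by simp only [hχ2 t ht]; rfl) hn
      obtain ⟨k1, k2⟩ := exists_sameSide_contract hD hB' (not_not.2 hx) hψ hHD
        (ψ := fun t => Sum.elim (fun _ => s) id (χ t)) (fun t ht => by simp only [hχ2 t ht]; rfl)
        (fun t ht => by simp only [hχ1 t (not_not.1 ht)]; rfl) hn
      have l1 : ∀ t, t ∈ B → (χ t).isLeft = true := fun t ht => by rw [hχ1 t ht]; rfl
      have l2 : ∀ t, t ∉ B → (χ t).isLeft = false := fun t ht => by rw [hχ2 t ht]; rfl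
      have e1 : D a c b d → ¬ D a b c d := hD.excl
      have e2 : D a d b c → ¬ D a b c d := fun h1 h2 => hD.excl h1 (hD.swap' h2)
      simp only [List.nodup_cons, List.mem_cons, List.not_mem_nil, or_false, not_or,
        not_false_eq_true, List.nodup_nil, and_true] at hn
      obtain ⟨⟨n1, n2, n3⟩, ⟨n4, n5⟩, n6⟩ := hn
      simp only [Set.mem_compl_iff, not_not] at k1 k2
      have m1 := hB a
      have m2 := hB c
      have m3 : D c d a b → D a b c d := hD.symm
      have m4 : D b d a c → D a c b d := hD.symm
      have m5 : D b c a d → D a d b c := hD.symm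
      have m6 := hB b
      generalize (∃ e, SameSide G e _ _ ∧ _) = SG at g1 g2 ⊢
      generalize (∃ e, SameSide H e _ _ ∧ _) = SH at k1 k2 ⊢
      clear hGD hHD ih hlt hφl hψl hr hs hχ hnodup hB hB' hχ1 hχ2
      by_cases ha : a ∈ B <;> by_cases hb : b ∈ B <;> by_cases hc : c ∈ B <;>
        by_cases hd : d ∈ B <;> grind

end Realize

/-! ### Tree structures as quartet systems -/

section Structures

/-- The relation symbol of the language. -/
abbrev quatR : quatLang.Relations 4 := QuatRel.R

/-- The quaternary relation of a structure. -/
def rel (X : CategoryTheory.Bundled.{0} quatLang.Structure) (a b c d : X) : Prop :=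
  Structure.RelMap (M := X) quatR ![a, b, c, d]

/-- The pairs `a, b` and `c, d` are separated by an edge. -/
def quartet (X : CategoryTheory.Bundled.{0} quatLang.Structure) (a b c d : X) : Prop :=
  rel X a c b d ∧ rel X a d b c

variable {X Y Z : CategoryTheory.Bundled.{0} quatLang.Structure}

theorem rel_map (i : X ↪[quatLang] Y) (a b c d : X) :
    rel Y (i a) (i b) (i c) (i d) ↔ rel X a b c d := by
  rw [rel, rel, ← i.map_rel]
  exact iff_of_eq (congrArg _ (by ext j; fin_cases j <;> rfl))

theorem quartet_map (i : X ↪[quatLang] Y) (a b c d : X) :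
    quartet Y (i a) (i b) (i c) (i d) ↔ quartet X a b c d := by
  rw [quartet, quartet, rel_map, rel_map]

theorem relMap_iff {n : ℕ} (r : quatLang.Relations n) (x : Fin n → X) (f : X → Y)
    (h : ∀ a b c d, rel Y (f a) (f b) (f c) (f d) ↔ rel X a b c d) :
    Structure.RelMap r (f ∘ x) ↔ Structure.RelMap r x := by
  cases r
  have h1 := h (x 0) (x 1) (x 2) (x 3)
  rw [rel, rel] at h1
  convert h1 using 2
  · ext j; fin_cases j <;> rfl
  · ext j; fin_cases j <;> rfl

/-- The relation of `X` is that of a quartet system on a finite set. -/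
structure IsTreeStructure (X : CategoryTheory.Bundled.{0} quatLang.Structure) : Prop where
  finite : Finite X
  quartetSystem : QuartetSystem (quartet X)
  rel_iff : ∀ a b c d, rel X a b c d ↔ quartet X a c b d ∨ quartet X a d b c

theorem isTreeStructure_of_rel [Finite X] {D : X → X → X → X → Prop} (hD : QuartetSystem D)
    (h : ∀ a b c d, rel X a b c d ↔ D a c b d ∨ D a d b c) :
    IsTreeStructure X ∧ ∀ a b c d, quartet X a b c d ↔ D a b c d := by
  have hq : ∀ a b c d, quartet X a b c d ↔ D a b c d := by
    intro a b c d
    rw [quartet, h, h]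
    constructor
    · rintro ⟨h1 | h1, h2⟩
      · exact h1
      · rcases h2 with h2 | h2
        · exact hD.swap' h2
        · exact absurd h1 (hD.excl h2)
    · exact fun h => ⟨Or.inl h, Or.inl (hD.swap' h)⟩
  have : quartet X = D := by
    funext a b c d
    exact propext (hq a b c d)
  exact ⟨⟨‹_›, this ▸ hD, this ▸ h⟩, hq⟩

theorem isTreeStructure_of_mem (hX : X ∈ treeClass) : IsTreeStructure X := by
  obtain ⟨V, _, G, hG, ⟨e⟩⟩ := hX
  have hfin : Finite X := Finite.of_injective (fun x => (e x).1)
    (Subtype.val_injective.comp e.injective)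
  have hD := (quartetSystem_edgeSplit hG).comap (fun x : X => (e x).1)
    (Subtype.val_injective.comp e.injective)
  refine (isTreeStructure_of_rel hD fun a b c d => ?_).1
  have h1 : rel X a b c d ↔ rel (leafStructure G) (e a) (e b) (e c) (e d) :=
    (rel_map e.toEmbedding a b c d).symm
  rw [h1]
  exact pathsCross_iff hG _ _ _ _

theorem mem_of_isTreeStructure (hX : IsTreeStructure X) : X ∈ treeClass := by
  have := hX.finite
  obtain ⟨V, _, G, φ, hG, hφ, hφl, h⟩ := hX.quartetSystem.isRealized _ X rfl
  obtain ⟨W, hW, H, hH, ⟨f⟩⟩ := crossStructure_mem _ V G (Set.range φ) rfl hG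
    (by rintro _ ⟨x, rfl⟩; exact hφl x)
  let E : X ≃ Set.range φ := Equiv.ofInjective φ hφ
  have key : X ≃[quatLang] crossStructure G (Set.range φ) :=
    { E with
      map_fun' := fun f _ => isEmptyElim f
      map_rel' := by
        intro n r x
        refine relMap_iff (Y := crossStructure G (Set.range φ)) r x _ fun a b c d => ?_
        have h1 : rel (crossStructure G (Set.range φ)) (E a) (E b) (E c) (E d) ↔
          PathsCross G (φ a) (φ b) (φ c) (φ d) := Iff.rfl
        rw [hX.rel_iff, ← h, ← h, ← pathsCross_iff hG]
        exact h1 }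
  exact ⟨W, hW, H, hH, ⟨f.comp key⟩⟩

instance (X : treeClass) : Finite X.1 := (isTreeStructure_of_mem X.2).finite

noncomputable instance (X : treeClass) : Fintype X.1 := Fintype.ofFinite _

theorem quartetSystem (X : treeClass) : QuartetSystem (quartet X.1) :=
  (isTreeStructure_of_mem X.2).quartetSystem

/-- An injection preserving and reflecting quartets is an embedding. -/
def embOfQuartet {X Y : treeClass} (f : X.1 → Y.1) (hf : Function.Injective f)
    (h : ∀ a b c d, quartet Y.1 (f a) (f b) (f c) (f d) ↔ quartet X.1 a b c d) :
    X.1 ↪[quatLang] Y.1 where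
  toFun := f
  inj' := hf
  map_fun' := fun f _ => isEmptyElim f
  map_rel' := fun r x => relMap_iff r x f fun a b c d => by
    rw [(isTreeStructure_of_mem X.2).rel_iff, (isTreeStructure_of_mem Y.2).rel_iff, h, h]

/-- The structure with a given quartet system. -/
def ofQuartet {α : Type} (D : α → α → α → α → Prop) :
    CategoryTheory.Bundled.{0} quatLang.Structure :=
  ⟨α, { funMap := fun f _ => isEmptyElim f
        RelMap := fun {n} (r : QuatRel n) => match n, r with
          | _, QuatRel.R => fun x => D (x 0) (x 2) (x 1) (x 3) ∨ D (x 0) (x 3) (x 1) (x 2) }⟩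

instance {α : Type} [h : Finite α] (D : α → α → α → α → Prop) : Finite (ofQuartet D) := h

/-- The member of the class of tree structures with a given quartet system. -/
def treeOfQuartet {α : Type} [Finite α] {D : α → α → α → α → Prop} (hD : QuartetSystem D) :
    treeClass :=
  ⟨ofQuartet D, mem_of_isTreeStructure
    (isTreeStructure_of_rel (X := ofQuartet D) hD fun _ _ _ _ => Iff.rfl).1⟩

theorem quartet_treeOfQuartet {α : Type} [Finite α] {D : α → α → α → α → Prop}
    (hD : QuartetSystem D) (a b c d : α) :
    quartet (treeOfQuartet hD).1 a b c d ↔ D a b c d :=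
  (isTreeStructure_of_rel (X := ofQuartet D) hD fun _ _ _ _ => Iff.rfl).2 a b c d

/-- A surjective embedding is an isomorphism. -/
noncomputable def equivOfSurjective (i : X ↪[quatLang] Y) (hi : Function.Surjective i) :
    X ≃[quatLang] Y where
  toEquiv := Equiv.ofBijective i ⟨i.injective, hi⟩
  map_fun' := fun f _ => isEmptyElim f
  map_rel' := fun r x => i.map_rel r x

/-- The image of an embedding. -/
noncomputable def image {X Y : treeClass} (i : X.1 ↪[quatLang] Y.1) : Finset Y.1 :=
  Finset.univ.map i.toEmbedding

theorem mem_image {X Y : treeClass} {i : X.1 ↪[quatLang] Y.1} {y : Y.1} :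
    y ∈ image i ↔ ∃ x, i x = y := by
  simp only [image, Finset.mem_map, Finset.mem_univ, true_and]
  rfl

/-- The weight of an embedding. -/
noncomputable def embWeight {k : Type*} [CommRing k] (u v : k) (i : Emb treeClass) : k :=
  extWeight (quartet i.tgt.1) u v (image i.hom) Finset.univ

variable {k : Type*} [CommRing k] (u v : k)

theorem embWeight_of_surjective {X Y : treeClass} (i : X.1 ↪[quatLang] Y.1)
    (hi : Function.Surjective i) : embWeight u v ⟨X, Y, i⟩ = 1 := by
  have : image i = Finset.univ := Finset.eq_univ_of_forall fun y => mem_image.2 (hi y)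
  rw [embWeight, this, extWeight_self]

variable {u v} in
theorem embWeight_comp (huv : u * v = 0) {X Y Z : treeClass} (i : X.1 ↪[quatLang] Y.1)
    (j : Y.1 ↪[quatLang] Z.1) :
    embWeight u v ⟨X, Z, j.comp i⟩ = embWeight u v ⟨Y, Z, j⟩ * embWeight u v ⟨X, Y, i⟩ := by
  have h1 : image (j.comp i) = (image i).map j.toEmbedding := by
    rw [image, image, Finset.map_map]
    rfl
  have h2 : image j = (Finset.univ : Finset Y.1).map j.toEmbedding := rfl
  have h3 : embWeight u v ⟨X, Y, i⟩ =
      extWeight (quartet Z.1) u v ((image i).map j.toEmbedding) (image j) := by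
    rw [h2]
    exact (extWeight_map huv (quartetSystem Z) j.toEmbedding (quartet_map j) _ _).symm
  rw [h3, embWeight, embWeight]
  dsimp only
  rw [h1]
  refine extWeight_mul (quartetSystem Z) huv ?_ (Finset.subset_univ _)
  exact Finset.map_subset_map.2 (Finset.subset_univ _)

/-- The weight of a one-leaf extension. -/
theorem embWeight_of_onePoint {X Y : treeClass} (i : X.1 ↪[quatLang] Y.1) (a : Y.1)
    (ha : a ∉ image i) (h : ∀ y, y ≠ a → y ∈ image i) :
    embWeight u v ⟨X, Y, i⟩ = locWeight u v (image i) (Branch (quartet Y.1) (image i) a) := by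
  have : insert a (image i) = Finset.univ := Finset.eq_univ_of_forall fun y => by
    by_cases hy : y = a
    · simp [hy]
    · simp [h y hy]
  rw [embWeight, ← extWeight_insert ha, this]

end Structures

/-! ### Amalgamations -/

section Amalgams

theorem emb_ext {X Y : CategoryTheory.Bundled.{0} quatLang.Structure} {i j : X ↪[quatLang] Y}
    (h : ∀ x, i x = j x) : i = j := FirstOrder.Language.Embedding.ext h

/-- An embedding regarded as an embedding into a subset containing its range. -/
def corestrict {X Y : CategoryTheory.Bundled.{0} quatLang.Structure} (i : X ↪[quatLang] Y)
    (s : Set Y) (h : ∀ x, i x ∈ s) : X ↪[quatLang] induced Y s where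
  toFun := fun x => ⟨i x, h x⟩
  inj' := fun _ _ hxy => i.injective (congrArg Subtype.val hxy)
  map_fun' := fun f _ => isEmptyElim f
  map_rel' := fun r x => i.map_rel r x

theorem exists_equiv_of_range_eq {X Y Z : CategoryTheory.Bundled.{0} quatLang.Structure}
    (g : X ↪[quatLang] Z) (g' : Y ↪[quatLang] Z) (h : Set.range g = Set.range g') :
    ∃ e : X ≃[quatLang] Y, g'.comp e.toEmbedding = g := by
  have h1 : ∀ x, ∃ y, g' y = g x := fun x => by
    have : g x ∈ Set.range g' := h ▸ Set.mem_range_self x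
    exact this
  choose φ hφ using h1
  let i : X ↪[quatLang] Y :=
    { toFun := φ
      inj' := fun x y hxy => g.injective (by rw [← hφ, ← hφ, hxy])
      map_fun' := fun f _ => isEmptyElim f
      map_rel' := fun r x => by
        rw [← g'.map_rel, ← g.map_rel]
        have : g' ∘ φ ∘ x = g ∘ x := by
          ext j
          exact hφ (x j)
        rw [this] }
  have hi : Function.Surjective i := fun y => by
    have : g' y ∈ Set.range g := h ▸ Set.mem_range_self y
    obtain ⟨x, hx⟩ := this
    exact ⟨x, g'.injective ((hφ x).trans hx)⟩
  exact ⟨equivOfSurjective i hi, emb_ext hφ⟩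

variable {X X' X'' Y Y' : treeClass}

/-- Every amalgamation is isomorphic to exactly one member of the family. -/
def IsComplete {i : X.1 ↪[quatLang] Y.1} {f : X.1 ↪[quatLang] X'.1} {ι : Type*}
    (A : ι → Amalgam i f) : Prop :=
  ∀ B : Amalgam i f, ∃! α, B.Iso (A α)

theorem Amalgam.Iso.refl {i : X.1 ↪[quatLang] Y.1} {f : X.1 ↪[quatLang] X'.1} (A : Amalgam i f) :
    A.Iso A := ⟨FirstOrder.Language.Equiv.refl _ _, emb_ext fun _ => rfl, emb_ext fun _ => rfl⟩

/-- An amalgamation with the two given embeddings interchanged. -/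
def Amalgam.flip {i : X.1 ↪[quatLang] Y.1} {f : X.1 ↪[quatLang] X'.1} (A : Amalgam i f) :
    Amalgam f i := ⟨A.Z, A.j₂, A.j₁, A.comm.symm, by rw [Set.union_comm, A.cover]⟩

theorem IsComplete.flip {i : X.1 ↪[quatLang] Y.1} {f : X.1 ↪[quatLang] X'.1} {ι : Type*}
    {A : ι → Amalgam i f} (hA : IsComplete A) : IsComplete fun α => (A α).flip := by
  intro B
  obtain ⟨α, ⟨e, h1, h2⟩, hu⟩ := hA B.flip
  refine ⟨α, ⟨e, h2, h1⟩, ?_⟩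
  rintro β ⟨e', h1', h2'⟩
  exact hu β ⟨e', h2', h1'⟩

theorem amalgam_hom_ext {i : X.1 ↪[quatLang] Y.1} {f : X.1 ↪[quatLang] X'.1} (A : Amalgam i f)
    {Z : treeClass} {g g' : A.Z.1 ↪[quatLang] Z.1} (h1 : g.comp A.j₁ = g'.comp A.j₁)
    (h2 : g.comp A.j₂ = g'.comp A.j₂) : g = g' := by
  refine emb_ext fun z => ?_
  have hz : z ∈ Set.range A.j₁ ∪ Set.range A.j₂ := A.cover ▸ Set.mem_univ z
  rcases hz with ⟨y, rfl⟩ | ⟨y, rfl⟩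
  · exact DFunLike.congr_fun h1 y
  · exact DFunLike.congr_fun h2 y

theorem range_eq_of_comp {i : X.1 ↪[quatLang] Y.1} {f : X.1 ↪[quatLang] X'.1} (A : Amalgam i f)
    {Z : treeClass} (g : A.Z.1 ↪[quatLang] Z.1) :
    Set.range g = Set.range (g.comp A.j₁) ∪ Set.range (g.comp A.j₂) := by
  rw [← Set.image_univ, ← A.cover, Set.image_union, ← Set.range_comp, ← Set.range_comp]
  rfl

/-- Two compatible embeddings factor through a member of a complete family. -/
theorem IsComplete.exists_factor {i : X.1 ↪[quatLang] Y.1} {f : X.1 ↪[quatLang] X'.1} {ι : Type*}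
    {A : ι → Amalgam i f} (hA : IsComplete A) {Z : treeClass} (k₁ : Y.1 ↪[quatLang] Z.1)
    (k₂ : X'.1 ↪[quatLang] Z.1) (h : k₁.comp i = k₂.comp f) :
    ∃ α, ∃ g : (A α).Z.1 ↪[quatLang] Z.1, g.comp (A α).j₁ = k₁ ∧ g.comp (A α).j₂ = k₂ := by
  let s : Set Z.1 := Set.range k₁ ∪ Set.range k₂
  let B : Amalgam i f :=
    { Z := ⟨induced Z.1 s, induced_mem_treeClass Z.2 s⟩
      j₁ := corestrict k₁ s fun y => Or.inl ⟨y, rfl⟩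
      j₂ := corestrict k₂ s fun y => Or.inr ⟨y, rfl⟩
      comm := emb_ext fun x => Subtype.ext (DFunLike.congr_fun h x)
      cover := by
        refine Set.eq_univ_of_forall ?_
        rintro ⟨z, ⟨y, rfl⟩ | ⟨y, rfl⟩⟩
        · exact Or.inl ⟨y, rfl⟩
        · exact Or.inr ⟨y, rfl⟩ }
  obtain ⟨α, ⟨e, h1, h2⟩, -⟩ := hA B
  refine ⟨α, (inducedIncl Z.1 s).comp e.symm.toEmbedding, emb_ext fun y => ?_, emb_ext fun y => ?_⟩
  · have h3 : (A α).j₁ y = e (B.j₁ y) := (DFunLike.congr_fun h1 y).symm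
    have h4 : e.symm ((A α).j₁ y) = B.j₁ y := by rw [h3, e.symm_apply_apply]
    exact congrArg Subtype.val h4
  · have h3 : (A α).j₂ y = e (B.j₂ y) := (DFunLike.congr_fun h2 y).symm
    have h4 : e.symm ((A α).j₂ y) = B.j₂ y := by rw [h3, e.symm_apply_apply]
    exact congrArg Subtype.val h4

theorem IsComplete.factor_unique {i : X.1 ↪[quatLang] Y.1} {f : X.1 ↪[quatLang] X'.1} {ι : Type*}
    {A : ι → Amalgam i f} (hA : IsComplete A) {Z : treeClass} {α β : ι}
    (g : (A α).Z.1 ↪[quatLang] Z.1) (g' : (A β).Z.1 ↪[quatLang] Z.1)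
    (h1 : g.comp (A α).j₁ = g'.comp (A β).j₁) (h2 : g.comp (A α).j₂ = g'.comp (A β).j₂) :
    α = β := by
  obtain ⟨e, he⟩ := exists_equiv_of_range_eq g g'
    (by rw [range_eq_of_comp, range_eq_of_comp, h1, h2])
  have hiso : (A α).Iso (A β) := by
    refine ⟨e, emb_ext fun y => g'.injective ?_, emb_ext fun y => g'.injective ?_⟩
    · exact (DFunLike.congr_fun he _).trans (DFunLike.congr_fun h1 y)
    · exact (DFunLike.congr_fun he _).trans (DFunLike.congr_fun h2 y)
  exact (hA (A α)).unique (Amalgam.Iso.refl _) hiso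

/-- An amalgamation of an amalgamation. -/
def Amalgam.trans {i : X.1 ↪[quatLang] Y.1} {f : X.1 ↪[quatLang] X'.1}
    {f' : X'.1 ↪[quatLang] X''.1} (A : Amalgam i f) (B : Amalgam A.j₂ f') :
    Amalgam i (f'.comp f) where
  Z := B.Z
  j₁ := B.j₁.comp A.j₁
  j₂ := B.j₂
  comm := emb_ext fun x => by
    have h1 : A.j₁ (i x) = A.j₂ (f x) := DFunLike.congr_fun A.comm x
    have h2 : B.j₁ (A.j₂ (f x)) = B.j₂ (f' (f x)) := DFunLike.congr_fun B.comm (f x)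
    change B.j₁ (A.j₁ (i x)) = B.j₂ (f' (f x))
    rw [h1, h2]
  cover := by
    refine Set.eq_univ_of_forall fun z => ?_
    have hz : z ∈ Set.range B.j₁ ∪ Set.range B.j₂ := B.cover ▸ Set.mem_univ z
    rcases hz with ⟨w, rfl⟩ | hz
    · have hw : w ∈ Set.range A.j₁ ∪ Set.range A.j₂ := A.cover ▸ Set.mem_univ w
      rcases hw with ⟨y, rfl⟩ | ⟨y, rfl⟩
      · exact Or.inl ⟨y, rfl⟩
      · exact Or.inr ⟨f' y, (DFunLike.congr_fun B.comm y).symm⟩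
    · exact Or.inr hz

/-- Amalgamating in two steps lists all amalgamations exactly once: an amalgamation over the composite
restricts to an amalgamation over the first embedding. -/
theorem IsComplete.trans {i : X.1 ↪[quatLang] Y.1} {f : X.1 ↪[quatLang] X'.1}
    {f' : X'.1 ↪[quatLang] X''.1} {ι : Type*} {A : ι → Amalgam i f} (hA : IsComplete A)
    {κ : ι → Type*} {B : ∀ α, κ α → Amalgam (A α).j₂ f'} (hB : ∀ α, IsComplete (B α)) :
    IsComplete fun p : Σ α, κ α => (A p.1).trans (B p.1 p.2) := by
  intro E
  obtain ⟨α, g, hg1, hg2⟩ := hA.exists_factor E.j₁ (E.j₂.comp f') E.comm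
  let E' : Amalgam (A α).j₂ f' :=
    { Z := E.Z
      j₁ := g
      j₂ := E.j₂
      comm := hg2
      cover := by
        refine Set.eq_univ_of_forall fun z => ?_
        have hz : z ∈ Set.range E.j₁ ∪ Set.range E.j₂ := E.cover ▸ Set.mem_univ z
        rcases hz with ⟨y, rfl⟩ | hz
        · exact Or.inl ⟨(A α).j₁ y, DFunLike.congr_fun hg1 y⟩
        · exact Or.inr hz }
  obtain ⟨β, ⟨e, h1, h2⟩, hu⟩ := hB α E'
  refine ⟨⟨α, β⟩, ⟨e, emb_ext fun y => ?_, h2⟩, ?_⟩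
  · have h3 : g ((A α).j₁ y) = E.j₁ y := DFunLike.congr_fun hg1 y
    have h4 : e (g ((A α).j₁ y)) = (B α β).j₁ ((A α).j₁ y) := DFunLike.congr_fun h1 _
    rw [h3] at h4
    exact h4
  · rintro ⟨α', β'⟩ ⟨e', h1', h2'⟩
    let g' : (A α').Z.1 ↪[quatLang] E.Z.1 := e'.symm.toEmbedding.comp (B α' β').j₁
    have hg1' : g'.comp (A α').j₁ = E.j₁ := emb_ext fun y => by
      have h3 : e' (E.j₁ y) = (B α' β').j₁ ((A α').j₁ y) := DFunLike.congr_fun h1' y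
      change e'.symm ((B α' β').j₁ ((A α').j₁ y)) = _
      rw [← h3, e'.symm_apply_apply]
    have hg2' : g'.comp (A α').j₂ = E.j₂.comp f' := emb_ext fun y => by
      have h3 : e' (E.j₂ (f' y)) = (B α' β').j₂ (f' y) := DFunLike.congr_fun h2' (f' y)
      have h4 : (B α' β').j₁ ((A α').j₂ y) = (B α' β').j₂ (f' y) :=
        DFunLike.congr_fun (B α' β').comm y
      change e'.symm ((B α' β').j₁ ((A α').j₂ y)) = E.j₂ (f' y)
      rw [h4, ← h3, e'.symm_apply_apply]
    obtain rfl : α' = α := hA.factor_unique g' g (hg1'.trans hg1.symm) (hg2'.trans hg2.symm)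
    have hgg : g' = g := amalgam_hom_ext _ (hg1'.trans hg1.symm) (hg2'.trans hg2.symm)
    have : β' = β := hu β' ⟨e', emb_ext fun y => by
      change e' (g y) = _
      rw [← hgg]
      exact e'.apply_symm_apply _, h2'⟩
    rw [this]

end Amalgams

/-! ### Reduction of condition (c) to one-leaf extensions -/

section Reduction

variable {k : Type*} [CommRing k]

/-- The conditions (a) and (b) of a measure. -/
structure IsMultiplicative (μ : Emb treeClass → k) : Prop where
  surj : ∀ {X Y : treeClass} (i : X.1 ↪[quatLang] Y.1), Function.Surjective i → μ ⟨X, Y, i⟩ = 1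
  comp : ∀ {X Y Z : treeClass} (i : X.1 ↪[quatLang] Y.1) (j : Y.1 ↪[quatLang] Z.1),
    μ ⟨X, Z, j.comp i⟩ = μ ⟨Y, Z, j⟩ * μ ⟨X, Y, i⟩

theorem ClassMeasure.isMultiplicative (μ : ClassMeasure treeClass k) : IsMultiplicative μ.val where
  surj i hi := μ.val_iso _ _ (equivOfSurjective i hi)
  comp i j := μ.val_comp _ _ _ i j

/-- The embedding misses at most one point. -/
def MissesLeOne {X Y : treeClass} (i : X.1 ↪[quatLang] Y.1) : Prop :=
  ∀ y y', y ∉ Set.range i → y' ∉ Set.range i → y = y'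

/-- Every embedding is a composite of embeddings that miss at most one point. -/
theorem emb_induction {Q : ∀ {X Y : treeClass}, (X.1 ↪[quatLang] Y.1) → Prop}
    (surj : ∀ {X Y : treeClass} (i : X.1 ↪[quatLang] Y.1), Function.Surjective i → Q i)
    (step : ∀ {X Y Z : treeClass} (i : X.1 ↪[quatLang] Y.1) (a : Z.1)
      (j : Y.1 ↪[quatLang] Z.1), a ∉ Set.range j → (∀ z, z ≠ a → z ∈ Set.range j) → Q i →
      Q (j.comp i)) {X Y : treeClass} (i : X.1 ↪[quatLang] Y.1) : Q i := by
  induction hn : Nat.card Y.1 using Nat.strong_induction_on generalizing Y with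
  | _ n ih =>
    by_cases hi : Function.Surjective i
    · exact surj i hi
    · simp only [Function.Surjective] at hi
      push Not at hi
      obtain ⟨a, ha⟩ := hi
      let i' : X.1 ↪[quatLang] (markedEmb Y a).src.1 := corestrict i {x | x ≠ a} ha
      have h1 : Q i' := ih _ (by
        rw [← hn]
        exact Finite.card_subtype_lt (p := fun x => x ≠ a) (x := a) (by simp)) i' rfl
      refine step i' a (markedEmb Y a).hom ?_ ?_ h1
      · rintro ⟨x, hx⟩
        exact x.2 hx
      · exact fun z hz => ⟨⟨z, hz⟩, rfl⟩

theorem IsMultiplicative.eq_of_iso {μ : Emb treeClass → k} (hμ : IsMultiplicative μ)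
    {X Z Z' : treeClass} {j : X.1 ↪[quatLang] Z.1} {j' : X.1 ↪[quatLang] Z'.1}
    (e : Z.1 ≃[quatLang] Z'.1) (h : e.toEmbedding.comp j = j') : μ ⟨X, Z, j⟩ = μ ⟨X, Z', j'⟩ := by
  rw [← h, hμ.comp, hμ.surj e.toEmbedding e.surjective, one_mul]

/-- Condition (c) for a pair of embeddings, witnessed by one complete family of amalgamations. -/
def AmalgamSum (μ : Emb treeClass → k) {X Y X' : treeClass} (i : X.1 ↪[quatLang] Y.1)
    (f : X.1 ↪[quatLang] X'.1) : Prop :=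
  ∃ (ι : Type) (_ : Fintype ι) (A : ι → Amalgam i f), IsComplete A ∧
    μ ⟨X, Y, i⟩ = ∑ α, μ ⟨X', (A α).Z, (A α).j₂⟩

/-- The sum in condition (c) does not depend on the chosen complete family. -/
theorem IsMultiplicative.sum_eq {μ : Emb treeClass → k} (hμ : IsMultiplicative μ)
    {X Y X' : treeClass} {i : X.1 ↪[quatLang] Y.1} {f : X.1 ↪[quatLang] X'.1} {ι κ : Type*}
    [Fintype ι] [Fintype κ] {A : ι → Amalgam i f} {B : κ → Amalgam i f} (hA : IsComplete A)
    (hB : IsComplete B) :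
    ∑ α, μ ⟨X', (A α).Z, (A α).j₂⟩ = ∑ β, μ ⟨X', (B β).Z, (B β).j₂⟩ := by
  choose φ hφ hφu using fun α => hB (A α)
  have hsymm : ∀ {A B : Amalgam i f}, A.Iso B → B.Iso A := by
    rintro A B ⟨e, h1, h2⟩
    refine ⟨e.symm, emb_ext fun y => ?_, emb_ext fun y => ?_⟩
    · rw [← h1]
      exact e.symm_apply_apply _
    · rw [← h2]
      exact e.symm_apply_apply _
  have htrans : ∀ {A B C : Amalgam i f}, A.Iso B → B.Iso C → A.Iso C := by
    rintro A B C ⟨e, h1, h2⟩ ⟨e', h1', h2'⟩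
    refine ⟨e'.comp e, emb_ext fun y => ?_, emb_ext fun y => ?_⟩
    · rw [← h1', ← h1]
      rfl
    · rw [← h2', ← h2]
      rfl
  refine Fintype.sum_bijective φ ⟨fun α α' h => ?_, fun β => ?_⟩ _ _ fun α => ?_
  · have h1 : (A α).Iso (A α') := htrans (hφ α) (h ▸ hsymm (hφ α'))
    exact (hA (A α)).unique (Amalgam.Iso.refl _) h1
  · obtain ⟨α, hα, -⟩ := hA (B β)
    exact ⟨α, (hφu α β (hsymm hα)).symm⟩
  · obtain ⟨e, -, h⟩ := hφ α
    exact hμ.eq_of_iso e h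

theorem AmalgamSum.trans_right {μ : Emb treeClass → k} {X Y X' X'' : treeClass}
    {i : X.1 ↪[quatLang] Y.1} {f : X.1 ↪[quatLang] X'.1} {f' : X'.1 ↪[quatLang] X''.1}
    (h : AmalgamSum μ i f) (h' : ∀ A : Amalgam i f, AmalgamSum μ A.j₂ f') :
    AmalgamSum μ i (f'.comp f) := by
  obtain ⟨ι, _, A, hA, hs⟩ := h
  choose κ hκ B hB hsB using fun α => h' (A α)
  refine ⟨Σ α, κ α, inferInstance, _, hA.trans hB, ?_⟩
  rw [hs, Fintype.sum_sigma]
  exact Finset.sum_congr rfl fun α _ => hsB α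

theorem AmalgamSum.trans_left {μ : Emb treeClass → k} (hμ : IsMultiplicative μ)
    {X Y Y' X' : treeClass}
    {i : X.1 ↪[quatLang] Y.1} {j : Y.1 ↪[quatLang] Y'.1} {f : X.1 ↪[quatLang] X'.1}
    (h : AmalgamSum μ i f) (h' : ∀ A : Amalgam i f, AmalgamSum μ j A.j₁) :
    AmalgamSum μ (j.comp i) f := by
  obtain ⟨ι, _, A, hA, hs⟩ := h
  choose κ hκ B hB hsB using fun α => h' (A α)
  refine ⟨Σ α, κ α, inferInstance, _, (hA.flip.trans fun α => (hB α).flip).flip, ?_⟩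
  rw [hμ.comp, hs, Fintype.sum_sigma, Finset.mul_sum]
  refine Finset.sum_congr rfl fun α _ => ?_
  rw [hsB α, Finset.sum_mul]
  refine Finset.sum_congr rfl fun β _ => ?_
  exact (hμ.comp (A α).j₂ (B α β).j₂).symm

theorem MissesLeOne.amalgam {X Y X' : treeClass} {i : X.1 ↪[quatLang] Y.1}
    {f : X.1 ↪[quatLang] X'.1} (hf : MissesLeOne f) (A : Amalgam i f) : MissesLeOne A.j₁ := by
  have key : ∀ z, z ∉ Set.range A.j₁ → ∃ y, y ∉ Set.range f ∧ A.j₂ y = z := by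
    intro z hz
    have hz' : z ∈ Set.range A.j₁ ∪ Set.range A.j₂ := A.cover ▸ Set.mem_univ z
    obtain ⟨y, rfl⟩ := hz'.resolve_left hz
    refine ⟨y, ?_, rfl⟩
    rintro ⟨x, rfl⟩
    exact hz ⟨i x, DFunLike.congr_fun A.comm x⟩
  intro z z' hz hz'
  obtain ⟨y, hy, rfl⟩ := key z hz
  obtain ⟨y', hy', rfl⟩ := key z' hz'
  rw [hf y y' hy hy']

/-- Condition (c) follows from its special case for embeddings that miss at most one point. -/
theorem amalgamSum_of_missesLeOne {μ : Emb treeClass → k} (hμ : IsMultiplicative μ)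
    (h : ∀ {X Y X' : treeClass} (i : X.1 ↪[quatLang] Y.1) (f : X.1 ↪[quatLang] X'.1),
      MissesLeOne i → MissesLeOne f → AmalgamSum μ i f) {X Y X' : treeClass}
    (i : X.1 ↪[quatLang] Y.1) (f : X.1 ↪[quatLang] X'.1) : AmalgamSum μ i f := by
  have hsurj : ∀ {X Y : treeClass} (i : X.1 ↪[quatLang] Y.1), Function.Surjective i →
      MissesLeOne i := fun i hi y _ hy _ => absurd (hi y) hy
  have hone : ∀ {X Y : treeClass} (j : X.1 ↪[quatLang] Y.1) (a : Y.1),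
      (∀ z, z ≠ a → z ∈ Set.range j) → MissesLeOne j := by
    intro X Y j a hj y y' hy hy'
    by_contra hne
    by_cases hya : y = a
    · exact hy' (hj y' fun h => hne (hya.trans h.symm))
    · exact hy (hj y hya)
  have h1 : ∀ {X Y : treeClass} (i : X.1 ↪[quatLang] Y.1) {X' : treeClass}
      (f : X.1 ↪[quatLang] X'.1), MissesLeOne f → AmalgamSum μ i f := by
    intro X Y i
    refine emb_induction (Q := fun {X Y} i => ∀ {X' : treeClass} (f : X.1 ↪[quatLang] X'.1),
      MissesLeOne f → AmalgamSum μ i f) (fun i hi X' f hf => h i f (hsurj i hi) hf) ?_ i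
    intro X Y Z i a j _ hj ih X' f hf
    exact (ih f hf).trans_left hμ fun A => h j A.j₁ (hone j a hj) (hf.amalgam A)
  refine emb_induction (Q := fun {X X'} f => ∀ {Y : treeClass} (i : X.1 ↪[quatLang] Y.1),
    AmalgamSum μ i f) (fun f hf Y i => h1 i f (hsurj f hf)) ?_ f i
  intro X X' X'' f a f' _ hf' ih Y i
  exact (ih i).trans_right fun A => h1 A.j₂ f' (hone f' a hf')

theorem amalgamSum_of_surjective_left {μ : Emb treeClass → k} (hμ : IsMultiplicative μ)
    {X Y X' : treeClass} (i : X.1 ↪[quatLang] Y.1) (f : X.1 ↪[quatLang] X'.1)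
    (hi : Function.Surjective i) : AmalgamSum μ i f := by
  let e := equivOfSurjective i hi
  have he : ∀ x, e.symm (i x) = x := fun x => e.symm_apply_apply x
  let A : Amalgam i f :=
    { Z := X'
      j₁ := f.comp e.symm.toEmbedding
      j₂ := FirstOrder.Language.Embedding.refl _ _
      comm := emb_ext fun x => congrArg f (he x)
      cover := Set.eq_univ_of_forall fun z => Or.inr ⟨z, rfl⟩ }
  refine ⟨Unit, inferInstance, fun _ => A, fun B => ⟨(), ?_, fun _ _ => rfl⟩, ?_⟩
  · have hcomm : ∀ x, B.j₁ (i x) = B.j₂ (f x) := DFunLike.congr_fun B.comm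
    have hB : Function.Surjective B.j₂ := fun z => by
      have hz : z ∈ Set.range B.j₁ ∪ Set.range B.j₂ := B.cover ▸ Set.mem_univ z
      rcases hz with ⟨y, rfl⟩ | hz
      · obtain ⟨x, rfl⟩ := hi y
        exact ⟨f x, (hcomm x).symm⟩
      · exact hz
    let e' := equivOfSurjective B.j₂ hB
    have he' : ∀ x, e'.symm (B.j₂ x) = x := fun x => e'.symm_apply_apply x
    refine ⟨e'.symm, emb_ext fun y => ?_, emb_ext fun y => he' y⟩
    obtain ⟨x, rfl⟩ := hi y
    change e'.symm (B.j₁ (i x)) = f (e.symm (i x))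
    rw [hcomm, he', he]
  · rw [hμ.surj i hi, Finset.univ_unique, Finset.sum_singleton]
    exact (hμ.surj _ Function.surjective_id).symm

theorem amalgamSum_of_surjective_right {μ : Emb treeClass → k} (hμ : IsMultiplicative μ)
    {X Y X' : treeClass} (i : X.1 ↪[quatLang] Y.1) (f : X.1 ↪[quatLang] X'.1)
    (hf : Function.Surjective f) : AmalgamSum μ i f := by
  obtain ⟨ι, _, A, hA, -⟩ := amalgamSum_of_surjective_left hμ f i hf
  refine ⟨ι, inferInstance, _, hA.flip, ?_⟩
  have h1 : ∀ α, μ ⟨X', (A α).Z, (A α).j₁⟩ * μ ⟨X, X', f⟩ =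
      μ ⟨Y, (A α).Z, (A α).j₂⟩ * μ ⟨X, Y, i⟩ := fun α => by
    rw [← hμ.comp, ← hμ.comp, (A α).comm]
  obtain ⟨κ, _, B, hB, hs⟩ := amalgamSum_of_surjective_left hμ f i hf
  have h2 := hμ.sum_eq hA hB
  rw [← hs, hμ.surj f hf] at h2
  have h3 := Finset.sum_congr (rfl : (Finset.univ : Finset ι) = _) fun α _ => h1 α
  rw [← Finset.sum_mul, ← Finset.sum_mul, h2, hμ.surj f hf, one_mul, mul_one] at h3
  exact h3.symm

end Reduction

/-! ### One-leaf extensions and their locations -/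

section OneLeaf

/-- To compare two quartet systems it suffices to compare the quartets without `a` and those whose
first entry is `a`. -/
theorem quartet_iff_of_first {α β : Type*} {D : α → α → α → α → Prop} {D' : β → β → β → β → Prop}
    (hD : QuartetSystem D) (hD' : QuartetSystem D') (g : α → β) (a : α)
    (h1 : ∀ x y z w, x ≠ a → y ≠ a → z ≠ a → w ≠ a → (D' (g x) (g y) (g z) (g w) ↔ D x y z w))
    (h2 : ∀ x y z, x ≠ a → y ≠ a → z ≠ a → (D' (g a) (g x) (g y) (g z) ↔ D a x y z))
    (x y z w : α) : D' (g x) (g y) (g z) (g w) ↔ D x y z w := by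
  have s1 := @hD.swap
  have s2 := @hD.symm
  have s3 := @hD.ne₁₂
  have s4 := @hD.ne₁₃
  have t1 := @hD'.swap
  have t2 := @hD'.symm
  have t3 := @hD'.ne₁₂
  have t4 := @hD'.ne₁₃
  by_cases hx : x = a
  · subst hx
    by_cases hy : y = x
    · grind
    by_cases hz : z = x
    · grind
    by_cases hw : w = x
    · have := @hD.swap'
      have := @hD'.swap'
      grind
    exact h2 y z w hy hz hw
  by_cases hy : y = a
  · subst hy
    by_cases hz : z = y
    · have := @hD.swap'
      have := @hD'.swap'
      grind
    by_cases hw : w = y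
    · have := @hD.swap'
      have := @hD'.swap'
      grind
    have := h2 x z w hx hz hw
    grind
  by_cases hz : z = a
  · subst hz
    by_cases hw : w = z
    · grind
    have := h2 w x y hw hx hy
    grind
  by_cases hw : w = a
  · subst hw
    have := h2 z x y hz hx hy
    grind
  exact h1 x y z w hx hy hz hw

variable {X X' Y Y' : treeClass}

/-- The only point outside the image of `i` is `a`. -/
def MissesOnly (i : X.1 ↪[quatLang] Y.1) (a : Y.1) : Prop := ∀ y, y ∈ image i ↔ y ≠ a

/-- The place at which the leaf `a` is attached to the image of `i`, as a relation on the source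
of `i`. -/
def loc (i : X.1 ↪[quatLang] Y.1) (a : Y.1) (x y : X.1) : Prop :=
  Branch (quartet Y.1) (image i) a (i x) (i y)

theorem apply_mem_image (i : X.1 ↪[quatLang] Y.1) (x : X.1) : i x ∈ image i :=
  mem_image.2 ⟨x, rfl⟩

theorem IsLocation.comap {α β : Type*} {D : α → α → α → α → Prop} {D' : β → β → β → β → Prop}
    (g : α ↪ β) (hg : ∀ a b c d, D' (g a) (g b) (g c) (g d) ↔ D a b c d) {S : Finset α}
    {F : β → β → Prop} (hF : IsLocation D' (S.map g) F) :
    IsLocation D S fun x y => F (g x) (g y) := by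
  have hm : ∀ x ∈ S, g x ∈ S.map g := fun x hx => Finset.mem_map_of_mem g hx
  refine ⟨fun x hx => hF.refl _ (hm x hx), fun x hx y hy => hF.symm _ (hm x hx) _ (hm y hy),
    fun x hx y hy z hz => hF.trans _ (hm x hx) _ (hm y hy) _ (hm z hz), ?_, ?_, ?_⟩
  · intro x hx y hy d hd e he hxy hde h1 h2 h3
    exact (hg _ _ _ _).1 (hF.split _ (hm x hx) _ (hm y hy) _ (hm d hd) _ (hm e he)
      (g.injective.ne hxy) (g.injective.ne hde) h1 h2 h3)
  · intro x hx y hy z hz w hw h1 h2 h3 h4 h5 h6 h7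
    exact hF.node _ (hm x hx) _ (hm y hy) _ (hm z hz) _ (hm w hw) h1 h2 h3 h4 h5 h6
      ((hg _ _ _ _).2 h7)
  · intro x hx y hy hxy
    obtain ⟨z, hz, h⟩ := hF.proper _ (hm x hx) _ (hm y hy) (g.injective.ne hxy)
    obtain ⟨w, hw, rfl⟩ := Finset.mem_map.1 hz
    exact ⟨w, hw, h⟩

theorem isLocation_loc (i : X.1 ↪[quatLang] Y.1) {a : Y.1} (ha : a ∉ image i) :
    IsLocation (quartet X.1) Finset.univ (loc i a) :=
  ((quartetSystem Y).isLocation_branch ha).comap i.toEmbedding (quartet_map i)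

theorem MissesOnly.not_mem {i : X.1 ↪[quatLang] Y.1} {a : Y.1} (h : MissesOnly i a) :
    a ∉ image i := fun h1 => (h a).1 h1 rfl

theorem MissesOnly.ne {i : X.1 ↪[quatLang] Y.1} {a : Y.1} (h : MissesOnly i a) (x : X.1) :
    i x ≠ a := (h _).1 (apply_mem_image i x)

theorem MissesOnly.exists_eq {i : X.1 ↪[quatLang] Y.1} {a : Y.1} (h : MissesOnly i a) {y : Y.1}
    (hy : y ≠ a) : ∃ x, i x = y := mem_image.1 ((h y).2 hy)

/-- The quartets containing the new leaf are determined by its place. -/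
theorem quartet_iff_loc (i : X.1 ↪[quatLang] Y.1) {a : Y.1} (ha : a ∉ image i) (x y z : X.1) :
    quartet Y.1 a (i x) (i y) (i z) ↔ y ≠ z ∧ loc i a y z ∧
      (¬ loc i a x y ∨ ∃ e, ¬ loc i a x e ∧ quartet X.1 e x y z) := by
  rw [(quartetSystem Y).quartet_iff_branch ha (apply_mem_image i x) (apply_mem_image i y)]
  refine and_congr i.injective.ne_iff (and_congr Iff.rfl (or_congr Iff.rfl ?_))
  constructor
  · rintro ⟨e, he, h1, h2⟩
    obtain ⟨e, rfl⟩ := mem_image.1 he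
    exact ⟨e, h1, (quartet_map i _ _ _ _).1 h2⟩
  · rintro ⟨e, h1, h2⟩
    exact ⟨i e, apply_mem_image i e, h1, (quartet_map i _ _ _ _).2 h2⟩

/-- One-leaf extensions with the same place are isomorphic. -/
theorem exists_equiv_of_loc {i : X.1 ↪[quatLang] Y.1} {a : Y.1} (hi : MissesOnly i a)
    {j : X'.1 ↪[quatLang] Y'.1} {b : Y'.1} (hj : MissesOnly j b) (φ : X.1 ≃[quatLang] X'.1)
    (h : ∀ x y, loc i a x y ↔ loc j b (φ x) (φ y)) :
    ∃ e : Y.1 ≃[quatLang] Y'.1, e.toEmbedding.comp i = j.comp φ.toEmbedding ∧ e a = b := by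
  have hex : ∀ y : Y.1, ∃ z : Y'.1, (y = a → z = b) ∧ ∀ x, i x = y → z = j (φ x) := by
    intro y
    by_cases hy : y = a
    · exact ⟨b, fun _ => rfl, fun x hx => absurd (hx.trans hy) (hi.ne x)⟩
    · obtain ⟨x, rfl⟩ := hi.exists_eq hy
      exact ⟨j (φ x), fun h => absurd h hy, fun x' hx' => by rw [i.injective hx']⟩
  choose g hga hgi using hex
  have hga : g a = b := hga a rfl
  have hgi : ∀ x, g (i x) = j (φ x) := fun x => hgi _ x rfl
  have hφq : ∀ x y z w, quartet X'.1 (φ x) (φ y) (φ z) (φ w) ↔ quartet X.1 x y z w :=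
    quartet_map φ.toEmbedding
  have hg : ∀ x y z w, quartet Y'.1 (g x) (g y) (g z) (g w) ↔ quartet Y.1 x y z w := by
    refine quartet_iff_of_first (quartetSystem Y) (quartetSystem Y') g a ?_ ?_
    · intro x y z w hx hy hz hw
      obtain ⟨x, rfl⟩ := hi.exists_eq hx
      obtain ⟨y, rfl⟩ := hi.exists_eq hy
      obtain ⟨z, rfl⟩ := hi.exists_eq hz
      obtain ⟨w, rfl⟩ := hi.exists_eq hw
      simp only [hgi, quartet_map, hφq]
    · intro x y z hx hy hz
      obtain ⟨x, rfl⟩ := hi.exists_eq hx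
      obtain ⟨y, rfl⟩ := hi.exists_eq hy
      obtain ⟨z, rfl⟩ := hi.exists_eq hz
      rw [hga, hgi, hgi, hgi, quartet_iff_loc i hi.not_mem, quartet_iff_loc j hj.not_mem]
      refine and_congr φ.injective.ne_iff (and_congr (h _ _).symm
        (or_congr (not_congr (h _ _).symm) ?_))
      constructor
      · rintro ⟨e, h1, h2⟩
        obtain ⟨e, rfl⟩ := φ.surjective e
        exact ⟨e, fun h3 => h1 ((h _ _).1 h3), (hφq _ _ _ _).1 h2⟩
      · rintro ⟨e, h1, h2⟩
        exact ⟨φ e, fun h3 => h1 ((h _ _).2 h3), (hφq _ _ _ _).2 h2⟩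
  have hginj : Function.Injective g := by
    intro x y hxy
    by_cases hx : x = a
    · by_cases hy : y = a
      · rw [hx, hy]
      · obtain ⟨y, rfl⟩ := hi.exists_eq hy
        rw [hx, hga, hgi] at hxy
        exact absurd hxy.symm (hj.ne _)
    · obtain ⟨x, rfl⟩ := hi.exists_eq hx
      by_cases hy : y = a
      · rw [hy, hga, hgi] at hxy
        exact absurd hxy (hj.ne _)
      · obtain ⟨y, rfl⟩ := hi.exists_eq hy
        rw [hgi, hgi] at hxy
        rw [φ.injective (j.injective hxy)]
  have hgsurj : Function.Surjective g := by
    intro z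
    by_cases hz : z = b
    · exact ⟨a, hga.trans hz.symm⟩
    · obtain ⟨x, rfl⟩ := hj.exists_eq hz
      obtain ⟨x, rfl⟩ := φ.surjective x
      exact ⟨i x, hgi x⟩
  exact ⟨equivOfSurjective (embOfQuartet g hginj hg) hgsurj, emb_ext hgi, hga⟩

/-- The tree structure obtained by attaching a leaf, called `none`, at the place `F`. -/
def addLeaf (X : treeClass) {F : X.1 → X.1 → Prop}
    (hF : IsLocation (quartet X.1) Finset.univ F) : treeClass :=
  treeOfQuartet (hF.quartetSystem_ext (quartetSystem X))

/-- The inclusion of a structure into the one with a leaf attached. -/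
def addLeafEmb (X : treeClass) {F : X.1 → X.1 → Prop}
    (hF : IsLocation (quartet X.1) Finset.univ F) : X.1 ↪[quatLang] (addLeaf X hF).1 :=
  embOfQuartet (X := X) (Y := addLeaf X hF) some (Option.some_injective _)
    fun _ _ _ _ => quartet_treeOfQuartet _ _ _ _ _

/-- The leaf that is attached. -/
def newLeaf (X : treeClass) {F : X.1 → X.1 → Prop}
    (hF : IsLocation (quartet X.1) Finset.univ F) : (addLeaf X hF).1 :=
  (none : Option X.1)

variable {F : X.1 → X.1 → Prop} (hF : IsLocation (quartet X.1) Finset.univ F)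

theorem missesOnly_addLeaf : MissesOnly (addLeafEmb X hF) (newLeaf X hF) := by
  intro y
  rw [mem_image]
  exact (Option.ne_none_iff_exists (o := (y : Option X.1))).symm

theorem quartet_addLeaf : quartet (addLeaf X hF).1 = extQuartet (quartet X.1) F := by
  funext x y z w
  exact propext (quartet_treeOfQuartet _ _ _ _ _)

theorem loc_addLeaf : loc (addLeafEmb X hF) (newLeaf X hF) = F := by
  funext x y
  rw [loc, quartet_addLeaf]
  exact propext (hF.branch_ext x y)

/-- The places of a leaf relative to two nested subtrees. -/
theorem loc_comp {i : X.1 ↪[quatLang] X'.1} (j : X'.1 ↪[quatLang] Y.1) (a : Y.1) (x y : X.1) :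
    loc (j.comp i) a x y ↔
      Branch (quartet Y.1) ((image i).map j.toEmbedding) a (j (i x)) (j (i y)) := by
  have : image (j.comp i) = (image i).map j.toEmbedding := by
    rw [image, image, Finset.map_map]
    rfl
  rw [loc, this]
  rfl

theorem loc_comp_apply (i : X.1 ↪[quatLang] X'.1) (j : X'.1 ↪[quatLang] Y.1) (a : X'.1) :
    loc (j.comp i) (j a) = loc i a := by
  funext x y
  rw [loc_comp]
  exact propext (branch_map j.toEmbedding (quartet_map j) _ _ _ _)

theorem loc_equiv {Z Z' : treeClass} (e : Z.1 ≃[quatLang] Z'.1) (j : X.1 ↪[quatLang] Z.1) (a : Z.1) :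
    loc (e.toEmbedding.comp j) (e a) = loc j a := loc_comp_apply j e.toEmbedding a

variable {i : X.1 ↪[quatLang] Y.1} {f : X.1 ↪[quatLang] X'.1} {a : Y.1} {b : X'.1}

theorem loc_comp_eq {j : X'.1 ↪[quatLang] Y.1} (hj : MissesOnly j a)
    (hG : IsLocation (quartet X'.1) Finset.univ (loc j a)) (f : X.1 ↪[quatLang] X'.1) :
    loc ((addLeafEmb X' hG).comp f) (newLeaf X' hG) = loc (j.comp f) a := by
  obtain ⟨e, he, hea⟩ := exists_equiv_of_loc (missesOnly_addLeaf hG) hj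
    (FirstOrder.Language.Equiv.refl _ _) fun x y => by
      rw [loc_addLeaf]
      rfl
  rw [← loc_equiv e, hea]
  congr 1
  exact emb_ext fun x => DFunLike.congr_fun he (f x)

/-- The place of the image of `a` in an amalgamation, relative to the other structure; it is `none`
if this image is a point of the other structure. -/
noncomputable def Amalgam.place (B : Amalgam i f) (a : Y.1) : Option (X'.1 → X'.1 → Prop) :=
  if B.j₁ a ∈ image B.j₂ then none else some (loc B.j₂ (B.j₁ a))

theorem Amalgam.apply_eq (hi : MissesOnly i a) (hf : MissesOnly f b) (B : Amalgam i f)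
    (h : B.j₁ a ∈ image B.j₂) : B.j₁ a = B.j₂ b := by
  obtain ⟨y, hy⟩ := mem_image.1 h
  by_cases hyb : y = b
  · rw [← hy, hyb]
  · obtain ⟨x, rfl⟩ := hf.exists_eq hyb
    have h1 : B.j₁ (i x) = B.j₂ (f x) := DFunLike.congr_fun B.comm x
    exact absurd (B.j₁.injective (h1.trans hy)) (hi.ne x)

theorem Amalgam.eq_or_exists (hi : MissesOnly i a) (B : Amalgam i f) (z : B.Z.1) :
    z = B.j₁ a ∨ ∃ y, B.j₂ y = z := by
  have hz : z ∈ Set.range B.j₁ ∪ Set.range B.j₂ := B.cover ▸ Set.mem_univ z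
  rcases hz with ⟨y, rfl⟩ | hz
  · by_cases hy : y = a
    · exact Or.inl (by rw [hy])
    · obtain ⟨x, rfl⟩ := hi.exists_eq hy
      exact Or.inr ⟨f x, (DFunLike.congr_fun B.comm x).symm⟩
  · exact Or.inr hz

theorem Amalgam.missesOnly (hi : MissesOnly i a) (B : Amalgam i f) (h : B.j₁ a ∉ image B.j₂) :
    MissesOnly B.j₂ (B.j₁ a) := by
  intro z
  refine ⟨fun hz hza => h (hza ▸ hz), fun hz => ?_⟩
  exact mem_image.2 ((B.eq_or_exists hi z).resolve_left hz)

theorem Amalgam.surjective (hi : MissesOnly i a) (B : Amalgam i f) (h : B.j₁ a ∈ image B.j₂) :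
    Function.Surjective B.j₂ := by
  intro z
  rcases B.eq_or_exists hi z with rfl | hz
  · exact mem_image.1 h
  · exact hz

/-- An amalgamation of two one-leaf extensions is determined by where the first new leaf goes. -/
theorem Amalgam.iso_iff (hi : MissesOnly i a) (hf : MissesOnly f b) (B B' : Amalgam i f) :
    B.Iso B' ↔ B.place a = B'.place a := by
  constructor
  · rintro ⟨e, h1, h2⟩
    have h3 : e (B.j₁ a) = B'.j₁ a := DFunLike.congr_fun h1 a
    have h4 : B'.j₁ a ∈ image B'.j₂ ↔ B.j₁ a ∈ image B.j₂ := by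
      rw [mem_image, mem_image, ← h3, ← h2]
      exact exists_congr fun x => e.injective.eq_iff
    have h5 : loc B'.j₂ (B'.j₁ a) = loc B.j₂ (B.j₁ a) := by rw [← h3, ← h2, loc_equiv]
    simp only [Amalgam.place, h4, h5]
  · intro h
    have key : ∀ e : B.Z.1 ≃[quatLang] B'.Z.1, e.toEmbedding.comp B.j₂ = B'.j₂ →
        e (B.j₁ a) = B'.j₁ a → B.Iso B' := by
      intro e h2 h3
      refine ⟨e, emb_ext fun y => ?_, h2⟩
      by_cases hy : y = a
      · rw [hy]
        exact h3
      · obtain ⟨x, rfl⟩ := hi.exists_eq hy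
        have h4 : B.j₁ (i x) = B.j₂ (f x) := DFunLike.congr_fun B.comm x
        have h5 : B'.j₁ (i x) = B'.j₂ (f x) := DFunLike.congr_fun B'.comm x
        change e (B.j₁ (i x)) = _
        rw [h4, h5]
        exact DFunLike.congr_fun h2 (f x)
    by_cases hB : B.j₁ a ∈ image B.j₂
    · by_cases hB' : B'.j₁ a ∈ image B'.j₂
      · let e := equivOfSurjective B.j₂ (B.surjective hi hB)
        let e' := equivOfSurjective B'.j₂ (B'.surjective hi hB')
        have he : ∀ x, e.symm (B.j₂ x) = x := fun x => e.symm_apply_apply x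
        have h2 : ∀ x, (e'.comp e.symm) (B.j₂ x) = B'.j₂ x := fun x =>
          congrArg B'.j₂ (he x)
        refine key (e'.comp e.symm) (emb_ext h2) ?_
        rw [B.apply_eq hi hf hB, B'.apply_eq hi hf hB']
        exact h2 b
      · simp [Amalgam.place, hB, hB'] at h
    · by_cases hB' : B'.j₁ a ∈ image B'.j₂
      · simp [Amalgam.place, hB, hB'] at h
      · simp only [Amalgam.place, hB, hB', if_false, Option.some.injEq] at h
        obtain ⟨e, h2, h3⟩ := exists_equiv_of_loc (B.missesOnly hi hB) (B'.missesOnly hi hB')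
          (FirstOrder.Language.Equiv.refl _ _) fun x y => by
            rw [h]
            rfl
        exact key e h2 h3

/-- A place `G` in `X'` that restricts along `f` to the place `E`. -/
def IsPlace (f : X.1 ↪[quatLang] X'.1) (E : X.1 → X.1 → Prop) (G : X'.1 → X'.1 → Prop) : Prop :=
  ∃ hG : IsLocation (quartet X'.1) Finset.univ G,
    loc ((addLeafEmb X' hG).comp f) (newLeaf X' hG) = E

theorem Amalgam.isPlace (hi : MissesOnly i a) (B : Amalgam i f)
    (h : B.j₁ a ∉ image B.j₂) : IsPlace f (loc i a) (loc B.j₂ (B.j₁ a)) := by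
  refine ⟨isLocation_loc _ h, ?_⟩
  rw [loc_comp_eq (B.missesOnly hi h), ← B.comm, loc_comp_apply]

theorem Amalgam.loc_eq (hi : MissesOnly i a) (hf : MissesOnly f b) (B : Amalgam i f)
    (h : B.j₁ a ∈ image B.j₂) : loc i a = loc f b := by
  rw [← loc_comp_apply i B.j₁, B.comm, B.apply_eq hi hf h, loc_comp_apply]

theorem exists_amalgam_none (hi : MissesOnly i a) (hf : MissesOnly f b) (h : loc i a = loc f b) :
    ∃ B : Amalgam i f, B.place a = none := by
  obtain ⟨e, h2, h3⟩ := exists_equiv_of_loc hi hf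
    (FirstOrder.Language.Equiv.refl _ _) fun x y => by
      rw [h]
      rfl
  let B : Amalgam i f :=
    { Z := X'
      j₁ := e.toEmbedding
      j₂ := FirstOrder.Language.Embedding.refl _ _
      comm := h2
      cover := Set.eq_univ_of_forall fun z => Or.inr ⟨z, rfl⟩ }
  exact ⟨B, if_pos (mem_image.2 ⟨e a, rfl⟩)⟩

/-- Attach a leaf to `X'` at `G`; the subtree on the new leaf and `X` is isomorphic to `Y`, because
its place is that of `a`. -/
theorem exists_amalgam_some (hi : MissesOnly i a) {G : X'.1 → X'.1 → Prop}
    (h : IsPlace f (loc i a) G) : ∃ B : Amalgam i f, B.place a = some G := by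
  obtain ⟨hG, hGE⟩ := h
  let j := addLeafEmb X' hG
  let n := newLeaf X' hG
  let s : Set (addLeaf X' hG).1 := {z | z = n ∨ ∃ x, j (f x) = z}
  let W : treeClass := ⟨induced _ s, induced_mem_treeClass (addLeaf X' hG).2 s⟩
  let g : X.1 ↪[quatLang] W.1 := corestrict (j.comp f) s fun x => Or.inr ⟨x, rfl⟩
  let n' : W.1 := ⟨n, Or.inl rfl⟩
  have hj : MissesOnly j n := missesOnly_addLeaf hG
  have hg : MissesOnly g n' := by
    intro z
    rw [mem_image]
    constructor
    · rintro ⟨x, rfl⟩ h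
      exact hj.ne (f x) (congrArg Subtype.val h)
    · intro hz
      rcases z.2 with h | ⟨x, h⟩
      · exact absurd (Subtype.ext h) hz
      · exact ⟨x, Subtype.ext h⟩
  have hloc : loc g n' = loc i a := by
    rw [← hGE]
    exact (loc_comp_apply g (inducedIncl _ s : W.1 ↪[quatLang] (addLeaf X' hG).1) n').symm
  obtain ⟨e, h2, h3⟩ := exists_equiv_of_loc hi hg
    (FirstOrder.Language.Equiv.refl _ _) fun x y => by
      rw [hloc]
      rfl
  let B : Amalgam i f :=
    { Z := addLeaf X' hG
      j₁ := (inducedIncl _ s).comp e.toEmbedding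
      j₂ := j
      comm := emb_ext fun x => congrArg Subtype.val (DFunLike.congr_fun h2 x)
      cover := Set.eq_univ_of_forall fun z => by
        by_cases hz : z = n
        · exact Or.inl ⟨a, by rw [hz]; exact congrArg Subtype.val h3⟩
        · obtain ⟨x, rfl⟩ := hj.exists_eq hz
          exact Or.inr ⟨x, rfl⟩ }
  have hn : B.j₁ a = n := congrArg Subtype.val h3
  refine ⟨B, ?_⟩
  have hn' : B.j₁ a ∉ image B.j₂ := hn ▸ hj.not_mem
  rw [Amalgam.place, if_neg hn', hn]
  exact congrArg some (loc_addLeaf hG)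

end OneLeaf

/-! ### Condition (c) for one-leaf extensions -/

section Sum

variable {k : Type*} [CommRing k] {X X' Y : treeClass} {i : X.1 ↪[quatLang] Y.1}
  {f : X.1 ↪[quatLang] X'.1} {a : Y.1} {b : X'.1}

/-- The value of attaching a leaf to `X` at the place `F`, and `0` if `F` is not a place. -/
noncomputable def leafVal (μ : Emb treeClass → k) (X : treeClass) (F : X.1 → X.1 → Prop) : k :=
  if h : IsLocation (quartet X.1) Finset.univ F then μ ⟨X, addLeaf X h, addLeafEmb X h⟩ else 0

theorem IsMultiplicative.eq_leafVal {μ : Emb treeClass → k} (hμ : IsMultiplicative μ)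
    (hi : MissesOnly i a) : μ ⟨X, Y, i⟩ = leafVal μ X (loc i a) := by
  have h := isLocation_loc i hi.not_mem
  obtain ⟨e, he, -⟩ := exists_equiv_of_loc hi (missesOnly_addLeaf h)
    (FirstOrder.Language.Equiv.refl _ _) fun x y => by
      rw [loc_addLeaf]
      rfl
  rw [leafVal, dif_pos h]
  exact hμ.eq_of_iso e he

/-- The places in `X'` that restrict along `f` to the place `E`. -/
noncomputable def places (f : X.1 ↪[quatLang] X'.1) (E : X.1 → X.1 → Prop) :
    Finset (X'.1 → X'.1 → Prop) := Finset.univ.filter (IsPlace f E)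

theorem mem_places {E : X.1 → X.1 → Prop} {G : X'.1 → X'.1 → Prop} :
    G ∈ places f E ↔ IsPlace f E G := by
  simp [places]

/-- Condition (c) for two one-leaf extensions: either the two new leaves coincide, or the first is
attached at a place that restricts to the given one. -/
theorem amalgamSum_iff {μ : Emb treeClass → k} (hμ : IsMultiplicative μ) (hi : MissesOnly i a)
    (hf : MissesOnly f b) : AmalgamSum μ i f ↔
      leafVal μ X (loc i a) = (if loc i a = loc f b then 1 else 0) +
        ∑ G ∈ places f (loc i a), leafVal μ X' G := by
  let P : Option (X'.1 → X'.1 → Prop) → Prop := fun o =>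
    o.elim (loc i a = loc f b) (IsPlace f (loc i a))
  have hex : ∀ o : {o // P o}, ∃ B : Amalgam i f, B.place a = o.1 := by
    rintro ⟨_ | G, h⟩
    · exact exists_amalgam_none hi hf h
    · exact exists_amalgam_some hi h
  choose A hA using hex
  have hval : ∀ B : Amalgam i f, P (B.place a) := by
    intro B
    rw [Amalgam.place]
    split_ifs with h
    · exact B.loc_eq hi hf h
    · exact B.isPlace hi h
  have hc : IsComplete A := by
    intro B
    refine ⟨⟨B.place a, hval B⟩, ?_, ?_⟩
    · exact (Amalgam.iso_iff hi hf _ _).2 (hA ⟨B.place a, hval B⟩).symm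
    · rintro o ho
      rw [Amalgam.iso_iff hi hf, hA] at ho
      exact Subtype.ext ho.symm
  let V : Option (X'.1 → X'.1 → Prop) → k := fun o => o.elim 1 (leafVal μ X')
  have hV : ∀ o, μ ⟨X', (A o).Z, (A o).j₂⟩ = V o.1 := by
    intro o
    rw [← hA o, Amalgam.place]
    split_ifs with h
    · exact hμ.surj _ ((A o).surjective hi h)
    · exact hμ.eq_leafVal ((A o).missesOnly hi h)
  have hsum : ∑ o, μ ⟨X', (A o).Z, (A o).j₂⟩ = (if loc i a = loc f b then 1 else 0) +
        ∑ G ∈ places f (loc i a), leafVal μ X' G := by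
    rw [Fintype.sum_congr _ _ hV, ← Finset.sum_subtype (Finset.univ.filter P) (by simp) V,
      Finset.sum_filter, Fintype.sum_option, places, Finset.sum_filter]
    congr!
  rw [← hsum, ← hμ.eq_leafVal hi]
  constructor
  · rintro ⟨ι, _, A', hA', hs⟩
    rw [hs, hμ.sum_eq hA' hc]
  · exact fun h => ⟨_, inferInstance, A, hc, h⟩

end Sum

/-! ### The places that restrict to a given place -/

section Restriction

variable {α : Type*} [Fintype α] {D : α → α → α → α → Prop} {S : Finset α} {b : α}
  {E G : α → α → Prop}

/-- The place, relative to `S`, of a leaf attached at `G`. -/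
def restrictLoc (D : α → α → α → α → Prop) (S : Finset α) (G : α → α → Prop) (x y : α) : Prop :=
  Branch (extQuartet D G) (S.map Function.Embedding.some) none (some x) (some y)

theorem map_some_eq {_ : DecidableEq (Option α)} (hS : insert b S = Finset.univ) :
    (Finset.univ.map Function.Embedding.some : Finset (Option α)) =
      insert (some b) (S.map Function.Embedding.some) := by
  rw [← hS]
  ext x
  simp [eq_comm]

omit [Fintype α] in
theorem branch_some (x y : α) :
    Branch (extQuartet D G) (S.map Function.Embedding.some) (some b) (some x) (some y) ↔
      Branch D S b x y :=
  branch_map Function.Embedding.some (fun _ _ _ _ => Iff.rfl) S b x y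

variable (hD : QuartetSystem D) (hb : b ∉ S) (hS : insert b S = Finset.univ)
include hD hb hS

theorem restrictLoc_cases (hG : IsLocation D Finset.univ G)
    (hE : ∀ x ∈ S, ∀ y ∈ S, (restrictLoc D S G x y ↔ E x y)) :
    (G = cherryLoc b ∧ ∀ x ∈ S, ∀ y ∈ S, (E x y ↔ Branch D S b x y)) ∨
    (G = newLoc b E ∧ ∀ x ∈ S, ∀ y ∈ S, (E x y ↔ Branch D S b x y)) ∨
    ∃ c ∈ S, (∃ d ∈ S, ¬ E c d) ∧ CoBranch S E (Branch D S b) c ∧ G = joinLoc b c E := by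
  have hmem : ∀ x, x = b ∨ x ∈ S := fun x => by
    have : x ∈ insert b S := hS ▸ Finset.mem_univ x
    simpa using this
  have hm : ∀ {x}, x ∈ S → some x ∈ S.map Function.Embedding.some := fun hx =>
    Finset.mem_map_of_mem Function.Embedding.some hx
  have hm' : ∀ x, some x ∈ (Finset.univ : Finset α).map Function.Embedding.some := fun x =>
    Finset.mem_map_of_mem Function.Embedding.some (Finset.mem_univ x)
  have hbr := hG.branch_ext
  have hE' : ∀ x ∈ S, ∀ y ∈ S, (Branch (extQuartet D G) (S.map Function.Embedding.some) none
      (some x) (some y) ↔ E x y) := hE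
  have hne : none ∉ S.map Function.Embedding.some := by simp
  have hnb : some b ∉ S.map Function.Embedding.some := by simpa using hb
  have hcases := (hG.quartetSystem_ext hD).branch_insert_cases hne hnb (by simp)
  rw [← map_some_eq hS] at hcases
  rcases hcases with
    ⟨h1, h2⟩ | ⟨h1, h2⟩ | ⟨c, hc, ⟨d, hd, hcd⟩, h2, h1⟩
  · refine Or.inl ⟨?_, fun x hx y hy => ?_⟩
    · funext x y
      rw [← hbr, h1 _ (hm' x) _ (hm' y), cherryLoc, cherryLoc, Option.some_inj, Option.some_inj]
    · rw [← hE' x hx y hy, h2 _ (hm hx) _ (hm hy), branch_some]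
  · refine Or.inr (Or.inl ⟨?_, fun x hx y hy => ?_⟩)
    · funext x y
      rw [← hbr, h1 _ (hm' x) _ (hm' y), newLoc, newLoc]
      simp only [Option.some_inj, ne_eq, eq_iff_iff]
      refine or_congr Iff.rfl (and_congr_right fun hx => and_congr_right fun hy => ?_)
      exact hE' x ((hmem x).resolve_left hx) y ((hmem y).resolve_left hy)
    · rw [← hE' x hx y hy, h2 _ (hm hx) _ (hm hy), branch_some]
  · obtain ⟨c, hc', rfl⟩ := Finset.mem_map.1 hc
    obtain ⟨d, hd', rfl⟩ := Finset.mem_map.1 hd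
    refine Or.inr (Or.inr ⟨c, hc', ⟨d, hd', fun h => hcd ((hE' c hc' d hd').2 h)⟩, ?_, ?_⟩)
    · intro d hd e he h3 h4
      have := h2 _ (hm hd) _ (hm he) (fun h => h3 ((hE' c hc' d hd).1 h))
        (fun h => h4 ((hE' c hc' e he).1 h))
      rwa [branch_some] at this
    · funext x y
      have hif : ∀ x {_ : Decidable (some x = some b)}, (if some x = some b then Function.Embedding.some c else some x) =
          some (if x = b then c else x) := fun x _ => by
        by_cases h : x = b <;> simp [h]
      have hin : ∀ x, (if x = b then c else x) ∈ S := fun x => by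
        split_ifs with h
        · exact hc'
        · exact (hmem x).resolve_left h
      rw [← hbr, h1 _ (hm' x) _ (hm' y), joinLoc, joinLoc, hif, hif]
      exact propext (hE' _ (hin x) _ (hin y))

theorem restrictLoc_cherry (hG : IsLocation D Finset.univ (cherryLoc b)) :
    ∀ x ∈ S, ∀ y ∈ S, (restrictLoc D S (cherryLoc b) x y ↔ Branch D S b x y) := by
  intro x hx y hy
  have hm : ∀ {x}, x ∈ S → some x ∈ S.map Function.Embedding.some := fun hx =>
    Finset.mem_map_of_mem Function.Embedding.some hx
  rw [← branch_some (G := cherryLoc b)]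
  refine branch_of_branch_insert_cherry (hG.quartetSystem_ext hD) (by simp) (by simpa using hb) ?_
    _ (hm hx) _ (hm hy)
  rw [← map_some_eq hS]
  intro x hx y hy
  obtain ⟨x, -, rfl⟩ := Finset.mem_map.1 hx
  obtain ⟨y, -, rfl⟩ := Finset.mem_map.1 hy
  refine (hG.branch_ext x y).trans ?_
  simp [cherryLoc]

omit hb in
theorem restrictLoc_of_eq (hE : IsLocation D S E) (hG : IsLocation D Finset.univ G)
    (h : ∀ x ∈ S, ∀ y ∈ S, (G x y ↔ E x y)) :
    ∀ x ∈ S, ∀ y ∈ S, (restrictLoc D S G x y ↔ E x y) := by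
  intro x hx y hy
  have hm : ∀ {x}, x ∈ S → some x ∈ S.map Function.Embedding.some := fun hx =>
    Finset.mem_map_of_mem Function.Embedding.some hx
  let E' : Option α → Option α → Prop := fun x y => ∃ p q, some p = x ∧ some q = y ∧ E p q
  have hE' : ∀ x y, E' (some x) (some y) ↔ E x y := by simp [E']
  have hloc : IsLocation (extQuartet D G) (S.map Function.Embedding.some) E' := by
    refine ⟨?_, ?_, ?_, ?_, ?_, ?_⟩
    · simpa [hE'] using hE.refl
    · simpa [hE'] using hE.symm
    · simpa [hE'] using hE.trans
    · simpa [hE', extQuartet] using hE.split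
    · simpa [hE', extQuartet] using hE.node
    · simpa [hE'] using hE.proper
  rw [← hE']
  refine branch_of_branch_insert (b := some b) (hG.quartetSystem_ext hD) (by simp) hloc ?_
    _ (hm hx) _ (hm hy)
  rw [← map_some_eq hS]
  intro x hx y hy
  obtain ⟨x, hx', rfl⟩ := Finset.mem_map.1 hx
  obtain ⟨y, hy', rfl⟩ := Finset.mem_map.1 hy
  exact ((hG.branch_ext x y).trans (h x hx' y hy')).trans (hE' x y).symm

end Restriction

section Places

variable {X X' : treeClass} {f : X.1 ↪[quatLang] X'.1} {b : X'.1}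
  {E : X.1 → X.1 → Prop} {G : X'.1 → X'.1 → Prop}

/-- A relation on the source of `f` transported to the image. -/
def push (f : X.1 ↪[quatLang] X'.1) (E : X.1 → X.1 → Prop) (x y : X'.1) : Prop :=
  ∃ p q, f p = x ∧ f q = y ∧ E p q

theorem push_apply (x y : X.1) : push f E (f x) (f y) ↔ E x y := by
  constructor
  · rintro ⟨p, q, hp, hq, h⟩
    rwa [f.injective hp, f.injective hq] at h
  · exact fun h => ⟨x, y, rfl, rfl, h⟩

theorem forall_mem_image {P : X'.1 → Prop} : (∀ x ∈ image f, P x) ↔ ∀ x, P (f x) := by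
  constructor
  · exact fun h x => h _ (apply_mem_image f x)
  · intro h x hx
    obtain ⟨x, rfl⟩ := mem_image.1 hx
    exact h x

theorem exists_mem_image {P : X'.1 → Prop} : (∃ x ∈ image f, P x) ↔ ∃ x, P (f x) := by
  constructor
  · rintro ⟨x, hx, h⟩
    obtain ⟨x, rfl⟩ := mem_image.1 hx
    exact ⟨x, h⟩
  · exact fun ⟨x, h⟩ => ⟨f x, apply_mem_image f x, h⟩

theorem push_congr {R : X'.1 → X'.1 → Prop} :
    (∀ x ∈ image f, ∀ y ∈ image f, (R x y ↔ push f E x y)) ↔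
      ∀ x y, (R (f x) (f y) ↔ E x y) := by
  simp only [forall_mem_image, push_apply]

theorem isLocation_push :
    IsLocation (quartet X'.1) (image f) (push f E) ↔ IsLocation (quartet X.1) Finset.univ E := by
  constructor
  · intro h
    have h1 := IsLocation.comap (S := Finset.univ) f.toEmbedding (quartet_map f) h
    have h2 : (fun x y => push f E (f x) (f y)) = E := by
      funext x y
      exact propext (push_apply x y)
    exact h2 ▸ h1
  · intro h
    refine ⟨?_, ?_, ?_, ?_, ?_, ?_⟩
    all_goals simp only [forall_mem_image, exists_mem_image, push_apply, quartet_map,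
      f.injective.ne_iff]
    · exact fun x => h.refl x (Finset.mem_univ x)
    · exact fun x y => h.symm x (Finset.mem_univ x) y (Finset.mem_univ y)
    · exact fun x y z => h.trans x (Finset.mem_univ x) y (Finset.mem_univ y) z (Finset.mem_univ z)
    · exact fun x y d e => h.split x (Finset.mem_univ x) y (Finset.mem_univ y) d
        (Finset.mem_univ d) e (Finset.mem_univ e)
    · exact fun x y d e => h.node x (Finset.mem_univ x) y (Finset.mem_univ y) d
        (Finset.mem_univ d) e (Finset.mem_univ e)
    · intro x y hxy
      obtain ⟨z, -, hz⟩ := h.proper x (Finset.mem_univ x) y (Finset.mem_univ y) hxy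
      exact ⟨z, hz⟩

theorem MissesOnly.insert_image (hf : MissesOnly f b) : insert b (image f) = Finset.univ :=
  Finset.eq_univ_of_forall fun y => by
    by_cases hy : y = b
    · simp [hy]
    · simp [(hf y).2 hy]

theorem isPlace_iff : IsPlace f E G ↔ IsLocation (quartet X'.1) Finset.univ G ∧
    ∀ x ∈ image f, ∀ y ∈ image f, (restrictLoc (quartet X'.1) (image f) G x y ↔ push f E x y) := by
  rw [push_congr, IsPlace]
  have h : ∀ hG : IsLocation (quartet X'.1) Finset.univ G,
      (loc ((addLeafEmb X' hG).comp f) (newLeaf X' hG) = E ↔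
        ∀ x y, (restrictLoc (quartet X'.1) (image f) G (f x) (f y) ↔ E x y)) := by
    intro hG
    rw [funext_iff]
    refine forall_congr' fun x => ?_
    rw [funext_iff]
    refine forall_congr' fun y => ?_
    rw [eq_iff_iff, loc_comp, quartet_addLeaf]
    rfl
  exact ⟨fun ⟨hG, h1⟩ => ⟨hG, (h hG).1 h1⟩, fun ⟨hG, h1⟩ => ⟨hG, (h hG).2 h1⟩⟩

theorem IsPlace.isLocation (h : IsPlace f E G) : IsLocation (quartet X.1) Finset.univ E := by
  obtain ⟨hG, rfl⟩ := h
  refine isLocation_loc _ fun h => ?_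
  obtain ⟨x, hx⟩ := mem_image.1 h
  exact (missesOnly_addLeaf hG).ne (f x) hx

/-- The leaf `b` is attached at the place `E`. -/
theorem loc_eq_iff : E = loc f b ↔
    ∀ x ∈ image f, ∀ y ∈ image f, (push f E x y ↔ Branch (quartet X'.1) (image f) b x y) := by
  simp only [forall_mem_image, push_apply, funext_iff, eq_iff_iff]
  rfl

theorem IsPlace.cases (hf : MissesOnly f b) (h : IsPlace f E G) :
    (G = cherryLoc b ∧ E = loc f b) ∨ (G = newLoc b (push f E) ∧ E = loc f b) ∨
    ∃ c ∈ image f, (∃ d ∈ image f, ¬ push f E c d) ∧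
      CoBranch (image f) (push f E) (Branch (quartet X'.1) (image f) b) c ∧
      G = joinLoc b c (push f E) := by
  rw [loc_eq_iff]
  obtain ⟨hG, h1⟩ := isPlace_iff.1 h
  exact restrictLoc_cases (quartetSystem X') hf.not_mem hf.insert_image hG h1

theorem isPlace_cherry (hf : MissesOnly f b) : IsPlace f (loc f b) (cherryLoc b) := by
  have hG : IsLocation (quartet X'.1) Finset.univ (cherryLoc b) :=
    hf.insert_image ▸ isLocation_cherry hf.not_mem
  refine isPlace_iff.2 ⟨hG, fun x hx y hy => ?_⟩
  rw [restrictLoc_cherry (quartetSystem X') hf.not_mem hf.insert_image hG x hx y hy]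
  exact (loc_eq_iff.1 rfl x hx y hy).symm

theorem isPlace_new (hf : MissesOnly f b) : IsPlace f (loc f b) (newLoc b (push f (loc f b))) := by
  have hG : IsLocation (quartet X'.1) Finset.univ (newLoc b (push f (loc f b))) :=
    hf.insert_image ▸ isLocation_new (quartetSystem X') hf.not_mem (loc_eq_iff.1 rfl)
  refine isPlace_iff.2 ⟨hG, restrictLoc_of_eq (quartetSystem X') hf.insert_image
    (isLocation_push.2 (isLocation_loc f hf.not_mem)) hG fun x hx y hy => ?_⟩
  have h1 := (hf x).1 hx
  have h2 := (hf y).1 hy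
  simp [newLoc, h1, h2]

theorem isPlace_join (hf : MissesOnly f b) (hE : IsLocation (quartet X.1) Finset.univ E) {c : X'.1}
    (hc : c ∈ image f) (hcd : ∃ d ∈ image f, ¬ push f E c d)
    (hco : CoBranch (image f) (push f E) (Branch (quartet X'.1) (image f) b) c) :
    IsPlace f E (joinLoc b c (push f E)) := by
  have hE' := isLocation_push (f := f).2 hE
  have hG : IsLocation (quartet X'.1) Finset.univ (joinLoc b c (push f E)) :=
    hf.insert_image ▸ isLocation_join (quartetSystem X') hf.not_mem hE' hc hcd hco
  refine isPlace_iff.2 ⟨hG, restrictLoc_of_eq (quartetSystem X') hf.insert_image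
    hE' hG fun x hx y hy => ?_⟩
  have h1 := (hf x).1 hx
  have h2 := (hf y).1 hy
  simp [joinLoc, h1, h2]

/-- If a leaf `a` is attached to `X` at another place than `b`, then there is exactly one way of
attaching both. -/
theorem exists_places_eq_singleton (hf : MissesOnly f b)
    (hE : IsLocation (quartet X.1) Finset.univ E) (hne : E ≠ loc f b) :
    ∃ c ∈ image f, (∃ d ∈ image f, ¬ push f E c d) ∧
      CoBranch (image f) (push f E) (Branch (quartet X'.1) (image f) b) c ∧
      places f E = {joinLoc b c (push f E)} := by
  have hE' := isLocation_push (f := f).2 hE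
  have hB := (quartetSystem X').isLocation_branch hf.not_mem
  rw [ne_eq, loc_eq_iff] at hne
  obtain ⟨c, hc, hcd, hco⟩ := exists_coBranch (quartetSystem X') hE' hB hne
  refine ⟨c, hc, hcd, hco, ?_⟩
  ext G
  rw [mem_places, Finset.mem_singleton]
  constructor
  · intro h
    rcases h.cases hf with ⟨-, h1⟩ | ⟨-, h1⟩ | ⟨c', hc', -, hco', rfl⟩
    · exact absurd (loc_eq_iff.1 h1) hne
    · exact absurd (loc_eq_iff.1 h1) hne
    · have hcc : push f E c c' := by
        by_contra h2
        exact hne (coBranch_unique hE' hB hc hc' hco hco' h2)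
      have hif : ∀ x, (if x = b then c' else x) ∈ image f ∧ (if x = b then c else x) ∈ image f ∧
          push f E (if x = b then c' else x) (if x = b then c else x) := fun x => by
        split_ifs with h
        · exact ⟨hc', hc, hE'.symm _ hc _ hc' hcc⟩
        · exact ⟨(hf x).2 h, (hf x).2 h, hE'.refl _ ((hf x).2 h)⟩
      funext x y
      obtain ⟨h1, h2, h3⟩ := hif x
      obtain ⟨h4, h5, h6⟩ := hif y
      refine propext ⟨fun h => ?_, fun h => ?_⟩
      · exact hE'.trans _ h2 _ h1 _ h5 (hE'.symm _ h1 _ h2 h3) (hE'.trans _ h1 _ h4 _ h5 h h6)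
      · exact hE'.trans _ h1 _ h2 _ h4 h3 (hE'.trans _ h2 _ h5 _ h4 h (hE'.symm _ h4 _ h5 h6))
  · rintro rfl
    exact isPlace_join hf hE hc hcd hco

end Places

/-! ### The two families of measures -/

section Existence

variable {X X' Y : treeClass} {f : X.1 ↪[quatLang] X'.1} {b : X'.1}

theorem places_of_subsingleton (hf : MissesOnly f b) (h : ∀ x y, loc f b x y) :
    places f (loc f b) = {cherryLoc b} := by
  have hE := isLocation_loc f hf.not_mem
  have hxy : ∀ x y : X.1, x = y := fun x y => by
    by_contra hne
    obtain ⟨z, -, hz⟩ := hE.proper x (Finset.mem_univ x) y (Finset.mem_univ y) hne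
    exact hz (h x z)
  have hnew : newLoc b (push f (loc f b)) = cherryLoc b := by
    funext x y
    by_cases hx : x = b
    · by_cases hy : y = b <;> simp [newLoc, cherryLoc, hx, hy]
    · by_cases hy : y = b
      · simp [newLoc, cherryLoc, hx, hy]
      · obtain ⟨x, rfl⟩ := hf.exists_eq hx
        obtain ⟨y, rfl⟩ := hf.exists_eq hy
        simp [newLoc, cherryLoc, hx, hy, push_apply, h]
  ext G
  rw [mem_places, Finset.mem_singleton]
  constructor
  · intro hG
    rcases hG.cases hf with ⟨rfl, -⟩ | ⟨rfl, -⟩ | ⟨c, hc, ⟨d, hd, hcd⟩, -⟩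
    · rfl
    · exact hnew
    · obtain ⟨c, rfl⟩ := mem_image.1 hc
      obtain ⟨d, rfl⟩ := mem_image.1 hd
      rw [push_apply] at hcd
      exact absurd (h c d) hcd
  · rintro rfl
    exact isPlace_cherry hf

theorem places_of_three (hf : MissesOnly f b) {c d e : X.1} (hcd : ¬ loc f b c d)
    (hce : ¬ loc f b c e) (hde : ¬ loc f b d e) :
    places f (loc f b) = {cherryLoc b, newLoc b (push f (loc f b))} := by
  have hE := isLocation_loc f hf.not_mem
  ext G
  rw [mem_places, Finset.mem_insert, Finset.mem_singleton]
  constructor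
  · intro hG
    rcases hG.cases hf with ⟨rfl, -⟩ | ⟨rfl, -⟩ | ⟨x, hx, -, hco, -⟩
    · exact Or.inl rfl
    · exact Or.inr rfl
    · obtain ⟨x, rfl⟩ := mem_image.1 hx
      have hco' : ∀ y z, ¬ loc f b x y → ¬ loc f b x z → loc f b y z := fun y z hy hz =>
        hco (f y) (apply_mem_image f y) (f z) (apply_mem_image f z) (by rwa [push_apply])
          (by rwa [push_apply])
      have t := fun x y z => hE.trans x (Finset.mem_univ x) y (Finset.mem_univ y) z
        (Finset.mem_univ z)
      have sy := fun x y => hE.symm x (Finset.mem_univ x) y (Finset.mem_univ y)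
      have h1 := t c x d
      have h2 := t c x e
      have h3 := t d x e
      have h4 := hco' c d
      have h5 := hco' c e
      have h6 := hco' d e
      have h7 := sy x c
      have h8 := sy x d
      tauto
  · rintro (rfl | rfl)
    · exact isPlace_cherry hf
    · exact isPlace_new hf

theorem places_of_pair (hf : MissesOnly f b) {c d : X.1} (hcd : ¬ loc f b c d)
    (hcover : ∀ x, loc f b c x ∨ loc f b d x) :
    places f (loc f b) = {cherryLoc b, newLoc b (push f (loc f b)),
      joinLoc b (f c) (push f (loc f b)), joinLoc b (f d) (push f (loc f b))} := by
  have hE := isLocation_loc f hf.not_mem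
  have t := fun x y z => hE.trans x (Finset.mem_univ x) y (Finset.mem_univ y) z
        (Finset.mem_univ z)
  have sy := fun x y => hE.symm x (Finset.mem_univ x) y (Finset.mem_univ y)
  have hjoin : ∀ x y, loc f b x y → joinLoc b (f x) (push f (loc f b)) =
      joinLoc b (f y) (push f (loc f b)) := by
    intro x y hxy
    funext z w
    have hb : ∀ z, f z ≠ b := fun z => hf.ne z
    by_cases hz : z = b
    · by_cases hw : w = b
      · simp only [joinLoc, hz, hw, if_true, push_apply]
        grind
      · obtain ⟨w, rfl⟩ := hf.exists_eq hw
        simp only [joinLoc, hz, hw, if_true, if_false, push_apply]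
        grind
    · obtain ⟨z, rfl⟩ := hf.exists_eq hz
      by_cases hw : w = b
      · simp only [joinLoc, hz, hw, if_true, if_false, push_apply]
        grind
      · simp only [joinLoc, hz, hw, if_false]
  have hplace : ∀ x y, ¬ loc f b x y → (∀ z, loc f b x z ∨ loc f b y z) →
      IsPlace f (loc f b) (joinLoc b (f x) (push f (loc f b))) := by
    intro x y hxy hcov
    refine isPlace_join hf hE (apply_mem_image f x)
      ⟨f y, apply_mem_image f y, by rwa [push_apply]⟩ ?_
    intro z hz w hw h1 h2
    obtain ⟨z, rfl⟩ := mem_image.1 hz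
    obtain ⟨w, rfl⟩ := mem_image.1 hw
    rw [push_apply] at h1 h2
    have h3 : loc f b z w := by
      have := hcov z
      have := hcov w
      grind
    exact h3
  ext G
  simp only [mem_places, Finset.mem_insert, Finset.mem_singleton]
  constructor
  · intro hG
    rcases hG.cases hf with ⟨rfl, -⟩ | ⟨rfl, -⟩ | ⟨x, hx, -, -, rfl⟩
    · exact Or.inl rfl
    · exact Or.inr (Or.inl rfl)
    · obtain ⟨x, rfl⟩ := mem_image.1 hx
      rcases hcover x with h | h
      · exact Or.inr (Or.inr (Or.inl (hjoin _ _ h).symm))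
      · exact Or.inr (Or.inr (Or.inr (hjoin _ _ h).symm))
  · rintro (rfl | rfl | rfl | rfl)
    · exact isPlace_cherry hf
    · exact isPlace_new hf
    · exact hplace c d hcd hcover
    · exact hplace d c (fun h => hcd (sy _ _ h)) fun z => (hcover z).symm

variable {k : Type*} [CommRing k] {u v : k}

theorem isMultiplicative_embWeight (huv : u * v = 0) : IsMultiplicative (embWeight u v) where
  surj := embWeight_of_surjective u v
  comp := embWeight_comp huv

theorem embWeight_eq_locWeight {i : X.1 ↪[quatLang] Y.1} {a : Y.1} (hi : MissesOnly i a) :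
    embWeight u v ⟨X, Y, i⟩ = locWeight u v Finset.univ (loc i a) := by
  rw [embWeight_of_onePoint u v i a hi.not_mem fun y => (hi y).2]
  exact locWeight_map u v i.toEmbedding fun x _ y _ => Iff.rfl

theorem leafVal_embWeight {F : X.1 → X.1 → Prop} (hF : IsLocation (quartet X.1) Finset.univ F) :
    leafVal (embWeight u v) X F = locWeight u v Finset.univ F := by
  rw [leafVal, dif_pos hF, embWeight_eq_locWeight (missesOnly_addLeaf hF), loc_addLeaf]

/-- Condition (c) for the weights: the weight of a place `E` is the sum of the weights of the places
that restrict to it, plus `1` if the two new leaves can be identified. -/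
theorem sum_locWeight (hf : MissesOnly f b) {E : X.1 → X.1 → Prop}
    (hE : IsLocation (quartet X.1) Finset.univ E) :
    locWeight u v Finset.univ E = (if E = loc f b then 1 else 0) +
      ∑ G ∈ places f E, locWeight u v Finset.univ G := by
  have hb := hf.not_mem
  have hS := hf.insert_image
  have hP := isLocation_push (f := f).2 hE
  have hw : locWeight u v Finset.univ E = locWeight u v (image f) (push f E) :=
    (locWeight_map u v f.toEmbedding fun x _ y _ => (push_apply x y).symm).symm
  by_cases hne : E = loc f b
  · subst hne
    rw [if_pos rfl]
    by_cases h1 : ∀ x y, loc f b x y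
    · rw [places_of_subsingleton hf h1, Finset.sum_singleton, hw]
      have hxy : ∀ x y : X.1, x = y := fun x y => by
        by_contra hne
        obtain ⟨z, -, hz⟩ := hE.proper x (Finset.mem_univ x) y (Finset.mem_univ y) hne
        exact hz (h1 x z)
      -- on at most one leaf: `u + v + 2 = 1 + (u + v + 1)` and `u + v + 1 = 1 + (u + v)`
      rcases isEmpty_or_nonempty X.1 with h0 | ⟨⟨x⟩⟩
      · have h2 : image f = ∅ := by
          ext y
          rw [mem_image]
          simp
        rw [← hS, h2, locWeight_empty, insert_empty_eq, locWeight_singleton]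
        ring
      · have h2 : image f = {f x} := by
          ext y
          rw [mem_image, Finset.mem_singleton]
          exact ⟨fun ⟨z, hz⟩ => by rw [← hz, hxy z x], fun h => ⟨x, h.symm⟩⟩
        have hbx : b ≠ f x := (hf.ne x).symm
        rw [← hS, h2, locWeight_singleton, locWeight, parts_cherry (by simpa using hbx)
          (Finset.mem_singleton_self _), partsWeight_pair]
        · simp only [single, Finset.card_singleton, if_true]
          ring
        · simpa using hbx
    · push Not at h1
      obtain ⟨c, d, hcd⟩ := h1
      have hc := apply_mem_image f c
      have hd := apply_mem_image f d
      have hcd' : ¬ push f (loc f b) (f c) (f d) := by rwa [push_apply]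
      have hcdne : f c ≠ f d := fun h => hcd' (h ▸ hP.refl _ hc)
      have hcb := hf.ne c
      have hdb := hf.ne d
      have hcherry := locWeight_cherry u v hb hc hd hcdne
      have hnew1 : cherryLoc b ≠ newLoc b (push f (loc f b)) := by
        intro h
        have h2 := congrFun₂ h (f c) (f d)
        simp [cherryLoc, newLoc, hcb, hdb, hcd'] at h2
      by_cases h2 : ∃ e, ¬ loc f b c e ∧ ¬ loc f b d e
      · obtain ⟨e, hce, hde⟩ := h2
        -- a node with `n` branches: besides the leg of `b` there is the node itself, which now has
        -- `n + 1` branches, and `v + 1 - (n - 1) (u + 1) = 1 + u + (v + 1 - n (u + 1))`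
        have h3 := three_le_card_parts hP hc hd (apply_mem_image f e) hcd' (by rwa [push_apply])
          (by rwa [push_apply])
        rw [places_of_three hf hcd hce hde, Finset.sum_pair hnew1, hw, ← hS, hcherry,
          locWeight_new u v hb (by omega), locWeight, partsWeight_of_three_le u v h3]
        ring
      · push Not at h2
        -- an edge: the leg of `b`, the new node, and the two halves of the edge, at each of which one
        -- end is now a node
        have hcover : ∀ x, loc f b c x ∨ loc f b d x := fun x => by
          by_cases h : loc f b c x
          · exact Or.inl h
          · exact Or.inr (h2 x h)
        have hcover' : ∀ x ∈ image f, push f (loc f b) (f c) x ∨ push f (loc f b) (f d) x := by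
          simpa only [forall_mem_image, push_apply] using hcover
        have hcard : (parts (image f) (push f (loc f b))).card = 2 := by
          rw [parts_eq_pair hP hc hd hcover', Finset.card_pair (filter_ne hP hd hcd')]
        have hdc' : ¬ push f (loc f b) (f d) (f c) := fun h => hcd' (hP.symm _ hd _ hc h)
        have hcc : push f (loc f b) (f c) (f c) := hP.refl _ hc
        have hdd : push f (loc f b) (f d) (f d) := hP.refl _ hd
        have hd1 : joinLoc b (f c) (push f (loc f b)) ≠ joinLoc b (f d) (push f (loc f b)) := by
          intro h
          have h2 := congrFun₂ h b (f c)
          simp [joinLoc, hcb, hdc', hcc] at h2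
        have hd2 : ∀ x, push f (loc f b) (f x) (f x) →
            newLoc b (push f (loc f b)) ≠ joinLoc b (f x) (push f (loc f b)) := by
          intro x hx h
          have h2 := congrFun₂ h b (f x)
          simp [joinLoc, newLoc, hf.ne x, hx] at h2
        have hd3 : ∀ x, push f (loc f b) (f x) (f x) →
            cherryLoc b ≠ joinLoc b (f x) (push f (loc f b)) := by
          intro x hx h
          have h2 := congrFun₂ h b (f x)
          simp [joinLoc, cherryLoc, hf.ne x, hx] at h2
        rw [places_of_pair hf hcd hcover, Finset.sum_insert, Finset.sum_insert, Finset.sum_pair hd1,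
          hw, ← hS, hcherry, locWeight_new u v hb hcard.ge, hcard,
          locWeight_pair u v hP hc hd hcd' hcover',
          locWeight_join_pair u v hb hP hc hd hcd' hcover',
          locWeight_join_pair u v hb hP hd hc hdc' fun x hx => (hcover' x hx).symm]
        · push_cast
          ring
        · simp only [Finset.mem_insert, Finset.mem_singleton, not_or]
          exact ⟨hd2 c hcc, hd2 d hdd⟩
        · simp only [Finset.mem_insert, Finset.mem_singleton, not_or]
          exact ⟨hnew1, hd3 c hcc, hd3 d hdd⟩
  · obtain ⟨c, hc, hcd, hco, hpl⟩ := exists_places_eq_singleton hf hE hne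
    rw [if_neg hne, zero_add, hpl, Finset.sum_singleton, hw, ← hS,
      locWeight_join u v hb hP ((quartetSystem X').isLocation_branch hb) hc hcd hco fun h =>
        hne (loc_eq_iff.2 h)]

theorem missesLeOne_cases {i : X.1 ↪[quatLang] Y.1} (hi : MissesLeOne i) :
    Function.Surjective i ∨ ∃ a, MissesOnly i a := by
  by_cases h : Function.Surjective i
  · exact Or.inl h
  · simp only [Function.Surjective] at h
    push Not at h
    obtain ⟨a, ha⟩ := h
    refine Or.inr ⟨a, fun y => ?_⟩
    rw [mem_image]
    constructor
    · rintro ⟨x, rfl⟩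
      exact ha x
    · intro hy
      by_contra h
      exact hy (hi y a h fun ⟨x, hx⟩ => ha x hx)

theorem amalgamSum_embWeight (huv : u * v = 0) (i : X.1 ↪[quatLang] Y.1)
    (f : X.1 ↪[quatLang] X'.1) : AmalgamSum (embWeight u v) i f := by
  have hμ := isMultiplicative_embWeight huv
  refine amalgamSum_of_missesLeOne hμ ?_ i f
  intro X Y X' i f hi hf
  rcases missesLeOne_cases hi with hi | ⟨a, hi⟩
  · exact amalgamSum_of_surjective_left hμ i f hi
  rcases missesLeOne_cases hf with hf | ⟨b, hf⟩
  · exact amalgamSum_of_surjective_right hμ i f hf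
  rw [amalgamSum_iff hμ hi hf]
  have hE := isLocation_loc i hi.not_mem
  rw [leafVal_embWeight hE, sum_locWeight hf hE]
  congr 1
  exact Finset.sum_congr rfl fun G hG =>
    (leafVal_embWeight (isPlace_iff.1 (mem_places.1 hG)).1).symm

/-- The measure with parameters `u` and `v`. -/
noncomputable def stdMeasure (u v : k) (huv : u * v = 0) : ClassMeasure treeClass k where
  val := embWeight u v
  val_iso _ _ e := embWeight_of_surjective u v e.toEmbedding e.surjective
  val_comp _ _ _ i j := embWeight_comp huv i j
  val_amalgam X Y X' i f n A hA := by
    obtain ⟨ι, _, B, hB, h⟩ := amalgamSum_embWeight huv i f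
    rw [h]
    exact (isMultiplicative_embWeight huv).sum_eq hB hA

end Existence

/-! ### Measures are determined by their values at two marked trees -/

section Reduction

variable {X X' Y : treeClass} {f : X.1 ↪[quatLang] X'.1} {b : X'.1}

theorem MissesOnly.card (hf : MissesOnly f b) : Fintype.card X'.1 = Fintype.card X.1 + 1 := by
  rw [← Finset.card_univ, ← hf.insert_image, Finset.card_insert_of_notMem hf.not_mem, image,
    Finset.card_map, Finset.card_univ]

theorem missesOnly_markedEmb (X : treeClass) (a : X.1) : MissesOnly (markedEmb X a).hom a := by
  intro y
  rw [mem_image]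
  constructor
  · rintro ⟨x, rfl⟩
    exact x.2
  · exact fun h => ⟨⟨y, h⟩, rfl⟩

theorem exists_missesOnly (X' : treeClass) (b : X'.1) :
    ∃ (X : treeClass) (f : X.1 ↪[quatLang] X'.1), MissesOnly f b :=
  ⟨_, _, missesOnly_markedEmb X' b⟩

theorem QuartetSystem.ne {α : Type*} {D : α → α → α → α → Prop} (hD : QuartetSystem D) {a b c d : α}
    (h : D a b c d) : a ≠ b ∧ a ≠ c ∧ a ≠ d ∧ b ≠ c ∧ b ≠ d ∧ c ≠ d :=
  ⟨hD.ne₁₂ h, hD.ne₁₃ h, hD.ne₁₃ (hD.swap' h), hD.ne₁₃ (hD.swap h),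
    hD.ne₁₃ (hD.swap (hD.swap' h)), hD.ne₁₂ (hD.symm h)⟩

variable {k : Type*} [CommRing k]

/-- The conditions (a), (b) and (c) of a measure. -/
structure IsMeasure (μ : Emb treeClass → k) : Prop extends IsMultiplicative μ where
  amalgam : ∀ {X Y X' : treeClass} (i : X.1 ↪[quatLang] Y.1) (f : X.1 ↪[quatLang] X'.1),
    AmalgamSum μ i f

/-- A leaf `b` of `X'` can be removed without changing the value at the place `G`. -/
structure Removable (R : Type*) [CommRing R] (G : X'.1 → X'.1 → Prop) (f : X.1 ↪[quatLang] X'.1)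
    (b : X'.1) (E : X.1 → X.1 → Prop) : Prop where
  misses : MissesOnly f b
  isLocation : IsLocation (quartet X.1) Finset.univ E
  iff : ∀ x y, E x y ↔ G (f x) (f y)
  exists_ne : ∃ c, c ≠ b ∧ G b c
  eq : ∀ μ : Emb treeClass → R, IsMeasure μ → leafVal μ X' G = leafVal μ X E

theorem isMeasure_embWeight {u v : k} (huv : u * v = 0) : IsMeasure (embWeight u v) :=
  ⟨isMultiplicative_embWeight huv, amalgamSum_embWeight huv⟩

theorem ClassMeasure.isMeasure (μ : ClassMeasure treeClass k) : IsMeasure μ.val := by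
  refine ⟨μ.isMultiplicative, fun {X Y X'} i f => ?_⟩
  obtain ⟨ι, _, A, hA, -⟩ := amalgamSum_embWeight (zero_mul (0 : k)) i f
  refine ⟨ι, inferInstance, A, hA, ?_⟩
  let e := Fintype.equivFin ι
  have hA' : IsAmalgamList fun n => A (e.symm n) := by
    intro B
    obtain ⟨α, hα, hu⟩ := hA B
    refine ⟨e α, by simpa using hα, fun n hn => ?_⟩
    rw [← hu _ hn, e.apply_symm_apply]
  rw [μ.val_amalgam X Y X' i f _ _ hA']
  exact Fintype.sum_equiv e.symm _ _ fun n => rfl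

/-- Condition (c) for attaching a leaf to `X` at the place `E`, when `b` has been attached. -/
theorem IsMeasure.leafVal_sum {μ : Emb treeClass → k} (hμ : IsMeasure μ) (hf : MissesOnly f b)
    {E : X.1 → X.1 → Prop} (hE : IsLocation (quartet X.1) Finset.univ E) :
    leafVal μ X E = (if E = loc f b then 1 else 0) + ∑ G ∈ places f E, leafVal μ X' G := by
  have h := (amalgamSum_iff hμ.toIsMultiplicative (missesOnly_addLeaf hE) hf).1
    (hμ.amalgam (addLeafEmb X hE) f)
  rwa [loc_addLeaf] at h

theorem IsMultiplicative.leafVal_congr {μ : Emb treeClass → k} (hμ : IsMultiplicative μ)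
    {F : X.1 → X.1 → Prop} {F' : X'.1 → X'.1 → Prop}
    (hF : IsLocation (quartet X.1) Finset.univ F) (hF' : IsLocation (quartet X'.1) Finset.univ F')
    (φ : X.1 ≃[quatLang] X'.1) (h : ∀ x y, F x y ↔ F' (φ x) (φ y)) :
    leafVal μ X F = leafVal μ X' F' := by
  obtain ⟨e, he, -⟩ := exists_equiv_of_loc (missesOnly_addLeaf hF) (missesOnly_addLeaf hF') φ
    fun x y => by rw [loc_addLeaf, loc_addLeaf, h]
  have h1 := hμ.comp (addLeafEmb X hF) e.toEmbedding
  rw [he, hμ.comp, hμ.surj φ.toEmbedding φ.surjective, hμ.surj e.toEmbedding e.surjective,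
    mul_one, one_mul] at h1
  rw [leafVal, dif_pos hF, leafVal, dif_pos hF', h1]

/-- A leaf can be removed unless it is a branch by itself or there are only two branches, which are
those at which the leaf itself is attached. -/
theorem exists_removable (R : Type*) [CommRing R] {G : X'.1 → X'.1 → Prop}
    (hG : IsLocation (quartet X'.1) Finset.univ G) (b : X'.1) :
    (∃ (X : treeClass) (f : X.1 ↪[quatLang] X'.1) (E : X.1 → X.1 → Prop), Removable R G f b E) ∨
      (∀ y, y ≠ b → ¬ G b y) ∨
      ((∀ d e, ¬ G b d → ¬ G b e → G d e) ∧
        ∀ x y d, x ≠ b → y ≠ b → x ≠ y → G x y → ¬ G x d → d ≠ b → quartet X'.1 b d x y) := by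
  obtain ⟨X, f, hf⟩ := exists_missesOnly X' b
  obtain ⟨E, hp⟩ : ∃ E, IsPlace f E G := ⟨_, hG, rfl⟩
  have hE : IsLocation (quartet X.1) Finset.univ E := hp.isLocation
  by_cases hne : E = loc f b
  -- `E = loc f b`: two new leaves attached to `X` at the same place
  · right
    rcases hp.cases hf with ⟨rfl, -⟩ | ⟨rfl, -⟩ | ⟨c, hc, -, hco, rfl⟩
    · left
      simp [cherryLoc]
    · left
      intro y hy
      simp [newLoc, hy]
    · right
      have hcb := (hf c).1 hc
      have hval : ∀ x y, x ≠ b → y ≠ b → (joinLoc b c (push f E) x y ↔ push f E x y) := by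
        intro x y hx hy
        simp [joinLoc, hx, hy]
      have hvb : ∀ y, y ≠ b → (joinLoc b c (push f E) b y ↔ push f E c y) := by
        intro y hy
        simp [joinLoc, hy]
      have hP := isLocation_push (f := f).2 hE
      have hbr := loc_eq_iff.1 hne
      have hbb : joinLoc b c (push f E) b b := by
        simp only [joinLoc, if_true]
        exact hP.refl c hc
      constructor
      · intro d e hd he
        have hdb : d ≠ b := fun h => hd (h ▸ hbb)
        have heb : e ≠ b := fun h => he (h ▸ hbb)
        rw [hvb d hdb] at hd
        rw [hvb e heb] at he
        rw [hval d e hdb heb, hbr d ((hf d).2 hdb) e ((hf e).2 heb)]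
        exact hco d ((hf d).2 hdb) e ((hf e).2 heb) hd he
      · intro x y d hx hy hxy h1 h2 hd
        rw [hval x y hx hy, hbr x ((hf x).2 hx) y ((hf y).2 hy)] at h1
        rw [hval x d hx hd, hbr x ((hf x).2 hx) d ((hf d).2 hd)] at h2
        exact (quartetSystem X').branch_apart hf.not_mem ((hf d).2 hd) hxy h1 h2
  · left
    obtain ⟨c, hc, hcd, hco, hpl⟩ := exists_places_eq_singleton hf hE hne
    have hGE : G = joinLoc b c (push f E) := by
      rw [← Finset.mem_singleton, ← hpl, mem_places]
      exact hp
    refine ⟨_, f, E, hf, hE, fun x y => ?_, ⟨c, (hf c).1 hc, ?_⟩, fun μ hμ => ?_⟩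
    · have h1 := hf.ne x
      have h2 := hf.ne y
      rw [hGE]
      simp [joinLoc, h1, h2, push_apply]
    · rw [hGE]
      have h1 := (hf c).1 hc
      simp only [joinLoc, h1, if_true, if_false]
      exact (isLocation_push (f := f).2 hE).refl c hc
    · rw [hμ.leafVal_sum hf hE, if_neg hne, hpl, Finset.sum_singleton, zero_add, ← hGE]

/-- Three leaves in different branches. -/
def HasThree {α : Type*} (F : α → α → Prop) : Prop := ∃ x y z, ¬ F x y ∧ ¬ F x z ∧ ¬ F y z

/-- Each branch is a single leaf. -/
def IsStar {α : Type*} (F : α → α → Prop) : Prop := ∀ x y, F x y → x = y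

/-- Two branches, with one and two leaves. -/
def IsOneTwo {α : Type*} (F : α → α → Prop) : Prop :=
  ∃ p q d, p ≠ q ∧ F p q ∧ ¬ F p d ∧ ∀ x, x = p ∨ x = q ∨ x = d

/-- Two branches, with two leaves each. -/
def IsTwoTwo {α : Type*} (F : α → α → Prop) : Prop :=
  ∃ p q d e, p ≠ q ∧ d ≠ e ∧ F p q ∧ F d e ∧ ¬ F p d ∧ ∀ x, x = p ∨ x = q ∨ x = d ∨ x = e

/-- If no leaf can be removed, then all branches are single leaves, or there are two branches, of sizes
one and two, or two and two. -/
theorem exists_removable_or (R : Type*) [CommRing R] {F : X.1 → X.1 → Prop}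
    (hF : IsLocation (quartet X.1) Finset.univ F) :
    (∃ (X' : treeClass) (f : X'.1 ↪[quatLang] X.1) (b : X.1) (E : X'.1 → X'.1 → Prop),
      Removable R F f b E) ∨ IsStar F ∨ (¬ HasThree F ∧ (IsOneTwo F ∨ IsTwoTwo F)) := by
  have r := fun x => hF.refl x (Finset.mem_univ x)
  have t := fun x y z => hF.trans x (Finset.mem_univ x) y (Finset.mem_univ y) z (Finset.mem_univ z)
  have sy := fun x y => hF.symm x (Finset.mem_univ x) y (Finset.mem_univ y)
  have hD := quartetSystem X
  by_cases hs : IsStar F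
  · exact Or.inr (Or.inl hs)
  rw [or_iff_not_imp_left]
  intro hno
  have hno' := fun b => (exists_removable R hF b).resolve_left
    fun ⟨X', f, E, h⟩ => hno ⟨X', f, b, E, h⟩
  refine Or.inr ?_
  simp only [IsStar] at hs
  push Not at hs
  obtain ⟨p, q, hpq, hne⟩ := hs
  have h2 : ∀ d e, ¬ F p d → ¬ F p e → F d e := by
    rcases hno' p with h | h
    · exact absurd hpq (h q hne.symm)
    · exact h.1
  have h3 : ¬ HasThree F := by
    rintro ⟨x, y, z, hxy, hxz, hyz⟩
    have a1 := h2 x y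
    have a2 := h2 x z
    have a3 := h2 y z
    have b1 := t x p y
    have b2 := t x p z
    have b3 := t y p z
    have c1 := sy p x
    have c2 := sy p y
    tauto
  refine ⟨h3, ?_⟩
  -- a branch with three leaves `x, y, z` would be split both as `y, z` against `x`
  -- and as `x, z` against `y`
  have key : ∀ x y z, x ≠ y → x ≠ z → y ≠ z → F x y → F x z → False := by
    intro x y z hxy hxz hyz h4 h5
    obtain ⟨d, -, hd⟩ := hF.proper x (Finset.mem_univ x) y (Finset.mem_univ y) hxy
    have hdx : d ≠ x := fun h => hd (h ▸ r x)
    have hdy : d ≠ y := fun h => hd (h ▸ h4)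
    have hx : quartet X.1 x d y z := by
      rcases hno' x with h | h
      · exact absurd h4 (h y hxy.symm)
      · exact h.2 y z d hxy.symm hxz.symm hyz (t _ _ _ (sy _ _ h4) h5)
          (fun h => hd (t _ _ _ h4 h)) hdx
    have hy : quartet X.1 y d x z := by
      rcases hno' y with h | h
      · exact absurd (sy _ _ h4) (h x hxy)
      · exact h.2 x z d hxy hyz.symm hxz h5 hd hdy
    exact hD.excl (hD.swap hx) (hD.swap hy)
  obtain ⟨d, -, hd⟩ := hF.proper p (Finset.mem_univ p) q (Finset.mem_univ q) hne
  by_cases he : ∃ e, e ≠ p ∧ e ≠ q ∧ e ≠ d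
  · obtain ⟨e, hep, heq, hed⟩ := he
    have hpe : ¬ F p e := fun h => key p q e hne hep.symm heq.symm hpq h
    have hde := h2 d e hd hpe
    refine Or.inr ⟨p, q, d, e, hne, hed.symm, hpq, hde, hd, fun x => ?_⟩
    by_cases hpx : F p x
    · by_contra h
      push Not at h
      exact key p q x hne (Ne.symm h.1) (Ne.symm h.2.1) hpq hpx
    · by_contra h
      push Not at h
      exact key d e x hed.symm (Ne.symm h.2.2.1) (Ne.symm h.2.2.2) hde (h2 d x hd hpx)
  · push Not at he
    refine Or.inl ⟨p, q, d, hne, hpq, hd, fun x => ?_⟩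
    by_cases h : x = p
    · exact Or.inl h
    · by_cases h' : x = q
      · exact Or.inr (Or.inl h')
      · exact Or.inr (Or.inr (he x h h'))

theorem isOneTwo_of_card {F : X.1 → X.1 → Prop} (hF : IsLocation (quartet X.1) Finset.univ F)
    (h : Fintype.card X.1 = 3) (hs : ¬ IsStar F) : IsOneTwo F := by
  simp only [IsStar] at hs
  push Not at hs
  obtain ⟨p, q, hpq, hne⟩ := hs
  obtain ⟨d, -, hd⟩ := hF.proper p (Finset.mem_univ p) q (Finset.mem_univ q) hne
  have hdp : p ≠ d := fun h => hd (h ▸ hF.refl p (Finset.mem_univ p))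
  have hdq : q ≠ d := fun h => hd (h ▸ hpq)
  have hcard : ({p, q, d} : Finset X.1).card = 3 := by
    rw [Finset.card_eq_three]
    exact ⟨p, q, d, hne, hdp, hdq, rfl⟩
  have huniv : ({p, q, d} : Finset X.1) = Finset.univ :=
    Finset.eq_univ_of_card _ (hcard.trans h.symm)
  refine ⟨p, q, d, hne, hpq, hd, fun x => ?_⟩
  have : x ∈ ({p, q, d} : Finset X.1) := huniv ▸ Finset.mem_univ x
  simpa using this

theorem IsOneTwo.card {F : X.1 → X.1 → Prop} (hF : IsLocation (quartet X.1) Finset.univ F)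
    (h : IsOneTwo F) : Fintype.card X.1 = 3 := by
  obtain ⟨p, q, d, hne, hpq, hd, hx⟩ := h
  have hdp : p ≠ d := fun h => hd (h ▸ hF.refl p (Finset.mem_univ p))
  have hdq : q ≠ d := fun h => hd (h ▸ hpq)
  have huniv : ({p, q, d} : Finset X.1) = Finset.univ :=
    Finset.eq_univ_of_forall fun x => by simpa using hx x
  rw [← Finset.card_univ, ← huniv, Finset.card_eq_three]
  exact ⟨p, q, d, hne, hdp, hdq, rfl⟩

/-- At the places where no leaf can be removed, the quartets are determined by the place. -/
theorem quartet_iff_of_small {F : X.1 → X.1 → Prop} (hF : IsLocation (quartet X.1) Finset.univ F)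
    (h : IsStar F ∨ IsOneTwo F ∨ IsTwoTwo F) (x y z w : X.1) :
    quartet X.1 x y z w ↔ x ≠ y ∧ z ≠ w ∧ F x y ∧ F z w ∧ ¬ F x z := by
  have r := fun x => hF.refl x (Finset.mem_univ x)
  have t := fun x y z => hF.trans x (Finset.mem_univ x) y (Finset.mem_univ y) z (Finset.mem_univ z)
  have sy := fun x y => hF.symm x (Finset.mem_univ x) y (Finset.mem_univ y)
  have hD := quartetSystem X
  have hsplit : ∀ x y z w, x ≠ y → z ≠ w → F x y → F z w → ¬ F x z → quartet X.1 x y z w := by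
    intro x y z w hxy hzw h1 h2 h3
    exact hF.split x (Finset.mem_univ x) y (Finset.mem_univ y) z (Finset.mem_univ z) w
      (Finset.mem_univ w) hxy hzw h1 h3 fun h => h3 (t _ _ _ h (sy _ _ h2))
  refine ⟨fun hq => ?_, fun ⟨h1, h2, h3, h4, h5⟩ => hsplit x y z w h1 h2 h3 h4 h5⟩
  obtain ⟨n1, n2, n3, n4, n5, n6⟩ := hD.ne hq
  refine ⟨n1, n6, ?_⟩
  rcases h with h | ⟨p, q, d, hne, hpq, hd, hx⟩ | ⟨p, q, d, e, hne, hde, hpq, hFde, hd, hx⟩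
  · exact absurd hq (hF.node x (Finset.mem_univ x) y (Finset.mem_univ y) z (Finset.mem_univ z) w
      (Finset.mem_univ w) (fun h' => n1 (h _ _ h')) (fun h' => n2 (h _ _ h'))
      (fun h' => n3 (h _ _ h')) (fun h' => n4 (h _ _ h')) (fun h' => n5 (h _ _ h'))
      (fun h' => n6 (h _ _ h')))
  · have h1 := hx x
    have h2 := hx y
    have h3 := hx z
    have h4 := hx w
    grind
  · have hpe : ¬ F p e := fun h => hd (t _ _ _ h (sy _ _ hFde))
    have hqd : ¬ F q d := fun h => hd (t _ _ _ hpq h)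
    have hqe : ¬ F q e := fun h => hpe (t _ _ _ hpq h)
    have hp : ∀ x, F p x → x = p ∨ x = q := by
      intro x h
      rcases hx x with h' | h' | h' | h'
      · exact Or.inl h'
      · exact Or.inr h'
      · exact absurd (h' ▸ h) hd
      · exact absurd (h' ▸ h) hpe
    have hnp : ∀ x, ¬ F p x → F d x ∧ (x = d ∨ x = e) := by
      intro x h
      rcases hx x with h' | h' | h' | h'
      · exact absurd (h' ▸ r p) h
      · exact absurd (h' ▸ hpq) h
      · exact ⟨h' ▸ r d, Or.inl h'⟩
      · exact ⟨h' ▸ hFde, Or.inr h'⟩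
    have pigeon : ∀ {a b x y z : X.1}, (x = a ∨ x = b) → (y = a ∨ y = b) → (z = a ∨ z = b) →
        x ≠ y → x ≠ z → y ≠ z → False := by
      clear hsplit t hF hD hx hp hnp
      grind
    have small : ∀ x y z, x ≠ y → x ≠ z → y ≠ z → F x y → ¬ F x z := by
      intro x y z h1 h2 h3 h4 h5
      by_cases h : F p x
      · exact pigeon (hp x h) (hp y (t _ _ _ h h4)) (hp z (t _ _ _ h h5)) h1 h2 h3
      · exact pigeon (hnp x h).2 (hnp y fun h' => h (t _ _ _ h' (sy _ _ h4))).2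
          (hnp z fun h' => h (t _ _ _ h' (sy _ _ h5))).2 h1 h2 h3
    have two : ∀ x y z, ¬ F x y → ¬ F x z → F y z := by
      intro x y z h1 h2
      by_cases h : F p x
      · exact t _ _ _ (sy _ _ (hnp y fun h' => h1 (t _ _ _ (sy _ _ h) h')).1)
          (hnp z fun h' => h2 (t _ _ _ (sy _ _ h) h')).1
      · have h3 : ∀ y, ¬ F x y → F p y := fun y h1 => by
          by_contra h'
          exact h1 (t _ _ _ (sy _ _ (hnp x h).1) (hnp y h').1)
        exact t _ _ _ (sy _ _ (h3 y h1)) (h3 z h2)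
    by_cases h1 : F x y
    · have h2 := small x y z n1 n2 n4 h1
      exact ⟨h1, two x z w h2 (small x y w n1 n3 n5 h1), h2⟩
    · by_cases h2 : F x z
      · exact absurd hq (hD.excl (hsplit x z y w n2 n5 h2
          (two x y w h1 (small x z w n2 n3 n6 h2)) h1))
      · have h3 := two x y z h1 h2
        have h4 : F x w := by
          by_contra h4
          exact small y z w n4 n5 n6 h3 (two x y w h1 h4)
        exact absurd (hD.swap' hq) (hD.excl (hsplit x w y z n3 n4 h4 h3 h1))

end Reduction

/-! ### Measures that agree at the minimal places -/

section Comparison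

variable {X X' : treeClass} {k : Type*} [CommRing k] {μ μ' : Emb treeClass → k}

/-- Two predicates on sets of equal size that hold equally often correspond under a bijection. -/
theorem exists_equiv_of_card {α β : Type*} [Fintype α] [Fintype β]
    (h : Fintype.card α = Fintype.card β) {P : α → Prop} {Q : β → Prop}
    (hPQ : Nat.card {x // P x} = Nat.card {x // Q x}) :
    ∃ g : α ≃ β, ∀ x, Q (g x) ↔ P x := by
  rw [Nat.card_eq_fintype_card, Nat.card_eq_fintype_card] at hPQ
  have h' : Fintype.card {x // ¬ P x} = Fintype.card {x // ¬ Q x} := by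
    rw [Fintype.card_subtype_compl, Fintype.card_subtype_compl, h, hPQ]
  let e := Fintype.equivOfCardEq hPQ
  let e' := Fintype.equivOfCardEq h'
  refine ⟨(Equiv.sumCompl P).symm.trans ((Equiv.sumCongr e e').trans (Equiv.sumCompl Q)),
    fun x => ?_⟩
  by_cases hx : P x
  · simp [hx, Equiv.sumCompl_symm_apply_of_pos, (e ⟨x, hx⟩).2]
  · simp [hx, Equiv.sumCompl_symm_apply_of_neg, (e' ⟨x, hx⟩).2]

/-- At an edge with branches of sizes one and two, or two and two, the place is given by a pair of
leaves and its complement. -/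
theorem iff_of_pair {F : X.1 → X.1 → Prop} (hF : IsLocation (quartet X.1) Finset.univ F)
    (h : IsOneTwo F ∨ IsTwoTwo F) :
    ∃ p q, p ≠ q ∧ ∀ x y, F x y ↔ ((x = p ∨ x = q) ↔ (y = p ∨ y = q)) := by
  have r := fun x => hF.refl x (Finset.mem_univ x)
  have t := fun x y z => hF.trans x (Finset.mem_univ x) y (Finset.mem_univ y) z (Finset.mem_univ z)
  have sy := fun x y => hF.symm x (Finset.mem_univ x) y (Finset.mem_univ y)
  have key : ∀ p q d, F p q → ¬ F p d → (∀ x, x = p ∨ x = q ∨ F d x) →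
      ∀ x y, F x y ↔ ((x = p ∨ x = q) ↔ (y = p ∨ y = q)) := by
    intro p q d hpq hd hx
    have h1 : ∀ x, (x = p ∨ x = q) ↔ F p x := by
      intro x
      constructor
      · rintro (rfl | rfl)
        · exact r _
        · exact hpq
      · intro h
        rcases hx x with h' | h' | h'
        · exact Or.inl h'
        · exact Or.inr h'
        · exact absurd (t _ _ _ h (sy _ _ h')) hd
    intro x y
    rw [h1, h1]
    constructor
    · exact fun h => ⟨fun h' => t _ _ _ h' h, fun h' => t _ _ _ h' (sy _ _ h)⟩
    · intro h
      by_cases hpx : F p x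
      · exact t _ _ _ (sy _ _ hpx) (h.1 hpx)
      · have h2 : ∀ x, ¬ F p x → F d x := fun x h => by
          rcases hx x with h' | h' | h'
          · exact absurd (h' ▸ r p) h
          · exact absurd (h' ▸ hpq) h
          · exact h'
        exact t _ _ _ (sy _ _ (h2 x hpx)) (h2 y fun h' => hpx (h.2 h'))
  rcases h with ⟨p, q, d, hne, hpq, hd, hx⟩ | ⟨p, q, d, e, hne, hde, hpq, hFde, hd, hx⟩
  · refine ⟨p, q, hne, key p q d hpq hd fun x => ?_⟩
    rcases hx x with h' | h' | h'
    · exact Or.inl h'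
    · exact Or.inr (Or.inl h')
    · exact Or.inr (Or.inr (h' ▸ r d))
  · refine ⟨p, q, hne, key p q d hpq hd fun x => ?_⟩
    rcases hx x with h' | h' | h' | h'
    · exact Or.inl h'
    · exact Or.inr (Or.inl h')
    · exact Or.inr (Or.inr (h' ▸ r d))
    · exact Or.inr (Or.inr (h' ▸ hFde))

theorem not_hasThree_of_pair {F : X.1 → X.1 → Prop}
    (hF : IsLocation (quartet X.1) Finset.univ F) (h : IsOneTwo F ∨ IsTwoTwo F) : ¬ HasThree F := by
  obtain ⟨p, q, -, h⟩ := iff_of_pair hF h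
  rintro ⟨x, y, z, h1, h2, h3⟩
  rw [h] at h1 h2 h3
  tauto

theorem IsTwoTwo.card {F : X.1 → X.1 → Prop} (hF : IsLocation (quartet X.1) Finset.univ F)
    (h : IsTwoTwo F) : Fintype.card X.1 = 4 := by
  have r := fun x => hF.refl x (Finset.mem_univ x)
  have t := fun x y z => hF.trans x (Finset.mem_univ x) y (Finset.mem_univ y) z (Finset.mem_univ z)
  have sy := fun x y => hF.symm x (Finset.mem_univ x) y (Finset.mem_univ y)
  obtain ⟨p, q, d, e, hne, hde, hpq, hFde, hd, hx⟩ := h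
  have h1 : p ≠ d := fun h => hd (h ▸ r p)
  have h2 : p ≠ e := fun h => hd (h ▸ sy _ _ hFde)
  have h3 : q ≠ d := fun h => hd (h ▸ hpq)
  have h4 : q ≠ e := fun h => hd (t _ _ _ hpq (h ▸ sy _ _ hFde))
  have huniv : ({p, q, d, e} : Finset X.1) = Finset.univ :=
    Finset.eq_univ_of_forall fun x => by simpa using hx x
  rw [← Finset.card_univ, ← huniv]
  rw [Finset.card_insert_of_notMem (by simp [hne, h1, h2]),
    Finset.card_insert_of_notMem (by simp [h3, h4]), Finset.card_pair hde]

theorem leafVal_eq_of_equiv (hμ : IsMultiplicative μ) {F : X.1 → X.1 → Prop}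
    {F' : X'.1 → X'.1 → Prop} (hF : IsLocation (quartet X.1) Finset.univ F)
    (hF' : IsLocation (quartet X'.1) Finset.univ F') (g : X.1 ≃ X'.1)
    (hg : ∀ x y, F x y ↔ F' (g x) (g y)) (hs : IsStar F ∨ IsOneTwo F ∨ IsTwoTwo F)
    (hs' : IsStar F' ∨ IsOneTwo F' ∨ IsTwoTwo F') : leafVal μ X F = leafVal μ X' F' := by
  let φ : X.1 ↪[quatLang] X'.1 := embOfQuartet g g.injective fun x y z w => by
    rw [quartet_iff_of_small hF' hs', quartet_iff_of_small hF hs, hg, hg, hg, g.injective.ne_iff,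
      g.injective.ne_iff]
  exact hμ.leafVal_congr hF hF' (equivOfSurjective φ g.surjective) hg

theorem leafVal_eq_of_star (hμ : IsMultiplicative μ) {F : X.1 → X.1 → Prop}
    {F' : X'.1 → X'.1 → Prop} (hF : IsLocation (quartet X.1) Finset.univ F)
    (hF' : IsLocation (quartet X'.1) Finset.univ F') (hs : IsStar F) (hs' : IsStar F')
    (hc : Fintype.card X.1 = Fintype.card X'.1) : leafVal μ X F = leafVal μ X' F' := by
  refine leafVal_eq_of_equiv hμ hF hF' (Fintype.equivOfCardEq hc) (fun x y => ?_) (Or.inl hs)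
    (Or.inl hs')
  constructor
  · intro h
    rw [hs _ _ h]
    exact hF'.refl _ (Finset.mem_univ _)
  · intro h
    rw [(Fintype.equivOfCardEq hc).injective (hs' _ _ h)]
    exact hF.refl _ (Finset.mem_univ _)

theorem leafVal_eq_of_pair (hμ : IsMultiplicative μ) {F : X.1 → X.1 → Prop}
    {F' : X'.1 → X'.1 → Prop} (hF : IsLocation (quartet X.1) Finset.univ F)
    (hF' : IsLocation (quartet X'.1) Finset.univ F') (hs : IsOneTwo F ∨ IsTwoTwo F)
    (hs' : IsOneTwo F' ∨ IsTwoTwo F') (hc : Fintype.card X.1 = Fintype.card X'.1) :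
    leafVal μ X F = leafVal μ X' F' := by
  obtain ⟨p, q, hpq, h⟩ := iff_of_pair hF hs
  obtain ⟨p', q', hpq', h'⟩ := iff_of_pair hF' hs'
  have hcard : ∀ {α : Type} [Fintype α] (p q : α), p ≠ q →
      Nat.card {x // x = p ∨ x = q} = 2 := by
    intro α _ p q hpq
    rw [Nat.card_eq_fintype_card, Fintype.card_subtype, ← Finset.card_pair hpq]
    congr 1
    ext x
    simp
  obtain ⟨g, hg⟩ := exists_equiv_of_card hc (P := fun x => x = p ∨ x = q)
    (Q := fun x => x = p' ∨ x = q') (by rw [hcard p q hpq, hcard p' q' hpq'])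
  refine leafVal_eq_of_equiv hμ hF hF' g (fun x y => ?_) (Or.inr hs) (Or.inr hs')
  rw [h, h', hg, hg]

/-- A place with at most two branches on four leaves has branches of size two, or the value there is
that at a place with branches of sizes one and two. -/
theorem isTwoTwo_or_exists (R : Type*) [CommRing R] {F : X.1 → X.1 → Prop}
    (hF : IsLocation (quartet X.1) Finset.univ F) (hc : Fintype.card X.1 = 4) (h : ¬ HasThree F) :
    IsTwoTwo F ∨ ∃ (X' : treeClass) (E : X'.1 → X'.1 → Prop),
      IsLocation (quartet X'.1) Finset.univ E ∧ IsOneTwo E ∧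
      ∀ μ : Emb treeClass → R, IsMeasure μ → leafVal μ X F = leafVal μ X' E := by
  rcases exists_removable_or R hF with ⟨X', f, b, E, hr⟩ | hs | ⟨-, h12 | h22⟩
  · have hc' : Fintype.card X'.1 = 3 := by
      have := hr.misses.card
      omega
    refine Or.inr ⟨X', E, hr.isLocation, isOneTwo_of_card hr.isLocation hc' fun hs => h ?_, hr.eq⟩
    obtain ⟨x, y, z, hxy, hxz, hyz⟩ := Fintype.two_lt_card_iff.1 (by omega : 2 < Fintype.card X'.1)
    refine ⟨f x, f y, f z, ?_, ?_, ?_⟩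
    · exact fun h => hxy (hs _ _ ((hr.iff _ _).2 h))
    · exact fun h => hxz (hs _ _ ((hr.iff _ _).2 h))
    · exact fun h => hyz (hs _ _ ((hr.iff _ _).2 h))
  · refine absurd ?_ h
    obtain ⟨x, y, z, hxy, hxz, hyz⟩ := Fintype.two_lt_card_iff.1 (by omega : 2 < Fintype.card X.1)
    exact ⟨x, y, z, fun h => hxy (hs _ _ h), fun h => hxz (hs _ _ h), fun h => hyz (hs _ _ h)⟩
  · have := h12.card hF
    omega
  · exact Or.inl h22

/-- Two measures that agree at the places with two branches of at most two leaves each, not both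
single, agree at a node with three single leaves. Indeed, condition (c) for attaching two leaves at the
edge `F` of a tree with three leaves has just one term with three branches, and removing one of the
two leaves of the cherry from it leaves the star. -/
theorem exists_star_agree (hμ : IsMeasure μ) (hμ' : IsMeasure μ') {F : X.1 → X.1 → Prop}
    (hF : IsLocation (quartet X.1) Finset.univ F) (hF12 : IsOneTwo F)
    (h : ∀ {X : treeClass} {F : X.1 → X.1 → Prop}, IsLocation (quartet X.1) Finset.univ F →
      IsOneTwo F ∨ IsTwoTwo F → leafVal μ X F = leafVal μ' X F) :
    ∃ (X' : treeClass) (E : X'.1 → X'.1 → Prop), IsLocation (quartet X'.1) Finset.univ E ∧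
      IsStar E ∧ Fintype.card X'.1 = 3 ∧ leafVal μ X' E = leafVal μ' X' E := by
  let f := addLeafEmb X hF
  let b := newLeaf X hF
  have hf : MissesOnly f b := missesOnly_addLeaf hF
  have hloc : F = loc f b := (loc_addLeaf hF).symm
  have hc := hF12.card hF
  have h3 := not_hasThree_of_pair hF (Or.inl hF12)
  have hnew : newLoc b (push f F) ∈ places f F := by
    have := isPlace_new hf
    rwa [← hloc, ← mem_places] at this
  -- the other places have at most two branches
  have hother : ∀ G ∈ (places f F).erase (newLoc b (push f F)),
      leafVal μ (addLeaf X hF) G = leafVal μ' (addLeaf X hF) G := by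
    intro G hG
    obtain ⟨hne, hG⟩ := Finset.mem_erase.1 hG
    have hp := mem_places.1 hG
    have hGl := (isPlace_iff.1 hp).1
    have hG3 : ¬ HasThree G := by
      rcases hp.cases hf with ⟨hG', -⟩ | ⟨hG', -⟩ | ⟨c, hc, -, -, hG'⟩
      · rintro ⟨x, y, z, h1, h2, h3⟩
        rw [hG', cherryLoc] at h1 h2 h3
        tauto
      · exact absurd hG' hne
      · rintro ⟨x, y, z, h1, h2, h3'⟩
        have hex : ∀ x, ∃ x', f x' = if x = b then c else x := fun x => by
          split_ifs with hx
          · exact mem_image.1 hc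
          · exact hf.exists_eq hx
        obtain ⟨x', hx⟩ := hex x
        obtain ⟨y', hy⟩ := hex y
        obtain ⟨z', hz⟩ := hex z
        rw [hG', joinLoc, ← hx, ← hy, push_apply] at h1
        rw [hG', joinLoc, ← hx, ← hz, push_apply] at h2
        rw [hG', joinLoc, ← hy, ← hz, push_apply] at h3'
        exact h3 ⟨x', y', z', h1, h2, h3'⟩
    have hc4 : Fintype.card (addLeaf X hF).1 = 4 := by
      rw [hf.card, hc]
    rcases isTwoTwo_or_exists k hGl hc4 hG3 with h22 | ⟨X', E, hE, hE12, heq⟩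
    · exact h hGl (Or.inr h22)
    · rw [heq μ hμ, heq μ' hμ', h hE (Or.inl hE12)]
  have hsum := hμ.leafVal_sum hf hF
  have hsum' := hμ'.leafVal_sum hf hF
  rw [← h hF (Or.inl hF12), hsum, ← Finset.add_sum_erase _ _ hnew, ← Finset.add_sum_erase _ _ hnew,
    Finset.sum_congr rfl hother] at hsum'
  have hagree := add_right_cancel (add_left_cancel hsum')
  have hG := (isPlace_iff.1 (mem_places.1 hnew)).1
  obtain ⟨p, q, d, hpq, hFpq, hFd, hx⟩ := hF12
  have hGpq : newLoc b (push f F) (f p) (f q) :=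
    Or.inr ⟨hf.ne p, hf.ne q, (push_apply p q).2 hFpq⟩
  have hpair : ∀ x y, x ≠ y → newLoc b (push f F) x y → x = f p ∨ x = f q := by
    rintro x y hxy (⟨h1, h2⟩ | ⟨h1, h2, x, y, rfl, rfl, hF'⟩)
    · exact absurd (h1.trans h2.symm) hxy
    · rcases hx x with h' | h' | h'
      · exact Or.inl (by rw [h'])
      · exact Or.inr (by rw [h'])
      · have hFdp : ¬ F d p := fun h => hFd (hF.symm _ (Finset.mem_univ _) _ (Finset.mem_univ _) h)
        have hFdq : ¬ F d q := fun h => hFdp (hF.trans _ (Finset.mem_univ _) _ (Finset.mem_univ _) _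
          (Finset.mem_univ _) h (hF.symm _ (Finset.mem_univ _) _ (Finset.mem_univ _) hFpq))
        rcases hx y with h2 | h2 | h2
        · exact absurd (h' ▸ h2 ▸ hF') hFdp
        · exact absurd (h' ▸ h2 ▸ hF') hFdq
        · exact absurd (by rw [h', h2]) hxy
  have hpair' : ∀ x y, x ≠ y → newLoc b (push f F) x y → y = f p ∨ y = f q := fun x y hxy h =>
    hpair y x hxy.symm (hG.symm _ (Finset.mem_univ _) _ (Finset.mem_univ _) h)
  -- only `p` and `q` are in a branch with another leaf, so one of them is the leaf removed
  rcases exists_removable_or k hG with ⟨X', f', b', E, hr⟩ | hs | ⟨h1, -⟩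
  · refine ⟨X', E, hr.isLocation, fun x y hE => ?_, ?_, ?_⟩
    · by_contra hxy
      have hfxy : f' x ≠ f' y := f'.injective.ne hxy
      have h1 := hpair _ _ hfxy ((hr.iff x y).1 hE)
      have h2 := hpair' _ _ hfxy ((hr.iff x y).1 hE)
      obtain ⟨c, hcb, hc⟩ := hr.exists_ne
      have h3 := hpair _ _ hcb.symm hc
      have h4 := hr.misses.ne x
      have h5 := hr.misses.ne y
      rcases h1 with h1 | h1 <;> rcases h2 with h2 | h2 <;> rcases h3 with h3 | h3 <;>
        simp_all
    · have h1 := hr.misses.card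
      have h2 := hf.card
      omega
    · rw [← hr.eq μ hμ, ← hr.eq μ' hμ', hagree]
  · exact absurd (f.injective (hs _ _ hGpq)) hpq
  · refine absurd ⟨b, f p, f d, ?_, ?_, ?_⟩ h1
    · rintro (⟨-, h⟩ | ⟨h, -⟩)
      · exact hf.ne p h
      · exact h rfl
    · rintro (⟨-, h⟩ | ⟨h, -⟩)
      · exact hf.ne d h
      · exact h rfl
    · rintro (⟨h, -⟩ | ⟨-, -, h⟩)
      · exact hf.ne p h
      · exact hFd ((push_apply p d).1 h)

/-- Two measures that agree at the places with two branches of at most two leaves each, not both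
single, agree at all places. The proof is by induction on the number of leaves. If no leaf can be
removed, the place is a star; condition (c) for attaching a leaf to a smaller star then has only one
term that is a star. This starts at four leaves, and for fewer than three leaves condition (c)
determines the values from those with one leaf more. -/
theorem leafVal_eq_of_agree (hμ : IsMeasure μ) (hμ' : IsMeasure μ')
    (hex : ∃ (X : treeClass) (F : X.1 → X.1 → Prop),
      IsLocation (quartet X.1) Finset.univ F ∧ IsOneTwo F)
    (h : ∀ {X : treeClass} {F : X.1 → X.1 → Prop}, IsLocation (quartet X.1) Finset.univ F →
      IsOneTwo F ∨ IsTwoTwo F → leafVal μ X F = leafVal μ' X F) {F : X.1 → X.1 → Prop}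
    (hF : IsLocation (quartet X.1) Finset.univ F) : leafVal μ X F = leafVal μ' X F := by
  obtain ⟨X₀, F₀, hF₀, hF₀'⟩ := hex
  obtain ⟨X₁, F₁, hF₁, hs₁, hc₁, heq⟩ := exists_star_agree hμ hμ' hF₀ hF₀' h
  have three : ∀ {X : treeClass} {F : X.1 → X.1 → Prop}, IsLocation (quartet X.1) Finset.univ F →
      Fintype.card X.1 = 3 → leafVal μ X F = leafVal μ' X F := by
    intro X F hF hc
    by_cases hs : IsStar F
    · rw [leafVal_eq_of_star hμ.toIsMultiplicative hF hF₁ hs hs₁ (hc.trans hc₁.symm),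
        leafVal_eq_of_star hμ'.toIsMultiplicative hF hF₁ hs hs₁ (hc.trans hc₁.symm), heq]
    · exact h hF (Or.inl (isOneTwo_of_card hF hc hs))
  have down : ∀ n, (∀ {X : treeClass} {F : X.1 → X.1 → Prop},
      IsLocation (quartet X.1) Finset.univ F → Fintype.card X.1 = n + 1 →
        leafVal μ X F = leafVal μ' X F) → ∀ {X : treeClass} {F : X.1 → X.1 → Prop},
      IsLocation (quartet X.1) Finset.univ F → Fintype.card X.1 = n →
        leafVal μ X F = leafVal μ' X F := by
    intro n ih X F hF hc
    have hf := missesOnly_addLeaf hF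
    rw [hμ.leafVal_sum hf hF, hμ'.leafVal_sum hf hF]
    congr 1
    refine Finset.sum_congr rfl fun G hG => ih (isPlace_iff.1 (mem_places.1 hG)).1 ?_
    rw [hf.card, hc]
  have two := fun {X : treeClass} {F : X.1 → X.1 → Prop} => @down 2 three X F
  have one := fun {X : treeClass} {F : X.1 → X.1 → Prop} => @down 1 two X F
  have zero := fun {X : treeClass} {F : X.1 → X.1 → Prop} => @down 0 one X F
  induction hn : Fintype.card X.1 using Nat.strong_induction_on generalizing X with
  | _ n ih =>
    have nonstar : ∀ {G : X.1 → X.1 → Prop}, IsLocation (quartet X.1) Finset.univ G →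
        ¬ IsStar G → leafVal μ X G = leafVal μ' X G := by
      intro G hG hs
      rcases exists_removable_or k hG with ⟨X', f', b', E, hr⟩ | hs' | ⟨-, h1⟩
      · rw [hr.eq μ hμ, hr.eq μ' hμ']
        have := hr.misses.card
        exact ih _ (by omega) hr.isLocation rfl
      · exact absurd hs' hs
      · exact h hG h1
    by_cases hs : IsStar F
    · by_cases h4 : 4 ≤ n
      · have : Nonempty X.1 := Fintype.card_pos_iff.1 (by omega)
        obtain ⟨b⟩ := this
        obtain ⟨X', f, hf⟩ := exists_missesOnly X b
        obtain ⟨E, hp⟩ : ∃ E, IsPlace f E F := ⟨_, hF, rfl⟩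
        have hE : leafVal μ X' E = leafVal μ' X' E := by
          have := hf.card
          exact ih _ (by omega) hp.isLocation rfl
        have hmem := mem_places.2 hp
        have hother : ∀ G ∈ (places f E).erase F, leafVal μ X G = leafVal μ' X G := by
          intro G hG
          obtain ⟨hne, hG⟩ := Finset.mem_erase.1 hG
          have hGl := (isPlace_iff.1 (mem_places.1 hG)).1
          refine nonstar hGl fun hs' => hne ?_
          funext x y
          refine propext ⟨fun h => ?_, fun h => ?_⟩
          · rw [hs' _ _ h]
            exact hF.refl _ (Finset.mem_univ _)
          · rw [hs _ _ h]
            exact hGl.refl _ (Finset.mem_univ _)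
        have hsum := hμ.leafVal_sum hf hp.isLocation
        have hsum' := hμ'.leafVal_sum hf hp.isLocation
        rw [← hE, hsum, ← Finset.add_sum_erase _ _ hmem, ← Finset.add_sum_erase _ _ hmem,
          Finset.sum_congr rfl hother] at hsum'
        exact add_right_cancel (add_left_cancel hsum')
      · have : n = 0 ∨ n = 1 ∨ n = 2 ∨ n = 3 := by omega
        rcases this with rfl | rfl | rfl | rfl
        · exact zero hF hn
        · exact one hF hn
        · exact two hF hn
        · exact three hF hn
    · exact nonstar hF hs

theorem IsMeasure.eq_of_leafVal (hμ : IsMeasure μ) (hμ' : IsMeasure μ')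
    (h : ∀ {X : treeClass} {F : X.1 → X.1 → Prop}, IsLocation (quartet X.1) Finset.univ F →
      leafVal μ X F = leafVal μ' X F) : μ = μ' := by
  funext ⟨X, Y, i⟩
  refine emb_induction (Q := fun {X Y} i => μ ⟨X, Y, i⟩ = μ' ⟨X, Y, i⟩) ?_ ?_ i
  · intro X Y i hi
    rw [hμ.surj i hi, hμ'.surj i hi]
  · intro X Y Z i a j ha hj ih
    have hja : MissesOnly j a := fun z => by
      rw [mem_image]
      constructor
      · rintro ⟨x, rfl⟩ h
        exact ha ⟨x, h⟩
      · exact hj z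
    rw [hμ.comp, hμ'.comp, ih, hμ.eq_leafVal hja, hμ'.eq_leafVal hja,
      h (isLocation_loc j hja.not_mem)]

end Comparison

/-! ### The marked trees `X_m`, `Y` and `Z` -/

section Marked

variable {V : Type}

theorem quartet_leafStructure [Finite V] {G : SimpleGraph V} (hG : IsTreeGraph G)
    (a b c d : {a | IsLeaf G a}) :
    quartet (leafStructure G) a b c d ↔ EdgeSplit G (a : V) b c d := by
  have hfin : Finite (leafStructure G) := inferInstanceAs (Finite {a | IsLeaf G a})
  exact (isTreeStructure_of_rel (X := leafStructure G)
    ((quartetSystem_edgeSplit hG).comap (fun x : {a | IsLeaf G a} => (x : V))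
      Subtype.val_injective) fun a b c d => pathsCross_iff hG _ _ _ _).2 a b c d

theorem not_sameSide_of_coloring {G : SimpleGraph V} {e : Sym2 V} (κ : V → Bool)
    (h : ∀ i j, G.Adj i j → s(i, j) ≠ e → κ i = κ j) {a b : V} (hab : κ a ≠ κ b) :
    ¬ SameSide G e a b := by
  intro hr
  have h1 := reachable_map_of_adj (H := (⊥ : SimpleGraph Bool)) κ (fun i j hij => by
    rw [SimpleGraph.deleteEdges_adj] at hij
    rw [h i j hij.1 hij.2]) hr
  rw [SimpleGraph.reachable_bot] at h1
  exact hab h1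

theorem edgeSplit_treeY :
    EdgeSplit (parentGraph (n := 5) ![0, 0, 0, 0, 1, 1]) 5 4 2 3 := by
  refine ⟨by decide, s(0, 1), ?_, ?_, ?_⟩
  · exact (sameSide_of_adj (y := 1) (by decide) (by decide)).trans
      (sameSide_of_adj (by decide) (by decide))
  · exact (sameSide_of_adj (y := 0) (by decide) (by decide)).trans
      (sameSide_of_adj (by decide) (by decide))
  · exact not_sameSide_of_coloring ![true, false, true, true, false, false] (by decide) (by decide)

theorem edgeSplit_treeZ :
    EdgeSplit (parentGraph (n := 7) ![0, 0, 0, 0, 1, 1, 2, 2]) 3 4 6 7 ∧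
      EdgeSplit (parentGraph (n := 7) ![0, 0, 0, 0, 1, 1, 2, 2]) 3 6 4 5 := by
  refine ⟨⟨by decide, s(0, 2), ?_, ?_, ?_⟩, ⟨by decide, s(0, 1), ?_, ?_, ?_⟩⟩
  · exact (sameSide_of_adj (y := 0) (by decide) (by decide)).trans
      ((sameSide_of_adj (y := 1) (by decide) (by decide)).trans
      (sameSide_of_adj (by decide) (by decide)))
  · exact (sameSide_of_adj (y := 2) (by decide) (by decide)).trans
      (sameSide_of_adj (by decide) (by decide))
  · exact not_sameSide_of_coloring ![true, true, false, true, true, true, false, false]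
      (by decide) (by decide)
  · exact (sameSide_of_adj (y := 0) (by decide) (by decide)).trans
      ((sameSide_of_adj (y := 2) (by decide) (by decide)).trans
      (sameSide_of_adj (by decide) (by decide)))
  · exact (sameSide_of_adj (y := 1) (by decide) (by decide)).trans
      (sameSide_of_adj (by decide) (by decide))
  · exact not_sameSide_of_coloring ![true, false, true, true, false, false, true, true]
      (by decide) (by decide)

theorem MissesOnly.loc_iff {X Y : treeClass} {i : X.1 ↪[quatLang] Y.1} {a : Y.1}
    (hi : MissesOnly i a) (x y : X.1) :
    loc i a x y ↔ x = y ∨ ∃ d, d ≠ a ∧ quartet Y.1 a d (i x) (i y) :=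
  or_congr i.injective.eq_iff (exists_congr fun d => and_congr (hi d) Iff.rfl)

theorem isOneTwo_of_quartet {X Y : treeClass} {i : X.1 ↪[quatLang] Y.1} {a b c d : Y.1}
    (hi : MissesOnly i a) (h : quartet Y.1 a b c d) (hx : ∀ x, x = a ∨ x = b ∨ x = c ∨ x = d) :
    IsOneTwo (loc i a) := by
  have hD := quartetSystem Y
  obtain ⟨hab, hac, had, hbc, hbd, hcd⟩ := hD.ne h
  obtain ⟨b, rfl⟩ := hi.exists_eq hab.symm
  obtain ⟨c, rfl⟩ := hi.exists_eq hac.symm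
  obtain ⟨d, rfl⟩ := hi.exists_eq had.symm
  refine ⟨c, d, b, fun h => hcd (by rw [h]), (hi.loc_iff c d).2 (Or.inr ⟨i b, hi.ne b, h⟩),
    fun h' => ?_, fun x => ?_⟩
  · rcases (hi.loc_iff c b).1 h' with h' | ⟨e, he, h'⟩
    · exact hbc (by rw [h'])
    · obtain ⟨-, -, -, h2, h4, -⟩ := hD.ne h'
      rcases hx e with h3 | h3 | h3 | h3
      · exact he h3
      · exact h4 h3
      · exact h2 h3
      · rw [h3] at h'
        exact hD.excl (hD.swap' h') (hD.swap' h)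
  · rcases hx (i x) with h' | h' | h' | h'
    · exact absurd h' (hi.ne x)
    · exact Or.inr (Or.inr (i.injective h'))
    · exact Or.inl (i.injective h')
    · exact Or.inr (Or.inl (i.injective h'))

theorem isTwoTwo_of_quartet {X Y : treeClass} {i : X.1 ↪[quatLang] Y.1} {a b b' c c' : Y.1}
    (hi : MissesOnly i a) (h : quartet Y.1 a b c c') (h' : quartet Y.1 a c b b')
    (hx : ∀ x, x = a ∨ x = b ∨ x = b' ∨ x = c ∨ x = c') : IsTwoTwo (loc i a) := by
  have hD := quartetSystem Y
  obtain ⟨hab, hac, hac', hbc, hbc', hcc'⟩ := hD.ne h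
  obtain ⟨-, -, hab', -, -, hbb'⟩ := hD.ne h'
  obtain ⟨b, rfl⟩ := hi.exists_eq hab.symm
  obtain ⟨c, rfl⟩ := hi.exists_eq hac.symm
  obtain ⟨b', rfl⟩ := hi.exists_eq hab'.symm
  obtain ⟨c', rfl⟩ := hi.exists_eq hac'.symm
  refine ⟨b, b', c, c', fun h => hbb' (by rw [h]), fun h => hcc' (by rw [h]),
    (hi.loc_iff b b').2 (Or.inr ⟨i c, hi.ne c, h'⟩),
    (hi.loc_iff c c').2 (Or.inr ⟨i b, hi.ne b, h⟩), fun h1 => ?_, fun x => ?_⟩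
  · rcases (hi.loc_iff b c).1 h1 with h1 | ⟨e, he, h1⟩
    · exact hbc (by rw [h1])
    · obtain ⟨-, -, -, h2, h4, -⟩ := hD.ne h1
      rcases hx e with h3 | h3 | h3 | h3 | h3
      · exact he h3
      · exact h2 h3
      · rw [h3] at h1
        exact hD.excl (hD.swap' h1) (hD.swap' h')
      · exact h4 h3
      · rw [h3] at h1
        exact hD.excl h1 (hD.swap' h)
  · rcases hx (i x) with h1 | h1 | h1 | h1 | h1
    · exact absurd h1 (hi.ne x)
    · exact Or.inl (i.injective h1)
    · exact Or.inr (Or.inl (i.injective h1))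
    · exact Or.inr (Or.inr (Or.inl (i.injective h1)))
    · exact Or.inr (Or.inr (Or.inr (i.injective h1)))

theorem isOneTwo_treeY : ∃ a : treeY.tgt.1, MissesOnly treeY.hom a ∧ IsOneTwo (loc treeY.hom a) := by
  let G := parentGraph (n := 5) ![0, 0, 0, 0, 1, 1]
  have hG : IsTreeGraph G := parentGraph_isTree _ (by decide) rfl
  have hl : ∀ a : Fin 6, IsLeaf G a ↔ a = 5 ∨ a = 4 ∨ a = 2 ∨ a = 3 := by
    simp only [IsLeaf, Set.Subsingleton, SimpleGraph.mem_neighborSet]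
    decide
  have hm := missesOnly_markedEmb (treeObj G hG) ⟨5, (hl 5).2 (by decide)⟩
  refine ⟨_, hm, isOneTwo_of_quartet hm (b := ⟨4, (hl 4).2 (by decide)⟩)
    (c := ⟨2, (hl 2).2 (by decide)⟩) (d := ⟨3, (hl 3).2 (by decide)⟩)
    ((quartet_leafStructure hG _ _ _ _).2 edgeSplit_treeY) fun x => ?_⟩
  rcases (hl x.1).1 x.2 with h | h | h | h
  · exact Or.inl (Subtype.ext h)
  · exact Or.inr (Or.inl (Subtype.ext h))
  · exact Or.inr (Or.inr (Or.inl (Subtype.ext h)))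
  · exact Or.inr (Or.inr (Or.inr (Subtype.ext h)))

theorem isTwoTwo_treeZ : ∃ a : treeZ.tgt.1, MissesOnly treeZ.hom a ∧ IsTwoTwo (loc treeZ.hom a) := by
  let G := parentGraph (n := 7) ![0, 0, 0, 0, 1, 1, 2, 2]
  have hG : IsTreeGraph G := parentGraph_isTree _ (by decide) rfl
  have hl : ∀ a : Fin 8, IsLeaf G a ↔ a = 3 ∨ a = 4 ∨ a = 5 ∨ a = 6 ∨ a = 7 := by
    simp only [IsLeaf, Set.Subsingleton, SimpleGraph.mem_neighborSet]
    decide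
  have hm := missesOnly_markedEmb (treeObj G hG) ⟨3, (hl 3).2 (by decide)⟩
  refine ⟨_, hm, isTwoTwo_of_quartet hm (b := ⟨4, (hl 4).2 (by decide)⟩)
    (b' := ⟨5, (hl 5).2 (by decide)⟩) (c := ⟨6, (hl 6).2 (by decide)⟩)
    (c' := ⟨7, (hl 7).2 (by decide)⟩)
    ((quartet_leafStructure hG _ _ _ _).2 edgeSplit_treeZ.1)
    ((quartet_leafStructure hG _ _ _ _).2 edgeSplit_treeZ.2) fun x => ?_⟩
  rcases (hl x.1).1 x.2 with h | h | h | h | h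
  · exact Or.inl (Subtype.ext h)
  · exact Or.inr (Or.inl (Subtype.ext h))
  · exact Or.inr (Or.inr (Or.inl (Subtype.ext h)))
  · exact Or.inr (Or.inr (Or.inr (Or.inl (Subtype.ext h))))
  · exact Or.inr (Or.inr (Or.inr (Or.inr (Subtype.ext h))))

theorem isStar_markedStar (n : ℕ) : ∃ a : (markedStar n).tgt.1,
    MissesOnly (markedStar n).hom a ∧ IsStar (loc (markedStar n).hom a) := by
  have hG : IsTreeGraph (SimpleGraph.starGraph (0 : Fin (n + 1))) :=
    ⟨(SimpleGraph.connected_starGraph _).preconnected, SimpleGraph.isAcyclic_starGraph _⟩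
  have hm := missesOnly_markedEmb (treeObj (SimpleGraph.starGraph (0 : Fin (n + 1))) hG)
    ⟨Fin.last n, starGraph_isLeaf_last n⟩
  refine ⟨_, hm, fun x y h => ?_⟩
  rcases (hm.loc_iff x y).1 h with h | ⟨d, hd, h⟩
  · exact h
  · exact absurd ((quartet_leafStructure hG _ _ _ _).1 h) (not_edgeSplit_star _ _ _ _ _)

theorem card_markedStar (n : ℕ) : Fintype.card (markedStar n).src.1 = if n ≤ 1 then n else n - 1 := by
  obtain ⟨a, ha, -⟩ := isStar_markedStar n
  have h1 := ha.card
  have h2 : Fintype.card (markedStar n).tgt.1 =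
      Nat.card {a | IsLeaf (SimpleGraph.starGraph (0 : Fin (n + 1))) a} := by
    rw [← Nat.card_eq_fintype_card]
    rfl
  have h3 : Nat.card {a | IsLeaf (SimpleGraph.starGraph (0 : Fin (n + 1))) a} =
      if n ≤ 1 then n + 1 else n := by
    split_ifs with hn
    · have : {a | IsLeaf (SimpleGraph.starGraph (0 : Fin (n + 1))) a} = Set.univ := by
        refine Set.eq_univ_of_forall fun a x hx y hy => ?_
        simp only [SimpleGraph.mem_neighborSet, SimpleGraph.starGraph_adj] at hx hy
        ext
        have := x.2
        have := y.2
        have := a.2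
        simp only [ne_eq, Fin.ext_iff] at hx hy
        omega
      rw [this]
      simp
    · have : {a | IsLeaf (SimpleGraph.starGraph (0 : Fin (n + 1))) a} = {0}ᶜ := by
        ext a
        simp only [Set.mem_ofPred_eq, Set.mem_compl_iff, Set.mem_singleton_iff]
        constructor
        · rintro h rfl
          have h1 : (⟨1, by omega⟩ : Fin (n + 1)) = ⟨2, by omega⟩ := h
            (by simp [SimpleGraph.starGraph_adj, Fin.ext_iff])
            (by simp [SimpleGraph.starGraph_adj, Fin.ext_iff])
          simp at h1
        · intro ha x hx y hy
          simp only [SimpleGraph.mem_neighborSet, SimpleGraph.starGraph_adj] at hx hy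
          grind
      rw [this, Nat.card_coe_set_eq, Set.ncard_compl, Set.ncard_singleton]
      simp
  rw [h2, h3] at h1
  split_ifs at h1 ⊢ <;> omega

theorem isStar_treeX (m : ℕ) (hm : 1 ≤ m) : ∃ a : (treeX m).tgt.1, MissesOnly (treeX m).hom a ∧
    IsStar (loc (treeX m).hom a) ∧ Fintype.card (treeX m).src.1 = m - 1 := by
  obtain ⟨a, ha, hs⟩ := isStar_markedStar (if m ≤ 2 then m - 1 else m)
  refine ⟨a, ha, hs, ?_⟩
  rw [treeX, card_markedStar]
  split_ifs <;> omega

end Marked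

section Weights

variable {X : treeClass} {k : Type*} [CommRing k] {u v : k} {F : X.1 → X.1 → Prop}

theorem parts_of_isStar (hF : IsLocation (quartet X.1) Finset.univ F) (hs : IsStar F) :
    parts Finset.univ F = Finset.univ.image fun x => {x} := by
  refine Finset.image_congr fun x _ => ?_
  ext y
  simp only [Finset.mem_filter, Finset.mem_univ, true_and, Finset.mem_singleton]
  exact ⟨fun h => (hs _ _ h).symm, fun h => h ▸ hF.refl x (Finset.mem_univ x)⟩

theorem card_parts_of_isStar (hF : IsLocation (quartet X.1) Finset.univ F) (hs : IsStar F) :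
    (parts Finset.univ F).card = Fintype.card X.1 := by
  rw [parts_of_isStar hF hs, Finset.card_image_of_injective _ Finset.singleton_injective,
    Finset.card_univ]

theorem locWeight_of_isStar (hF : IsLocation (quartet X.1) Finset.univ F) (hs : IsStar F)
    (h : 3 ≤ Fintype.card X.1) :
    locWeight u v Finset.univ F = v + 1 - ((Fintype.card X.1 : k) - 1) * (u + 1) := by
  have hc := card_parts_of_isStar hF hs
  rw [locWeight, partsWeight_of_three_le _ _ (by omega), hc]

theorem locWeight_of_isStar_two (hF : IsLocation (quartet X.1) Finset.univ F) (hs : IsStar F)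
    (h : Fintype.card X.1 = 2) : locWeight u v Finset.univ F = u + v := by
  have hc := card_parts_of_isStar hF hs
  have hp : ((parts Finset.univ F).filter fun B => B.card = 1) = parts Finset.univ F := by
    refine Finset.filter_true_of_mem fun B hB => ?_
    rw [parts_of_isStar hF hs] at hB
    obtain ⟨x, -, rfl⟩ := Finset.mem_image.1 hB
    exact Finset.card_singleton x
  rw [locWeight, partsWeight, hp, hc, h]
  push_cast
  ring

theorem locWeight_of_isStar_one (hF : IsLocation (quartet X.1) Finset.univ F) (hs : IsStar F)
    (h : Fintype.card X.1 = 1) : locWeight u v Finset.univ F = u + v + 1 := by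
  rw [locWeight, partsWeight, card_parts_of_isStar hF hs, h]

theorem locWeight_of_isStar_zero (hF : IsLocation (quartet X.1) Finset.univ F) (hs : IsStar F)
    (h : Fintype.card X.1 = 0) : locWeight u v Finset.univ F = u + v + 2 := by
  rw [locWeight, partsWeight, card_parts_of_isStar hF hs, h]

theorem locWeight_of_isOneTwo (hF : IsLocation (quartet X.1) Finset.univ F) (h : IsOneTwo F) :
    locWeight u v Finset.univ F = u := by
  obtain ⟨p, q, d, hpq, hFpq, hd, hx⟩ := h
  have h1 : ∀ x, F p x ↔ x = p ∨ x = q := fun x => by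
    constructor
    · intro h
      rcases hx x with h' | h' | h'
      · exact Or.inl h'
      · exact Or.inr h'
      · exact absurd (h' ▸ h) hd
    · rintro (rfl | rfl)
      · exact hF.refl _ (Finset.mem_univ _)
      · exact hFpq
  have h2 : ∀ x, F d x ↔ x = d := fun x => by
    constructor
    · intro h
      by_contra hxd
      have h3 : F p x := (h1 x).2 ((or_assoc.2 (hx x)).resolve_right hxd)
      exact hd (hF.trans _ (Finset.mem_univ _) _ (Finset.mem_univ _) _ (Finset.mem_univ _) h3
        (hF.symm _ (Finset.mem_univ _) _ (Finset.mem_univ _) h))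
    · rintro rfl
      exact hF.refl _ (Finset.mem_univ _)
  rw [locWeight_pair u v hF (Finset.mem_univ p) (Finset.mem_univ d) hd fun x _ => by
    rw [h1, h2]
    have := hx x
    tauto]
  have h3 : (Finset.univ.filter (F p)).card = 2 := by
    rw [← Finset.card_pair hpq]
    congr 1
    ext x
    simp [h1]
  have h4 : (Finset.univ.filter (F d)).card = 1 := by
    rw [← Finset.card_singleton d]
    congr 1
    ext x
    simp [h2]
  simp [single, h3, h4]

theorem locWeight_of_isTwoTwo (hF : IsLocation (quartet X.1) Finset.univ F) (h : IsTwoTwo F) :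
    locWeight u v Finset.univ F = u - v := by
  obtain ⟨p, q, d, e, hpq, hde, hFpq, hFde, hd, hx⟩ := h
  have hcover : ∀ x ∈ (Finset.univ : Finset X.1), F p x ∨ F d x := fun x _ => by
    rcases hx x with rfl | rfl | rfl | rfl
    · exact Or.inl (hF.refl _ (Finset.mem_univ _))
    · exact Or.inl hFpq
    · exact Or.inr (hF.refl _ (Finset.mem_univ _))
    · exact Or.inr hFde
  have h1 : ∀ p q, p ≠ q → F p q → (Finset.univ.filter (F p)).card ≠ 1 := by
    intro p q hpq hF' h
    obtain ⟨x, hx⟩ := Finset.card_eq_one.1 h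
    have h2 : p ∈ Finset.univ.filter (F p) :=
      Finset.mem_filter.2 ⟨Finset.mem_univ _, hF.refl _ (Finset.mem_univ _)⟩
    have h3 : q ∈ Finset.univ.filter (F p) := Finset.mem_filter.2 ⟨Finset.mem_univ _, hF'⟩
    rw [hx, Finset.mem_singleton] at h2 h3
    exact hpq (h2.trans h3.symm)
  rw [locWeight_pair u v hF (Finset.mem_univ p) (Finset.mem_univ d) hd hcover, single, single,
    if_neg (h1 p q hpq hFpq), if_neg (h1 d e hde hFde)]
  ring

end Weights

/-! ### The relation between the values at `Y` and `Z`, and the universal measure -/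

section Universal

variable {k : Type*} [CommRing k] {u v : k} {μ μ' : Emb treeClass → k} {X X' Y : treeClass}

theorem IsMultiplicative.eq_treeY (hμ : IsMultiplicative μ) {F : X.1 → X.1 → Prop}
    (hF : IsLocation (quartet X.1) Finset.univ F) (h : IsOneTwo F) : leafVal μ X F = μ treeY := by
  obtain ⟨a, ha, h12⟩ := isOneTwo_treeY
  have hl := isLocation_loc _ ha.not_mem
  rw [show μ treeY = leafVal μ treeY.src (loc treeY.hom a) from hμ.eq_leafVal ha]
  exact leafVal_eq_of_pair hμ hF hl (Or.inl h) (Or.inl h12) ((h.card hF).trans (h12.card hl).symm)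

theorem IsMultiplicative.eq_treeZ (hμ : IsMultiplicative μ) {F : X.1 → X.1 → Prop}
    (hF : IsLocation (quartet X.1) Finset.univ F) (h : IsTwoTwo F) : leafVal μ X F = μ treeZ := by
  obtain ⟨a, ha, h22⟩ := isTwoTwo_treeZ
  have hl := isLocation_loc _ ha.not_mem
  rw [show μ treeZ = leafVal μ treeZ.src (loc treeZ.hom a) from hμ.eq_leafVal ha]
  exact leafVal_eq_of_pair hμ hF hl (Or.inr h) (Or.inr h22) ((h.card hF).trans (h22.card hl).symm)

/-- A measure is determined by its values at `Y` and `Z`. -/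
theorem IsMeasure.ext (hμ : IsMeasure μ) (hμ' : IsMeasure μ') (hY : μ treeY = μ' treeY)
    (hZ : μ treeZ = μ' treeZ) : μ = μ' := by
  refine hμ.eq_of_leafVal hμ' fun hF => leafVal_eq_of_agree hμ hμ' ?_ ?_ hF
  · obtain ⟨a, ha, h12⟩ := isOneTwo_treeY
    exact ⟨_, _, isLocation_loc _ ha.not_mem, h12⟩
  · rintro X F hF (h | h)
    · rw [hμ.eq_treeY hF h, hμ'.eq_treeY hF h, hY]
    · rw [hμ.eq_treeZ hF h, hμ'.eq_treeZ hF h, hZ]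

theorem embWeight_treeY : embWeight u v treeY = u := by
  obtain ⟨a, ha, h⟩ := isOneTwo_treeY
  exact (embWeight_eq_locWeight ha).trans (locWeight_of_isOneTwo (isLocation_loc _ ha.not_mem) h)

theorem embWeight_treeZ : embWeight u v treeZ = u - v := by
  obtain ⟨a, ha, h⟩ := isTwoTwo_treeZ
  exact (embWeight_eq_locWeight ha).trans (locWeight_of_isTwoTwo (isLocation_loc _ ha.not_mem) h)

theorem embWeight_treeX_one : embWeight u v (treeX 1) = u + v + 2 := by
  obtain ⟨a, ha, h, hc⟩ := isStar_treeX 1 le_rfl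
  exact (embWeight_eq_locWeight ha).trans
    (locWeight_of_isStar_zero (isLocation_loc _ ha.not_mem) h hc)

theorem embWeight_treeX_two : embWeight u v (treeX 2) = u + v + 1 := by
  obtain ⟨a, ha, h, hc⟩ := isStar_treeX 2 (by omega)
  exact (embWeight_eq_locWeight ha).trans
    (locWeight_of_isStar_one (isLocation_loc _ ha.not_mem) h hc)

theorem embWeight_treeX_three : embWeight u v (treeX 3) = u + v := by
  obtain ⟨a, ha, h, hc⟩ := isStar_treeX 3 (by omega)
  exact (embWeight_eq_locWeight ha).trans
    (locWeight_of_isStar_two (isLocation_loc _ ha.not_mem) h hc)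

theorem embWeight_treeX {m : ℕ} (hm : 4 ≤ m) :
    embWeight u v (treeX m) = v + 1 - ((m : k) - 2) * (u + 1) := by
  obtain ⟨a, ha, h, hc⟩ := isStar_treeX m (by omega)
  refine (embWeight_eq_locWeight ha).trans ?_
  rw [locWeight_of_isStar (isLocation_loc _ ha.not_mem) h (by omega), hc, Nat.cast_sub (by omega)]
  ring

theorem exists_lift {f : X'.1 ↪[quatLang] Y.1} {b : Y.1} (hf : MissesOnly f b)
    (g : X.1 ↪[quatLang] Y.1) (h : ∀ x, g x ≠ b) : ∃ g' : X.1 ↪[quatLang] X'.1, f.comp g' = g := by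
  choose φ hφ using fun x => hf.exists_eq (h x)
  refine ⟨embOfQuartet φ (fun x y hxy => g.injective (by rw [← hφ, ← hφ, hxy]))
    fun x y z w => ?_, emb_ext hφ⟩
  rw [← quartet_map f, hφ, hφ, hφ, hφ, quartet_map]

/-- Removing from `Z` the marked leaf and another one in the two possible orders gives a relation
between the values of a measure: after the marked leaf, removing `q` is the extension `Y`; if `q` is
removed first, both steps have the value of `Y`. -/
theorem IsMeasure.mul_eq_mul (hμ : IsMeasure μ) {g : X.1 ↪[quatLang] Y.1} {a : Y.1}
    (hg : MissesOnly g a) (h22 : IsTwoTwo (loc g a)) :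
    μ treeZ * μ treeY = μ treeY * μ treeY := by
  have hl := isLocation_loc g hg.not_mem
  have hDX := quartetSystem X
  have hDY := quartetSystem Y
  have hcard := h22.card hl
  have hqX := quartet_iff_of_small hl (Or.inr (Or.inr h22))
  obtain ⟨p, q, d, e, hpq, hde, hFpq, hFde, hFpd, hx⟩ := id h22
  have hX : quartet X.1 p q d e := (hqX p q d e).2 ⟨hpq, hde, hFpq, hFde, hFpd⟩
  have hFdp : ¬ loc g a d p := fun h => hFpd (hl.symm _ (Finset.mem_univ _) _ (Finset.mem_univ _) h)
  -- the quartets of `Y` that contain the marked leaf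
  have hY1 : quartet Y.1 a (g p) (g d) (g e) :=
    hDY.branch_apart hg.not_mem (apply_mem_image g p) (g.injective.ne hde) hFde hFdp
  have hY2 : quartet Y.1 a (g d) (g p) (g q) :=
    hDY.branch_apart hg.not_mem (apply_mem_image g d) (g.injective.ne hpq) hFpq hFpd
  obtain ⟨-, hpd, hpe, hqd, hqe, -⟩ := hDX.ne hX
  obtain ⟨X₃, f, hf⟩ := exists_missesOnly X q
  obtain ⟨X', g', hg'⟩ := exists_missesOnly Y (g q)
  have haq : a ≠ g q := (hg.ne q).symm
  obtain ⟨f', hf'⟩ := exists_lift hg' (g.comp f) fun x h => hf.ne x (g.injective h)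
  have hf'x : ∀ x, g' (f' x) = g (f x) := DFunLike.congr_fun hf'
  obtain ⟨a', ha'⟩ := hg'.exists_eq haq
  have hfa' : MissesOnly f' a' := by
    intro y
    rw [mem_image]
    constructor
    · rintro ⟨x, rfl⟩ h
      exact hg.ne (f x) (by rw [← hf'x, h, ha'])
    · intro hy
      obtain ⟨x, hx⟩ := hg.exists_eq (y := g' y) fun h => hy (g'.injective (h.trans ha'.symm))
      have hxq : x ≠ q := fun h => hg'.ne y (by rw [← hx, h])
      obtain ⟨x, rfl⟩ := hf.exists_eq hxq
      exact ⟨x, g'.injective ((hf'x x).trans hx)⟩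
  obtain ⟨p₃, hp₃⟩ := hf.exists_eq hpq
  obtain ⟨d₃, hd₃⟩ := hf.exists_eq hqd.symm
  obtain ⟨e₃, he₃⟩ := hf.exists_eq hqe.symm
  have hx₃ : ∀ x, x = d₃ ∨ x = e₃ ∨ x = p₃ := by
    intro x
    rcases hx (f x) with h | h | h | h
    · exact Or.inr (Or.inr (f.injective (h.trans hp₃.symm)))
    · exact absurd h (hf.ne x)
    · exact Or.inl (f.injective (h.trans hd₃.symm))
    · exact Or.inr (Or.inl (f.injective (h.trans he₃.symm)))
  have hde₃ : d₃ ≠ e₃ := fun h => hde (by rw [← hd₃, ← he₃, h])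
  have vg : μ ⟨X, Y, g⟩ = μ treeZ := by rw [hμ.eq_leafVal hg, hμ.eq_treeZ hl h22]
  have vf : μ ⟨X₃, X, f⟩ = μ treeY := by
    rw [hμ.eq_leafVal hf]
    refine hμ.eq_treeY (isLocation_loc f hf.not_mem) (isOneTwo_of_quartet hf (hDX.swap hX) ?_)
    intro x
    have := hx x
    tauto
  have vf' : μ ⟨X₃, X', f'⟩ = μ treeY := by
    rw [hμ.eq_leafVal hfa']
    refine hμ.eq_treeY (isLocation_loc f' hfa'.not_mem) ?_
    refine isOneTwo_of_quartet hfa' (b := f' p₃) (c := f' d₃) (d := f' e₃) ?_ fun x => ?_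
    · rw [← quartet_map g', ha', hf'x, hf'x, hf'x, hp₃, hd₃, he₃]
      exact hY1
    · by_cases hxa : x = a'
      · exact Or.inl hxa
      · obtain ⟨x, rfl⟩ := hfa'.exists_eq hxa
        rcases hx₃ x with rfl | rfl | rfl
        · exact Or.inr (Or.inr (Or.inl rfl))
        · exact Or.inr (Or.inr (Or.inr rfl))
        · exact Or.inr (Or.inl rfl)
  have vg' : μ ⟨X', Y, g'⟩ = μ treeY := by
    rw [hμ.eq_leafVal hg']
    have hl' := isLocation_loc g' hg'.not_mem
    have t := fun x y z => hl'.trans x (Finset.mem_univ x) y (Finset.mem_univ y) z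
      (Finset.mem_univ z)
    have sy := fun x y => hl'.symm x (Finset.mem_univ x) y (Finset.mem_univ y)
    have h1 : loc g' (g q) (f' d₃) (f' e₃) := by
      refine (hg'.loc_iff _ _).2 (Or.inr ⟨g p, g.injective.ne hpq, ?_⟩)
      rw [hf'x, hf'x, hd₃, he₃, quartet_map]
      exact hDX.swap hX
    have h2 : loc g' (g q) (f' d₃) a' := by
      refine (hg'.loc_iff _ _).2 (Or.inr ⟨g p, g.injective.ne hpq, ?_⟩)
      rw [hf'x, hd₃, ha']
      exact hDY.symm (hDY.swap (hDY.swap' hY2))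
    have hx' : ∀ x, x = f' p₃ ∨ loc g' (g q) (f' d₃) x := by
      intro x
      by_cases hxa : x = a'
      · exact Or.inr (hxa ▸ h2)
      · obtain ⟨x, rfl⟩ := hfa'.exists_eq hxa
        rcases hx₃ x with rfl | rfl | rfl
        · exact Or.inr (hl'.refl _ (Finset.mem_univ _))
        · exact Or.inr h1
        · exact Or.inl rfl
    have h3 : ¬ HasThree (loc g' (g q)) := by
      rintro ⟨x, y, z, hxy, hxz, hyz⟩
      have r := hl'.refl _ (Finset.mem_univ (f' p₃))
      have key : ∀ x y, ¬ loc g' (g q) x y → ¬ loc g' (g q) (f' d₃) x ∨ ¬ loc g' (g q) (f' d₃) y :=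
        fun x y h => not_and_or.1 fun ⟨h1, h2⟩ => h (t _ _ _ (sy _ _ h1) h2)
      have key' : ∀ x y, ¬ loc g' (g q) x y → loc g' (g q) (f' d₃) x ∨ loc g' (g q) (f' d₃) y := by
        intro x y h
        rcases hx' x with rfl | h'
        · rcases hx' y with rfl | h'
          · exact absurd r h
          · exact Or.inr h'
        · exact Or.inl h'
      have a1 := key x y hxy
      have a2 := key x z hxz
      have a3 := key y z hyz
      have b1 := key' x y hxy
      have b2 := key' x z hxz
      have b3 := key' y z hyz
      tauto
    have hcard' : Fintype.card X'.1 = 4 := by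
      have c1 := hg.card
      have c2 := hg'.card
      omega
    rcases isTwoTwo_or_exists k hl' hcard' h3 with h | ⟨X₀, E, hE, h12, heq⟩
    · -- the quartet of `X'` pairs the marked leaf with a leaf of the other branch
      have hX' : quartet X'.1 a' (f' p₃) (f' d₃) (f' e₃) := by
        rw [← quartet_map g', ha', hf'x, hf'x, hf'x, hp₃, hd₃, he₃]
        exact hY1
      exact absurd (sy _ _ h2) ((quartet_iff_of_small hl' (Or.inr (Or.inr h)) _ _ _ _).1 hX').2.2.2.2
    · rw [heq μ hμ, hμ.eq_treeY hE h12]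
  have h1 := hμ.comp f g
  rw [← hf', hμ.comp, vg, vf, vf', vg'] at h1
  exact h1.symm

theorem IsMeasure.mul_sub_eq_zero (hμ : IsMeasure μ) : μ treeY * (μ treeY - μ treeZ) = 0 := by
  obtain ⟨a, hg, h22⟩ := isTwoTwo_treeZ
  rw [mul_sub, ← hμ.mul_eq_mul hg h22]
  ring

theorem IsMeasure.map {l : Type*} [CommRing l] (hμ : IsMeasure μ) (φ : k →+* l) :
    IsMeasure fun i => φ (μ i) where
  surj i hi := by rw [hμ.surj i hi, map_one]
  comp i j := by rw [hμ.comp, map_mul]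
  amalgam i f := by
    obtain ⟨ι, _, A, hA, h⟩ := hμ.amalgam i f
    exact ⟨ι, inferInstance, A, hA, (congrArg φ h).trans (map_sum φ _ _)⟩

theorem ClassMeasure.ext {μ μ' : ClassMeasure treeClass k} (h : μ.val = μ'.val) : μ = μ' := by
  cases μ
  cases μ'
  cases h
  rfl

/-- The universal measure. -/
noncomputable def universalMeasure : ClassMeasure treeClass (Theta treeClass) where
  val := Theta.cls
  val_iso X Y e := by
    rw [← sub_eq_zero, Theta.cls, ← map_one (Ideal.Quotient.mk _), ← map_sub,
      Ideal.Quotient.eq_zero_iff_mem]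
    exact Ideal.subset_span (ThetaRel.iso X Y e)
  val_comp X Y Z i j := by
    rw [← sub_eq_zero, Theta.cls, Theta.cls, Theta.cls, ← map_mul, ← map_sub,
      Ideal.Quotient.eq_zero_iff_mem]
    exact Ideal.subset_span (ThetaRel.comp X Y Z i j)
  val_amalgam X Y X' i f n A hA := by
    simp only [Theta.cls]
    rw [← sub_eq_zero, ← map_sum, ← map_sub, Ideal.Quotient.eq_zero_iff_mem]
    exact Ideal.subset_span (ThetaRel.amalgam X Y X' i f n A hA)

/-- The ring homomorphism from the universal measure ring given by a measure. -/
noncomputable def thetaHom (μ : ClassMeasure treeClass k) : Theta treeClass →+* k :=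
  Ideal.Quotient.lift _ (MvPolynomial.eval₂Hom (Int.castRingHom k) μ.val) fun p hp => by
    have h : Ideal.span {p | ThetaRel treeClass p} ≤
        RingHom.ker (MvPolynomial.eval₂Hom (Int.castRingHom k) μ.val) := by
      refine Ideal.span_le.2 ?_
      rintro p (⟨X, Y, e⟩ | ⟨X, Y, Z, i, j⟩ | ⟨X, Y, X', i, f, n, A, hA⟩)
      · simp [RingHom.mem_ker, μ.val_iso X Y e]
      · simp [RingHom.mem_ker, μ.val_comp X Y Z i j]
      · simp [RingHom.mem_ker, μ.val_amalgam X Y X' i f n A hA]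
    exact RingHom.mem_ker.1 (h hp)

theorem thetaHom_cls (μ : ClassMeasure treeClass k) (i : Emb treeClass) :
    thetaHom μ (Theta.cls i) = μ.val i := by
  rw [thetaHom, Theta.cls, Ideal.Quotient.lift_mk, MvPolynomial.coe_eval₂Hom, MvPolynomial.eval₂_X]

theorem TwoLines.mul_eq_zero : TwoLines.u * TwoLines.v = 0 := by
  rw [TwoLines.u, TwoLines.v, ← map_mul, Ideal.Quotient.eq_zero_iff_mem]
  exact Ideal.subset_span rfl

/-- The ring homomorphism from `ℤ[u, v] / (u v)` with given values at `u` and `v`. -/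
noncomputable def twoLinesHom (u v : k) (huv : u * v = 0) : TwoLines →+* k :=
  Ideal.Quotient.lift _ (MvPolynomial.eval₂Hom (Int.castRingHom k) ![u, v]) fun p hp => by
    have h : Ideal.span {(MvPolynomial.X 0 * MvPolynomial.X 1 : MvPolynomial (Fin 2) ℤ)} ≤
        RingHom.ker (MvPolynomial.eval₂Hom (Int.castRingHom k) ![u, v]) := by
      refine Ideal.span_le.2 ?_
      rintro p rfl
      simp [RingHom.mem_ker, huv]
    exact RingHom.mem_ker.1 (h hp)

theorem twoLinesHom_u (huv : u * v = 0) : twoLinesHom u v huv TwoLines.u = u := by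
  rw [twoLinesHom, TwoLines.u, Ideal.Quotient.lift_mk]
  simp

theorem twoLinesHom_v (huv : u * v = 0) : twoLinesHom u v huv TwoLines.v = v := by
  rw [twoLinesHom, TwoLines.v, Ideal.Quotient.lift_mk]
  simp

theorem TwoLines.hom_ext {φ ψ : TwoLines →+* k} (hu : φ TwoLines.u = ψ TwoLines.u)
    (hv : φ TwoLines.v = ψ TwoLines.v) : φ = ψ := by
  refine Ideal.Quotient.ringHom_ext (MvPolynomial.ringHom_ext (fun n => ?_) fun i => ?_)
  · simp
  · fin_cases i
    · exact hu
    · exact hv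

theorem Theta.hom_ext {φ ψ : Theta treeClass →+* k} (h : ∀ i, φ (Theta.cls i) = ψ (Theta.cls i)) :
    φ = ψ :=
  Ideal.Quotient.ringHom_ext (MvPolynomial.ringHom_ext (fun n => by simp) h)

/-- The universal measure ring is the coordinate ring of two lines. -/
noncomputable def thetaEquiv : Theta treeClass ≃+* TwoLines :=
  RingEquiv.ofRingHom (thetaHom (stdMeasure TwoLines.u TwoLines.v TwoLines.mul_eq_zero))
    (twoLinesHom _ _ universalMeasure.isMeasure.mul_sub_eq_zero)
    (TwoLines.hom_ext (by
      rw [RingHom.comp_apply, twoLinesHom_u]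
      exact (thetaHom_cls _ _).trans embWeight_treeY) (by
      rw [RingHom.comp_apply, twoLinesHom_v, map_sub]
      change thetaHom _ (Theta.cls treeY) - thetaHom _ (Theta.cls treeZ) = _
      rw [thetaHom_cls, thetaHom_cls]
      change embWeight _ _ treeY - embWeight _ _ treeZ = _
      rw [embWeight_treeY, embWeight_treeZ, sub_sub_cancel]
      rfl))
    (Theta.hom_ext fun i => by
      have h1 := (isMeasure_embWeight TwoLines.mul_eq_zero).map
        (twoLinesHom _ _ universalMeasure.isMeasure.mul_sub_eq_zero)
      have h2 := h1.ext universalMeasure.isMeasure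
        (by rw [embWeight_treeY, twoLinesHom_u])
        (by rw [embWeight_treeZ, map_sub, twoLinesHom_u, twoLinesHom_v, sub_sub_cancel])
      rw [RingHom.comp_apply, thetaHom_cls]
      exact congrFun h2 i)

theorem thetaEquiv_cls (i : Emb treeClass) :
    thetaEquiv (Theta.cls i) = embWeight TwoLines.u TwoLines.v i :=
  thetaHom_cls _ i

theorem existsUnique_measure (huv : u * v = 0) :
    ∃! μ : ClassMeasure treeClass k, μ.val treeY = u ∧ μ.val treeZ = u - v := by
  refine ⟨stdMeasure u v huv, ⟨embWeight_treeY, embWeight_treeZ⟩, fun μ ⟨hY, hZ⟩ => ?_⟩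
  exact ClassMeasure.ext (μ.isMeasure.ext (isMeasure_embWeight huv)
    (hY.trans embWeight_treeY.symm) (hZ.trans embWeight_treeZ.symm))

end Universal

end TreeMeasures

open TreeMeasures

theorem theorem3p4 :
    (∃ Φ : Theta treeClass ≃+* TwoLines,
      Φ (Theta.cls (treeX 1)) =
        TwoLines.u + TwoLines.v + 2 ∧
      Φ (Theta.cls (treeX 2)) =
        TwoLines.u + TwoLines.v + 1 ∧
      Φ (Theta.cls (treeX 3)) =
        TwoLines.u + TwoLines.v ∧
      (∀ m : ℕ, 4 ≤ m → Φ (Theta.cls (treeX m)) =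
        TwoLines.v + 1 -
          ((m : TwoLines) - 2) * (TwoLines.u + 1)) ∧
      Φ (Theta.cls treeY) = TwoLines.u ∧
      Φ (Theta.cls treeZ) =
        TwoLines.u - TwoLines.v) ∧
    (∀ (k : Type*) [CommRing k] [IsDomain k],
      (∀ t : k, ∃! μ : ClassMeasure treeClass k,
        μ.val treeY = t ∧ μ.val treeZ = t) ∧
      (∀ t : k, ∃! μ : ClassMeasure treeClass k,
        μ.val treeY = 0 ∧ μ.val treeZ = -t) ∧
      (∀ μ : ClassMeasure treeClass k,
        μ.val treeY = μ.val treeZ ∨ μ.val treeY = 0)) := by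
  refine ⟨⟨thetaEquiv, ?_, ?_, ?_, ?_, ?_, ?_⟩, fun k _ _ => ⟨fun t => ?_, fun t => ?_, fun μ => ?_⟩⟩
  · rw [thetaEquiv_cls, embWeight_treeX_one]
  · rw [thetaEquiv_cls, embWeight_treeX_two]
  · rw [thetaEquiv_cls, embWeight_treeX_three]
  · intro m hm
    rw [thetaEquiv_cls, embWeight_treeX hm]
  · rw [thetaEquiv_cls, embWeight_treeY]
  · rw [thetaEquiv_cls, embWeight_treeZ]
  · simpa using existsUnique_measure (mul_zero t)
  · simpa using existsUnique_measure (zero_mul t)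
  · rcases mul_eq_zero.1 μ.isMeasure.mul_sub_eq_zero with h | h
    · exact Or.inr h
    · exact Or.inl (sub_eq_zero.1 h)
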